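/- Let $r\ge 1$, $n\ge 0$, $\zeta=e^{2\pi i/r}$, let $q$ be an indeterminate and $\mathcal R=\mathbb Z[\tfrac1r][q,q^{-1},\zeta]$. Fix an enumeration $\{\zeta^k : 0\le k<r\}=\{\zeta_1,\dots,\zeta_r\}$. **The algebra.** $Y=Y_{r,n}(q)$ is the associative $\mathcal R$-algebra with generators $t_1,\dots,t_n,g_1,\dots,g_{n-1}$ and relations $g_ig_j=g_jg_i$ ($|i-j|\ge2$), $g_ig_{i+1}g_i=g_{i+1}g_ig_{i+1}$, $t_it_j=t_jt_i$, $g_it_j=t_{s_i(j)}g_i$, $t_j^r=1$, $g_i^2=1+(q-q^{-1})e_{i,i+1}g_i$, where $s_i=(i,i+1)$ and $e_{i,k}=\frac1r\sum_{s=0}^{r-1}t_i^st_k^{-s}$. For $w\in\mathfrak S_n$ of length $l(w)$ let $g_w=g_{i_1}\cdots g_{i_m}$ for a reduced expression $w=s_{i_1}\cdots s_{i_m}$. Let $*$ be the anti-automorphism of $Y$ fixing all $g_i$ and $t_j$. **Combinatorics.** An $r$-composition of $n$ is $\mu=(\mu^{(1)},\dots,\mu^{(r)})$ with $\mu^{(k)}=(\mu^{(k)}_1,\dots,\mu^{(k)}_n)\in\mathbb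 Z_{\ge0}^n$ and $\sum_{k,i}\mu^{(k)}_i=n$; it is an $r$-partition if every $\mu^{(k)}$ is non-increasing. Let $\mathcal C_{r,n}\supseteq\mathcal P_{r,n}$ be the (finite) sets of these, $\alpha(\mu)=(|\mu^{(1)}|,\dots,|\mu^{(r)}|)$. Write $\lambda\unrhd\mu$ if $\sum_{i<k}|\lambda^{(i)}|+\sum_{i\le j}\lambda^{(k)}_i\ge\sum_{i<k}|\mu^{(i)}|+\sum_{i\le j}\mu^{(k)}_i$ for all $1\le k\le r$, $j\ge0$, and $\lambda\rhd\mu$ if moreover $\lambda\ne\mu$. A $\mu$-tableau is a bijection from the diagram $[\mu]$ to $\{1,\dots,n\}$; for $\lambda\in\mathcal P_{r,n}$, $\mathrm{Std}(\lambda)$ is the set of $\lambda$-tableaux whose entries increase along rows and down columns of each component. Let $\mathfrak t^\mu$ be the $\mu$-tableau with $1,\dots,n$ entered in order along the rows of the first component, then of the second, and so on; $\mathfrak S_\mu$ is its row stabilizer, and for a $\mu$-tableau $\mathfrak s$, $d(\mathfrak s)\in\mathfrak S_n$ is defined by $\mathfrak s=\mathfrak t^\mu d(\mathfrak s)$ (right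 action on entries). For $\lambda\in\mathcal P_{r,n}$, $\mu\in\mathcal C_{r,n}$ let $\mathcal T_0^+(\lambda,\mu)$ be empty unless $\alpha(\lambda)=\alpha(\mu)$, in which case it is the set of maps $S:[\lambda]\to\{1,\dots,n\}\times\{1,\dots,r\}$ that take each value $(i,k)$ exactly $\mu^{(k)}_i$ times, are weakly increasing along rows and strictly increasing down columns of each component (pairs ordered by $(i_1,k_1)<(i_2,k_2)$ iff $k_1<k_2$, or $k_1=k_2$ and $i_1<i_2$), and have only entries $(i,l)$ with $l\ge k$ in the $k$-th component. Put $\mathcal T_0^+(\lambda)=\bigcup_{\mu\in\mathcal C_{r,n}}\mathcal T_0^+(\lambda,\mu)$. For $\mathfrak s\in\mathrm{Std}(\lambda)$, $\mu(\mathfrak s)$ is obtained from $\mathfrak s$ by replacing each entry $m$ by $(i,k)$ if $m$ lies in row $i$ of the $k$-th component of $\mathfrak t^\mu$. **Elements and modules.** For $\mu\in\mathcal C_{r,n}$ let $m_\mu=u_\mu E_\mu x_\mu$, where $u_\mu=\prod_{k:\,\mu^{(k)}\ne\emptyset}\prod_{l\ne k}(t_{a_k}-\zeta_l)$ with $a_k=\sum_{j\le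 k}|\mu^{(j)}|$, $E_\mu=\prod e_{i,j}$ over all $i<j$ lying in the same component of $\mathfrak t^\mu$, and $x_\mu=\sum_{w\in\mathfrak S_\mu}q^{l(w)}g_w$. Put $M^\mu=m_\mu Y$ (a right $Y$-module) and $\mathrm{YS}=YS_q(r,n)=\mathrm{End}_Y\big(\bigoplus_{\mu\in\mathcal C_{r,n}}M^\mu\big)$. For $S\in\mathcal T_0^+(\lambda,\mu)$, $T\in\mathcal T_0^+(\lambda,\nu)$ put $$m_{ST}=\sum_{\mathfrak s,\mathfrak t}q^{l(d(\mathfrak s))+l(d(\mathfrak t))}\,g_{d(\mathfrak s)}^{*}\,m_\lambda\, g_{d(\mathfrak t)},$$ summed over $\mathfrak s,\mathfrak t\in\mathrm{Std}(\lambda)$ with $\mu(\mathfrak s)=S$, $\nu(\mathfrak t)=T$. **Theorem.** For all $\lambda\in\mathcal P_{r,n}$ and $S\in\mathcal T_0^+(\lambda,\mu)$, $T\in\mathcal T_0^+(\lambda,\nu)$ there is a (unique) $\varphi_{ST}\in\mathrm{YS}$ with $\varphi_{ST}(m_\nu h)=m_{ST}h\in M^\mu$ for all $h\in Y$ and $\varphi_{ST}=0$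 on $M^\kappa$ for $\kappa\ne\nu$. The algebra $\mathrm{YS}$ is a free $\mathcal R$-module with basis $\{\varphi_{ST} : S,T\in\mathcal T_0^+(\lambda)\text{ for some }\lambda\in\mathcal P_{r,n}\}$, and: (i) The $\mathcal R$-linear map $*:\mathrm{YS}\to\mathrm{YS}$ with $\varphi_{ST}^*=\varphi_{TS}$ for all $S,T\in\mathcal T_0^+(\lambda)$, $\lambda\in\mathcal P_{r,n}$, is an anti-automorphism of $\mathrm{YS}$. (ii) Let $\lambda\in\mathcal P_{r,n}$, $T\in\mathcal T_0^+(\lambda)$ and $\varphi\in\mathrm{YS}$. There are $r_V=r_{V,T,\varphi}\in\mathcal R$ ($V\in\mathcal T_0^+(\lambda)$) such that for all $S\in\mathcal T_0^+(\lambda)$ $$\varphi_{ST}\,\varphi\equiv\sum_{V\in\mathcal T_0^+(\lambda)}r_V\,\varphi_{SV}\pmod{\mathrm{YS}^{\rhd\lambda}},$$ where $\mathrm{YS}^{\rhd\lambda}$ is the $\mathcal R$-span of all $\varphi_{UV}$ with $U,V\in\mathcal T_0^+(\alpha)$, $\alpha\in\mathcal P_{r,n}$, $\alpha\rhd\lambda$.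 In particular $\{\varphi_{ST}\}$ is a cellular basis of $\mathrm{YS}$ in the sense of Graham and Lehrer (with respect to the order opposite to $\unrhd$). -/

import Mathlib

namespace YokonumaSchur

noncomputable section

/-! ### The Yokonuma–Hecke algebra `Y_{r,n}(q)` -/

section Algebra

/-- `(1/r) ∑_{s=0}^{r-1} a^s b^{-s}`, for `a`, `b` with `a^r = b^r = 1` (so `b^{-s} = b^{r-s}`). -/
def eElt (R : Type*) [CommRing R] (r : ℕ) [Invertible (r : R)] {A : Type*} [Ring A] [Algebra R A]
    (a b : A) : A :=
  ⅟(r : R) • ∑ s ∈ Finset.range r, a ^ s * b ^ (r - s)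

/-- The index `i` of `{0, …, n-2}`, seen in `{0, …, n-1}`. -/
def lo {n : ℕ} (i : Fin (n - 1)) : Fin n := ⟨i, by omega⟩

/-- The index `i + 1`. -/
def hi {n : ℕ} (i : Fin (n - 1)) : Fin n := ⟨i + 1, by omega⟩

/-- The simple transposition `s_i = (i, i+1)`. -/
def simpleRefl {n : ℕ} (i : Fin (n - 1)) : Equiv.Perm (Fin n) := Equiv.swap (lo i) (hi i)

/-- Generator `t_j` in the free algebra. -/
def freeT (R : Type*) [CommRing R] {n : ℕ} (j : Fin n) : FreeAlgebra R (Fin n ⊕ Fin (n - 1)) :=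
  FreeAlgebra.ι R (Sum.inl j)

/-- Generator `g_i` in the free algebra. -/
def freeG (R : Type*) [CommRing R] {n : ℕ} (i : Fin (n - 1)) :
    FreeAlgebra R (Fin n ⊕ Fin (n - 1)) :=
  FreeAlgebra.ι R (Sum.inr i)

/-- The defining relations of the Yokonuma–Hecke algebra. -/
inductive YRel (R : Type*) [CommRing R] (r n : ℕ) [Invertible (r : R)] (q : Rˣ) :
    FreeAlgebra R (Fin n ⊕ Fin (n - 1)) → FreeAlgebra R (Fin n ⊕ Fin (n - 1)) → Prop
  | far (i j : Fin (n - 1)) (h : (i : ℕ) + 2 ≤ j ∨ (j : ℕ) + 2 ≤ i) :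
      YRel R r n q (freeG R i * freeG R j) (freeG R j * freeG R i)
  | braid (i j : Fin (n - 1)) (h : (j : ℕ) = i + 1) :
      YRel R r n q (freeG R i * freeG R j * freeG R i) (freeG R j * freeG R i * freeG R j)
  | t_comm (i j : Fin n) : YRel R r n q (freeT R i * freeT R j) (freeT R j * freeT R i)
  | g_t (i : Fin (n - 1)) (j : Fin n) :
      YRel R r n q (freeG R i * freeT R j) (freeT R (simpleRefl i j) * freeG R i)
  | t_pow (j : Fin n) : YRel R r n q (freeT R j ^ r) 1
  | quad (i : Fin (n - 1)) :
      YRel R r n q (freeG R i * freeG R i)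
        (1 + ((q : R) - ((q⁻¹ : Rˣ) : R)) •
          (eElt R r (freeT R (lo i)) (freeT R (hi i)) * freeG R i))

/-- The Yokonuma–Hecke algebra. -/
def Y (R : Type*) [CommRing R] (r n : ℕ) [Invertible (r : R)] (q : Rˣ) : Type _ :=
  RingQuot (YRel R r n q)

instance (R : Type*) [CommRing R] (r n : ℕ) [Invertible (r : R)] (q : Rˣ) : Ring (Y R r n q) :=
  inferInstanceAs (Ring (RingQuot (YRel R r n q)))

instance (R : Type*) [CommRing R] (r n : ℕ) [Invertible (r : R)] (q : Rˣ) :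
    Algebra R (Y R r n q) :=
  inferInstanceAs (Algebra R (RingQuot (YRel R r n q)))

variable {R : Type*} [CommRing R] {r n : ℕ} [Invertible (r : R)] {q : Rˣ}

/-- The quotient map from the free algebra. -/
def mkY (R : Type*) [CommRing R] (r n : ℕ) [Invertible (r : R)] (q : Rˣ) :
    FreeAlgebra R (Fin n ⊕ Fin (n - 1)) →ₐ[R] Y R r n q :=
  RingQuot.mkAlgHom R (YRel R r n q)

/-- The generator `t_j` of `Y_{r,n}`. -/
def tY (R : Type*) [CommRing R] (r : ℕ) {n : ℕ} [Invertible (r : R)] (q : Rˣ) (j : Fin n) :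
    Y R r n q := mkY R r n q (freeT R j)

/-- The generator `g_i` of `Y_{r,n}`. -/
def gY (R : Type*) [CommRing R] (r : ℕ) {n : ℕ} [Invertible (r : R)] (q : Rˣ) (i : Fin (n - 1)) :
    Y R r n q := mkY R r n q (freeG R i)

theorem map_eElt {A B : Type*} [Ring A] [Algebra R A] [Ring B] [Algebra R B] (f : A →ₐ[R] B)
    (a b : A) : f (eElt R r a b) = eElt R r (f a) (f b) := by
  simp [eElt]

theorem mkY_rel {x y : FreeAlgebra R (Fin n ⊕ Fin (n - 1))} (h : YRel R r n q x y) :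
    mkY R r n q x = mkY R r n q y := RingQuot.mkAlgHom_rel R h

theorem tY_comm (i j : Fin n) : tY R r q i * tY R r q j = tY R r q j * tY R r q i := by
  simpa [tY] using mkY_rel (YRel.t_comm (R := R) (r := r) (q := q) i j)

theorem tY_pow (j : Fin n) : tY R r q j ^ r = 1 := by
  simpa [tY] using mkY_rel (YRel.t_pow (R := R) (r := r) (q := q) j)

theorem gY_mul_tY (i : Fin (n - 1)) (j : Fin n) :
    gY R r q i * tY R r q j = tY R r q (simpleRefl i j) * gY R r q i := by
  simpa [tY, gY] using mkY_rel (YRel.g_t (R := R) (r := r) (q := q) i j)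

theorem gY_far (i j : Fin (n - 1)) (h : (i : ℕ) + 2 ≤ j ∨ (j : ℕ) + 2 ≤ i) :
    gY R r q i * gY R r q j = gY R r q j * gY R r q i := by
  simpa [gY] using mkY_rel (YRel.far (R := R) (r := r) (q := q) i j h)

theorem gY_braid (i j : Fin (n - 1)) (h : (j : ℕ) = i + 1) :
    gY R r q i * gY R r q j * gY R r q i = gY R r q j * gY R r q i * gY R r q j := by
  simpa [gY] using mkY_rel (YRel.braid (R := R) (r := r) (q := q) i j h)

theorem gY_quad (i : Fin (n - 1)) :
    gY R r q i * gY R r q i = 1 + ((q : R) - ((q⁻¹ : Rˣ) : R)) •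
      (eElt R r (tY R r q (lo i)) (tY R r q (hi i)) * gY R r q i) := by
  have h := mkY_rel (YRel.quad (R := R) (r := r) (q := q) i)
  rw [map_mul, map_add, map_one, map_smul, map_mul, map_eElt] at h
  exact h

theorem eElt_symm {A : Type*} [Ring A] [Algebra R A] {a b : A} (hab : Commute a b)
    (ha : a ^ r = 1) (hb : b ^ r = 1) : eElt R r a b = eElt R r b a := by
  unfold eElt
  congr 1
  rcases Nat.eq_zero_or_pos r with h | h
  · subst h; simp
  obtain ⟨k, rfl⟩ : ∃ k, r = k + 1 := ⟨r - 1, by omega⟩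
  rw [Finset.sum_range_succ', Finset.sum_range_succ', ← Finset.sum_range_reflect]
  congr 1
  · refine Finset.sum_congr rfl fun j hj => ?_
    have hj := Finset.mem_range.1 hj
    have h1 : k - 1 - j + 1 = k + 1 - (j + 1) := by omega
    have h2 : k + 1 - (k - 1 - j + 1) = j + 1 := by omega
    rw [h2, h1]
    exact (hab.pow_pow _ _).eq
  · simp [ha, hb]

theorem gY_mul_eElt (i : Fin (n - 1)) :
    gY R r q i * eElt R r (tY R r q (lo i)) (tY R r q (hi i)) =
      eElt R r (tY R r q (lo i)) (tY R r q (hi i)) * gY R r q i := by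
  have hs : ∀ (j : Fin n) (k : ℕ),
      gY R r q i * tY R r q j ^ k = tY R r q (simpleRefl i j) ^ k * gY R r q i := by
    intro j k
    exact (SemiconjBy.pow_right (gY_mul_tY i j) k).eq
  have h1 : gY R r q i * eElt R r (tY R r q (lo i)) (tY R r q (hi i)) =
      eElt R r (tY R r q (hi i)) (tY R r q (lo i)) * gY R r q i := by
    simp only [eElt, mul_smul_comm, smul_mul_assoc, Finset.mul_sum, Finset.sum_mul]
    congr 1
    refine Finset.sum_congr rfl fun s _ => ?_
    rw [← mul_assoc, hs, mul_assoc, hs, ← mul_assoc]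
    simp [simpleRefl]
  rw [h1, eElt_symm (tY_comm _ _) (tY_pow _) (tY_pow _)]

/-- The images of the generators in the opposite algebra. -/
def starGen (R : Type*) [CommRing R] (r n : ℕ) [Invertible (r : R)] (q : Rˣ) :
    Fin n ⊕ Fin (n - 1) → (Y R r n q)ᵐᵒᵖ :=
  Sum.elim (fun j => MulOpposite.op (tY R r q j)) (fun i => MulOpposite.op (gY R r q i))

theorem starGen_rel {x y : FreeAlgebra R (Fin n ⊕ Fin (n - 1))} (h : YRel R r n q x y) :
    FreeAlgebra.lift R (starGen R r n q) x = FreeAlgebra.lift R (starGen R r n q) y := by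
  have hT : ∀ j, FreeAlgebra.lift R (starGen R r n q) (freeT R j) =
      MulOpposite.op (tY R r q j) := fun j => by simp [freeT, starGen]
  have hG : ∀ i, FreeAlgebra.lift R (starGen R r n q) (freeG R i) =
      MulOpposite.op (gY R r q i) := fun i => by simp [freeG, starGen]
  cases h with
  | far i j h =>
    simp only [map_mul, hG, ← MulOpposite.op_mul]
    rw [gY_far i j h]
  | braid i j h =>
    simp only [map_mul, hG, ← MulOpposite.op_mul]
    rw [← mul_assoc, ← mul_assoc, gY_braid i j h]
  | t_comm i j =>
    simp only [map_mul, hT, ← MulOpposite.op_mul]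
    rw [tY_comm]
  | g_t i j =>
    simp only [map_mul, hT, hG, ← MulOpposite.op_mul]
    rw [gY_mul_tY]
    simp [simpleRefl]
  | t_pow j =>
    simp only [map_pow, hT, map_one, ← MulOpposite.op_pow]
    rw [tY_pow]
    simp
  | quad i =>
    simp only [map_mul, map_add, map_one, map_smul, map_eElt, hT, hG]
    have he : eElt R r (MulOpposite.op (tY R r q (lo i))) (MulOpposite.op (tY R r q (hi i))) =
        MulOpposite.op (eElt R r (tY R r q (lo i)) (tY R r q (hi i))) := by
      simp only [eElt, MulOpposite.op_smul, Finset.op_sum, ← MulOpposite.op_pow,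
        ← MulOpposite.op_mul]
      congr 2
      funext s
      rw [(Commute.pow_pow (tY_comm (R := R) (r := r) (q := q) (lo i) (hi i)) s (r - s)).eq]
    rw [he, ← MulOpposite.op_mul, ← MulOpposite.op_mul, gY_mul_eElt, gY_quad]
    simp

/-- The anti-automorphism `*` of `Y_{r,n}` fixing the generators, as a homomorphism to the
opposite algebra. -/
def starHom (R : Type*) [CommRing R] (r n : ℕ) [Invertible (r : R)] (q : Rˣ) :
    Y R r n q →ₐ[R] (Y R r n q)ᵐᵒᵖ :=
  RingQuot.liftAlgHom R ⟨FreeAlgebra.lift R (starGen R r n q), fun _ _ h => starGen_rel h⟩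

/-- The anti-automorphism `*` of `Y_{r,n}`, with `g_i^* = g_i` and `t_j^* = t_j`. -/
def starY (h : Y R r n q) : Y R r n q := (starHom R r n q h).unop

theorem starY_tY (j : Fin n) : starY (tY R r q j) = tY R r q j := by
  have h : starHom R r n q (mkY R r n q (freeT R j)) = _ :=
    RingQuot.liftAlgHom_mkAlgHom_apply R _ (fun _ _ h => starGen_rel h) (freeT R j)
  rw [starY, tY, h]
  simp [freeT, starGen, tY]

theorem starY_gY (i : Fin (n - 1)) : starY (gY R r q i) = gY R r q i := by
  have h : starHom R r n q (mkY R r n q (freeG R i)) = _ :=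
    RingQuot.liftAlgHom_mkAlgHom_apply R _ (fun _ _ h => starGen_rel h) (freeG R i)
  rw [starY, gY, h]
  simp [freeG, starGen, gY]

theorem starY_mul (a b : Y R r n q) : starY (a * b) = starY b * starY a := by
  simp [starY]

end Algebra

/-! ### Words, length and the elements `g_w` -/

/-- Permutations are multiplied as functions, `(v * w) j = v (w j)`. -/
def wordProd {n : ℕ} (l : List (Fin (n - 1))) : Equiv.Perm (Fin n) := (l.map simpleRefl).prod

theorem exists_word {n : ℕ} (w : Equiv.Perm (Fin n)) : ∃ l, wordProd l = w := by
  rcases n with _ | n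
  · exact ⟨[], Subsingleton.elim _ _⟩
  have hw : w ∈ Submonoid.closure
      (Set.range fun i : Fin n => Equiv.swap i.castSucc i.succ) := by
    rw [Equiv.Perm.mclosure_swap_castSucc_succ]; trivial
  induction hw using Submonoid.closure_induction with
  | mem x hx =>
    obtain ⟨i, rfl⟩ := hx
    exact ⟨[i], by simp [wordProd, simpleRefl]; rfl⟩
  | one => exact ⟨[], rfl⟩
  | mul x y _ _ hx hy =>
    obtain ⟨l, rfl⟩ := hx
    obtain ⟨m, rfl⟩ := hy
    exact ⟨l ++ m, by simp [wordProd]⟩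

/-- The length `l(w)`: the least length of a word in the simple transpositions with product `w`. -/
def len {n : ℕ} (w : Equiv.Perm (Fin n)) : ℕ :=
  sInf {k | ∃ l : List (Fin (n - 1)), wordProd l = w ∧ l.length = k}

theorem exists_reducedWord {n : ℕ} (w : Equiv.Perm (Fin n)) :
    ∃ l : List (Fin (n - 1)), wordProd l = w ∧ l.length = len w := by
  obtain ⟨l, hl⟩ := exists_word w
  exact Nat.sInf_mem (s := {k | ∃ l : List (Fin (n - 1)), wordProd l = w ∧ l.length = k})
    ⟨l.length, l, hl, rfl⟩

/-- A reduced expression of `w`. -/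
def reducedWord {n : ℕ} (w : Equiv.Perm (Fin n)) : List (Fin (n - 1)) :=
  (exists_reducedWord w).choose

/-- `g_w = g_{i_1} ⋯ g_{i_k}` for a reduced expression `w = s_{i_1} ⋯ s_{i_k}`; by Matsumoto's
lemma the choice of the expression is immaterial. -/
def gPerm (R : Type*) [CommRing R] (r : ℕ) {n : ℕ} [Invertible (r : R)] (q : Rˣ)
    (w : Equiv.Perm (Fin n)) : Y R r n q :=
  ((reducedWord w).map (gY R r q)).prod

/-! ### Multicompositions, multipartitions and tableaux -/

/-- `r`-compositions of `n`; every component is a sequence of `n` nonnegative integers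
(compositions are taken up to trailing zeros and have at most `n` rows). -/
def RComp (r n : ℕ) : Type := {μ : Fin r → Fin n → ℕ // ∑ k, ∑ i, μ k i = n}

instance (r n : ℕ) : DecidableEq (RComp r n) := inferInstanceAs (DecidableEq (Subtype _))

variable {r n : ℕ}

/-- The `i`-th part of the `k`-th component. -/
def RComp.part (μ : RComp r n) (k : Fin r) (i : Fin n) : ℕ := μ.1 k i

/-- `|μ^{(k)}|`, so that `μ.size = α(μ)` is the type of `μ`. -/
def RComp.size (μ : RComp r n) (k : Fin r) : ℕ := ∑ i, μ.part k i

theorem RComp.sum_size (μ : RComp r n) : ∑ k, μ.size k = n := μ.2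

theorem RComp.part_le (μ : RComp r n) (k : Fin r) (i : Fin n) : μ.part k i ≤ n := by
  calc μ.part k i ≤ μ.size k :=
        Finset.single_le_sum (f := μ.part k) (fun _ _ => Nat.zero_le _) (Finset.mem_univ i)
    _ ≤ ∑ k, μ.size k :=
        Finset.single_le_sum (f := μ.size) (fun _ _ => Nat.zero_le _) (Finset.mem_univ k)
    _ = n := μ.sum_size

instance (r n : ℕ) : Finite (RComp r n) := by
  refine Finite.of_injective
    (fun (μ : RComp r n) (k : Fin r) (i : Fin n) =>
      (⟨μ.part k i, Nat.lt_succ_of_le (μ.part_le k i)⟩ : Fin (n + 1))) ?_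
  intro μ ν h
  apply Subtype.ext
  funext k i
  exact congrArg Fin.val (congrFun (congrFun h k) i)

instance (r n : ℕ) : Fintype (RComp r n) := Fintype.ofFinite _

/-- `r`-partitions of `n`. -/
def RPart (r n : ℕ) : Type := {l : RComp r n // ∀ k, Antitone (l.part k)}

/-- The underlying `r`-composition. -/
def RPart.toComp (l : RPart r n) : RComp r n := l.1

/-- `∑_{i<k} |μ^{(i)}| + ∑_{i≤j} μ^{(k)}_i` (the last sum is over the first `j` rows). -/
def RComp.partialSum (μ : RComp r n) (k : Fin r) (j : ℕ) : ℕ :=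
  ∑ i ∈ Finset.univ.filter (· < k), μ.size i +
    ∑ i ∈ Finset.univ.filter (fun i : Fin n => (i : ℕ) < j), μ.part k i

theorem RComp.partialSum_injective :
    Function.Injective (RComp.partialSum : RComp r n → Fin r → ℕ → ℕ) := by
  intro μ ν h
  have key : ∀ (κ : RComp r n) (k : Fin r) (i : Fin n),
      κ.partialSum k (i + 1) = κ.partialSum k i + κ.part k i := by
    intro κ k i
    have : (Finset.univ.filter fun a : Fin n => (a : ℕ) < i + 1) =
        insert i (Finset.univ.filter fun a : Fin n => (a : ℕ) < i) := by
      ext a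
      simp only [Finset.mem_filter, Finset.mem_univ, true_and, Finset.mem_insert, Fin.ext_iff]
      omega
    rw [partialSum, this, Finset.sum_insert (by simp), partialSum]
    omega
  apply Subtype.ext
  funext k i
  have h1 := key μ k i
  have h2 := key ν k i
  rw [h] at h1
  change μ.part k i = ν.part k i
  omega

/-- The dominance order on `r`-compositions. -/
instance : PartialOrder (RComp r n) := PartialOrder.lift _ RComp.partialSum_injective

/-- The dominance order on `r`-partitions: `μ < l` means `l ▷ μ`. -/
instance : PartialOrder (RPart r n) := PartialOrder.lift RPart.toComp Subtype.val_injective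

/-- The nodes of the diagram `[μ]`: `⟨k, i, j⟩` is the node in row `i` and column `j` of the
`k`-th component. -/
abbrev Node (μ : RComp r n) : Type := Σ k : Fin r, Σ i : Fin n, Fin (μ.part k i)

/-- `μ`-tableaux: bijections from the diagram to `{1, …, n}` (here `{0, …, n-1}`). -/
abbrev Tableau (μ : RComp r n) : Type := Node μ ≃ Fin n

/-- The tableau `t^μ`, with entries increasing along the rows of the first component, then along
the rows of the second component, and so on. -/
def tInit (μ : RComp r n) : Tableau μ :=
  ((Equiv.sigmaCongrRight fun _ => finSigmaFinEquiv).trans finSigmaFinEquiv).trans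
    (finCongr μ.sum_size)

/-- Row standard tableaux. -/
def IsRowStandard {μ : RComp r n} (t : Tableau μ) : Prop :=
  ∀ k i, StrictMono fun j : Fin (μ.part k i) => t ⟨k, i, j⟩

/-- Standard tableaux (used for shapes that are multipartitions). -/
def IsStandard {μ : RComp r n} (t : Tableau μ) : Prop :=
  IsRowStandard t ∧ ∀ (k : Fin r) (i i' : Fin n) (j : ℕ) (h : j < μ.part k i)
    (h' : j < μ.part k i'), i < i' → t ⟨k, i, ⟨j, h⟩⟩ < t ⟨k, i', ⟨j, h'⟩⟩

/-- `Std(l)`. -/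
def Std (l : RPart r n) : Type := {t : Tableau l.toComp // IsStandard t}

instance (l : RPart r n) : Finite (Std l) := inferInstanceAs (Finite (Subtype _))

instance (l : RPart r n) : Fintype (Std l) := Fintype.ofFinite _

/-- `d(s)`, with `s = t^μ d(s)`. In that equation permutations act on the right, so that
`s_{i_1} ⋯ s_{i_k}` applies `s_{i_1}` first; for permutations multiplied as functions it reads
`s = d(s)⁻¹ ∘ t^μ`. -/
def dPerm {μ : RComp r n} (s : Tableau μ) : Equiv.Perm (Fin n) := s.symm.trans (tInit μ)

theorem dPerm_spec {μ : RComp r n} (s : Tableau μ) (x : Node μ) :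
    s x = (dPerm s)⁻¹ (tInit μ x) := by
  rw [Equiv.Perm.eq_inv_iff_eq]
  simp [dPerm]

/-- The component and the row of `t^μ` in which `m` stands; the pair `(i, k)` (row `i`, component
`k`) is written `(k, i)`, so that the order on pairs is the lexicographic one. -/
def rowOf (μ : RComp r n) (m : Fin n) : Fin r ×ₗ Fin n :=
  toLex (((tInit μ).symm m).1, ((tInit μ).symm m).2.1)

/-- The component `p_μ(m)` of `t^μ` in which `m` stands. -/
def compOf (μ : RComp r n) (m : Fin n) : Fin r := ((tInit μ).symm m).1

/-! ### The elements `m_μ` and `m_{st}` -/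

section Elements

variable {R : Type*} [CommRing R] [Invertible (r : R)]

/-- `E_{A_μ}`: the product of all `e_{i,j}`, `i < j`, with `i`, `j` in the same block of `A_μ`,
that is, in the same component of `t^μ`. (The factors commute.) -/
def EElt (q : Rˣ) (μ : RComp r n) : Y R r n q :=
  (((List.finRange n ×ˢ List.finRange n).filter
      fun p => p.1 < p.2 ∧ compOf μ p.1 = compOf μ p.2).map
    fun p => eElt R r (tY R r q p.1) (tY R r q p.2)).prod

/-- `u_{i,k} = ∏_{l ≠ k} (t_i - ζ_l)`, where `z l = ζ_l`. (The factors commute.) -/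
def uFactor (q : Rˣ) (z : Fin r → R) (i : Fin n) (k : Fin r) : Y R r n q :=
  (((List.finRange r).filter (· ≠ k)).map
    fun l => tY R r q i - algebraMap R (Y R r n q) (z l)).prod

theorem RComp.sum_le_lt (μ : RComp r n) (k : Fin r) (h : 0 < μ.size k) :
    ∑ j ∈ Finset.univ.filter (· ≤ k), μ.size j - 1 < n := by
  have h1 : ∑ j ∈ Finset.univ.filter (· ≤ k), μ.size j ≤ n := by
    conv_rhs => rw [← μ.sum_size]
    exact Finset.sum_le_sum_of_subset (Finset.filter_subset _ _)
  have h2 : μ.size k ≤ ∑ j ∈ Finset.univ.filter (· ≤ k), μ.size j :=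
    Finset.single_le_sum (f := μ.size) (fun _ _ => Nat.zero_le _) (by simp)
  omega

/-- `u_μ = ∏ u_{a_k,k}` over the nonempty components `k` of `μ`, with
`a_k = ∑_{j ≤ k} |μ^{(j)}|` (which is the index `a_k - 1` of `{0, …, n-1}`). -/
def uElt (q : Rˣ) (z : Fin r → R) (μ : RComp r n) : Y R r n q :=
  ((List.finRange r).map fun k =>
    if h : 0 < μ.size k then
      uFactor q z ⟨∑ j ∈ Finset.univ.filter (· ≤ k), μ.size j - 1, μ.sum_le_lt k h⟩ k
    else 1).prod

open scoped Classical in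
/-- The Young subgroup `S_μ`, the row stabilizer of `t^μ`. -/
def youngSubgroup (μ : RComp r n) : Finset (Equiv.Perm (Fin n)) :=
  Finset.univ.filter fun w => ∀ m, rowOf μ (w m) = rowOf μ m

/-- `x_μ = ∑_{w ∈ S_μ} q^{l(w)} g_w`. -/
def xElt (q : Rˣ) (μ : RComp r n) : Y R r n q :=
  ∑ w ∈ youngSubgroup μ, (q : R) ^ len w • gPerm R r q w

/-- `m_μ = u_μ E_{A_μ} x_μ`. -/
def mElt (q : Rˣ) (z : Fin r → R) (μ : RComp r n) : Y R r n q :=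
  uElt q z μ * EElt q μ * xElt q μ

/-- `m_{st} = g_{d(s)}^* m_μ g_{d(t)}`. -/
def mTab (q : Rˣ) (z : Fin r → R) {μ : RComp r n} (s t : Tableau μ) : Y R r n q :=
  starY (gPerm R r q (dPerm s)) * mElt q z μ * gPerm R r q (dPerm t)

end Elements

/-! ### Semistandard tableaux -/

/-- The `l`-tableau `S` (entries `(k, i)` for row `i` of component `k`) has type `μ`. -/
def HasType {l : RComp r n} (S : Node l → Fin r ×ₗ Fin n) (μ : RComp r n) : Prop :=
  ∀ k i, Nat.card {x // S x = toLex (k, i)} = μ.part k i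

/-- The set `T_0(l, μ)` of semistandard `l`-tableaux of type `μ`. -/
def T0 (l : RPart r n) (μ : RComp r n) : Set (Node l.toComp → Fin r ×ₗ Fin n) :=
  {S | HasType S μ ∧
    (∀ k i, Monotone fun j : Fin (l.toComp.part k i) => S ⟨k, i, j⟩) ∧
    (∀ (k : Fin r) (i i' : Fin n) (j : ℕ) (h : j < l.toComp.part k i)
      (h' : j < l.toComp.part k i'), i < i' → S ⟨k, i, ⟨j, h⟩⟩ < S ⟨k, i', ⟨j, h'⟩⟩) ∧
    ∀ x, x.1 ≤ (ofLex (S x)).1}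

/-- `T_0^+(l, μ) = {S ∈ T_0(l, μ) | α(l) = α(μ)}`. -/
def T0plus (l : RPart r n) (μ : RComp r n) : Set (Node l.toComp → Fin r ×ₗ Fin n) :=
  {S | S ∈ T0 l μ ∧ l.toComp.size = μ.size}

/-- `T_0^+(l) = ⋃_μ T_0^+(l, μ)`. The union is disjoint as a tableau determines its type; an
element is recorded together with its type. -/
def SST (l : RPart r n) : Type := Σ μ : RComp r n, T0plus l μ

instance (l : RPart r n) : Finite (SST l) := by
  have : Finite (Fin r ×ₗ Fin n) := inferInstanceAs (Finite (Fin r × Fin n))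
  exact inferInstanceAs (Finite (Σ μ : RComp r n, T0plus l μ))

instance (l : RPart r n) : Fintype (SST l) := Fintype.ofFinite _

/-- The type of `S`. -/
def SST.type {l : RPart r n} (S : SST l) : RComp r n := S.1

/-- The tableau itself. -/
def SST.tab {l : RPart r n} (S : SST l) : Node l.toComp → Fin r ×ₗ Fin n := S.2.1

/-- `μ(s)`: replace each entry `m` of `s` by the row and component of `t^μ` containing `m`. -/
def typeMap {l : RComp r n} (μ : RComp r n) (s : Tableau l) : Node l → Fin r ×ₗ Fin n :=
  fun x => rowOf μ (s x)

/-! ### The Yokonuma–Schur algebra -/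

section Schur

variable {R : Type*} [CommRing R] [Invertible (r : R)]

open scoped Classical in
/-- `m_{ST} = ∑ q^{l(d(s)) + l(d(t))} m_{st}`, over `s, t ∈ Std(l)` with `μ(s) = S`, `ν(t) = T`,
where `μ`, `ν` are the types of `S`, `T`. -/
def mSST (q : Rˣ) (z : Fin r → R) {l : RPart r n} (S T : SST l) : Y R r n q :=
  ∑ s ∈ Finset.univ.filter (fun s : Std l => typeMap S.type s.1 = S.tab),
    ∑ t ∈ Finset.univ.filter (fun t : Std l => typeMap T.type t.1 = T.tab),
      (q : R) ^ (len (dPerm s.1) + len (dPerm t.1)) • mTab q z s.1 t.1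

/-- The right module `M^μ = m_μ Y_{r,n}`; right modules are modules over the opposite algebra. -/
def MMod (q : Rˣ) (z : Fin r → R) (μ : RComp r n) : Submodule (Y R r n q)ᵐᵒᵖ (Y R r n q) :=
  Submodule.span _ {mElt q z μ}

theorem mElt_mul_mem (q : Rˣ) (z : Fin r → R) (μ : RComp r n) (h : Y R r n q) :
    mElt q z μ * h ∈ MMod q z μ :=
  (MMod q z μ).smul_mem (MulOpposite.op h) (Submodule.subset_span rfl)

/-- `M^μ` as a type. -/
def MType (q : Rˣ) (z : Fin r → R) (μ : RComp r n) : Type _ := MMod q z μ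

instance (q : Rˣ) (z : Fin r → R) (μ : RComp r n) : AddCommGroup (MType q z μ) :=
  inferInstanceAs (AddCommGroup (MMod q z μ))

instance (q : Rˣ) (z : Fin r → R) (μ : RComp r n) : Module (Y R r n q)ᵐᵒᵖ (MType q z μ) :=
  inferInstanceAs (Module (Y R r n q)ᵐᵒᵖ (MMod q z μ))

instance (q : Rˣ) (z : Fin r → R) (μ : RComp r n) : Module R (MType q z μ) :=
  inferInstanceAs (Module R (MMod q z μ))

instance (q : Rˣ) (z : Fin r → R) (μ : RComp r n) :
    IsScalarTower R (Y R r n q)ᵐᵒᵖ (MType q z μ) :=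
  inferInstanceAs (IsScalarTower R (Y R r n q)ᵐᵒᵖ (MMod q z μ))

instance (q : Rˣ) (z : Fin r → R) (μ : RComp r n) :
    SMulCommClass (Y R r n q)ᵐᵒᵖ R (MType q z μ) :=
  inferInstanceAs (SMulCommClass (Y R r n q)ᵐᵒᵖ R (MMod q z μ))

/-- The element `x` of `M^μ`. -/
def MType.mk {q : Rˣ} {z : Fin r → R} {μ : RComp r n} (x : Y R r n q) (hx : x ∈ MMod q z μ) :
    MType q z μ := ⟨x, hx⟩

/-- The permutation module `⨁_μ M^μ`, over all `r`-compositions `μ` of `n`. -/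
abbrev MSum (n : ℕ) (q : Rˣ) (z : Fin r → R) : Type _ :=
  DirectSum (RComp r n) fun μ => MType q z μ

/-- The Yokonuma–Schur algebra `End_{Y_{r,n}}(⨁_μ M^μ)`. -/
abbrev YS (n : ℕ) (q : Rˣ) (z : Fin r → R) : Type _ :=
  Module.End (Y R r n q)ᵐᵒᵖ (MSum n q z)

/-- The inclusion `M^μ → ⨁_μ M^μ`. -/
def incl (q : Rˣ) (z : Fin r → R) (μ : RComp r n) :
    MType q z μ →ₗ[(Y R r n q)ᵐᵒᵖ] MSum n q z :=
  DirectSum.lof (Y R r n q)ᵐᵒᵖ (RComp r n) (fun μ => MType q z μ) μ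

/-- `f` is `φ_{ST}`, for `S` of type `μ` and `T` of type `ν`: it maps `m_ν h ∈ M^ν` to
`m_{ST} h ∈ M^μ` for all `h`, and it vanishes on `M^κ` for `κ ≠ ν`. -/
def IsPhi {q : Rˣ} {z : Fin r → R} {l : RPart r n} (S T : SST l) (f : YS n q z) : Prop :=
  (∀ h : Y R r n q, ∃ hm : mSST q z S T * h ∈ MMod q z S.type,
    f (incl q z T.type (MType.mk (mElt q z T.type * h) (mElt_mul_mem q z T.type h))) =
      incl q z S.type (MType.mk (mSST q z S T * h) hm)) ∧
  ∀ κ, κ ≠ T.type → ∀ x : MType q z κ, f (incl q z κ x) = 0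

end Schur

/-! ### Cellular bases -/

section Cellular

variable {R A Λ : Type*} [CommRing R] [Ring A] [Algebra R A] [PartialOrder Λ]
  {T : Λ → Type*}

/-- The `R`-submodule spanned by the basis elements attached to some `m > l`. -/
def cellAbove (b : Module.Basis (Σ l, T l × T l) R A) (l : Λ) : Submodule R A :=
  Submodule.span R {a | ∃ (m : Λ) (U V : T m), l < m ∧ a = b ⟨m, U, V⟩}

/-- Cellular bases in the sense of Graham and Lehrer (with the order on `Λ` reversed). -/
structure IsCellularBasis [∀ l, Fintype (T l)] (b : Module.Basis (Σ l, T l × T l) R A) :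
    Prop where
  exists_involution : ∃ star : A →ₗ[R] A, (∀ a, star (star a) = a) ∧
    (∀ a c, star (a * c) = star c * star a) ∧ ∀ l (U V : T l), star (b ⟨l, U, V⟩) = b ⟨l, V, U⟩
  mul_rule : ∀ (l : Λ) (a : A), ∃ c : T l → T l → R, ∀ U V : T l,
    a * b ⟨l, U, V⟩ - ∑ W, c W U • b ⟨l, W, V⟩ ∈ cellAbove b l

end Cellular

/-! ### The ground ring `ℤ[1/r][q, q⁻¹, ζ]` -/

section Ground

/-- `ζ = e^{2πi/r}`. -/
def zetaC (r : ℕ) : ℂ := Complex.exp (2 * Real.pi * Complex.I / r)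

/-- The ring `ℤ[1/r, ζ]`. -/
abbrev Coeff (r : ℕ) : Type := Algebra.adjoin ℤ ({(r : ℂ)⁻¹, zetaC r} : Set ℂ)

/-- `ℛ = ℤ[1/r][q, q⁻¹, ζ]`, the Laurent polynomials in the indeterminate `q`. -/
def Ground (r : ℕ) : Type := LaurentPolynomial (Coeff r)

instance (r : ℕ) : CommRing (Ground r) := inferInstanceAs (CommRing (LaurentPolynomial (Coeff r)))

/-- The inclusion of the constants `ℤ[1/r, ζ]` in `ℛ`. -/
def constGround (r : ℕ) : Coeff r →+* Ground r := LaurentPolynomial.C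

instance (r : ℕ) [NeZero r] : Invertible ((r : ℕ) : Ground r) where
  invOf := constGround r ⟨(r : ℂ)⁻¹, Algebra.subset_adjoin (by simp)⟩
  invOf_mul_self := by
    rw [← map_natCast (constGround r), ← map_mul, ← map_one
      (constGround r)]
    congr 1
    apply Subtype.ext
    simp [NeZero.ne r]
  mul_invOf_self := by
    rw [← map_natCast (constGround r), ← map_mul, ← map_one
      (constGround r)]
    congr 1
    apply Subtype.ext
    simp [NeZero.ne r]

/-- The indeterminate `q`. -/
def qGround (r : ℕ) : (Ground r)ˣ where
  val := (LaurentPolynomial.T 1 : LaurentPolynomial (Coeff r))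
  inv := (LaurentPolynomial.T (-1) : LaurentPolynomial (Coeff r))
  val_inv := (LaurentPolynomial.T_add (R := Coeff r) 1 (-1)).symm.trans (by simp; rfl)
  inv_val := (LaurentPolynomial.T_add (R := Coeff r) (-1) 1).symm.trans (by simp; rfl)

/-- `ζ` as an element of `ℛ`. -/
def zetaGround (r : ℕ) : Ground r :=
  constGround r ⟨zetaC r, Algebra.subset_adjoin (by simp)⟩

/-- The enumeration `ζ_l = ζ^{σ(l)}` of the `r`-th roots of unity given by `σ`. -/
def roots {r : ℕ} (σ : Equiv.Perm (Fin r)) (l : Fin r) : Ground r := zetaGround r ^ (σ l : ℕ)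

end Ground

end

end YokonumaSchur

open YokonumaSchur

namespace YokonumaSchur

noncomputable section

/-! ### Inversions, length and Matsumoto's lemma -/

section Inversions

variable {n : ℕ} {α : Type*} [LinearOrder α]

/-! The whole algebra is realised on words. A letter is a pair (colour, row), and $Y$ acts from the
right on the free module with basis the words of length $n$: $t_j$ multiplies a word by the root of
unity of its $j$-th colour, and $g_i$ exchanges the letters in places $i,i+1$, with the usual Hecke
correction if their colours agree and none if they differ. The words of content $\nu$ span a module
generated by the nondecreasing word $v_\nu$, and it is universal for vectors with the eigenvalue
relations of $m_\nu$ (`IsVec`, `uHom`). As $m_\nu$ acts on $v_\nu$ by a nonzero scalar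
(`IsVec.ract_mElt`), this module is $M^\nu$. Hence $\bigoplus_\mu M^\mu$ is the module of words
(`toMSum_bijective`), and YS is the algebra `endAlg` of matrices that commute with all $g_i$ and
$t_j$ (`ysEquiv`). The generators act by symmetric matrices, so transposition is an
anti-automorphism of `endAlg`; this is the involution.

For $T$ of shape $\lambda$ and type $\nu$ let $\eta_T$ take $v_\nu$ to $\sum_u
q^{\mathrm{inv}(u)}u$, over the words $u$ whose joint multiplicities with $v_\nu$ are the numbers of
entries of each kind in each row of $T$. These $u$ correspond to the standard tableaux $\mathfrak t$
with $\nu(\mathfrak t)=T$, and $\varphi_{ST}=\eta_S^{\mathsf T}\eta_T$ (`isPhi_phiMat`). So (i)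
becomes $(\eta_S^{\mathsf T}\eta_T)^{\mathsf T}=\eta_T^{\mathsf T}\eta_S$.

Linear independence comes from linear forms indexed by the same pairs $(S,T)$: apply a matrix to the
vector antisymmetrised along the columns of $T$, and read off the coefficient at the column reading
of $S$ (`pairing`). The values on the $\varphi_{UV}$ form a matrix that is triangular for dominance
of shapes and then for a Bruhat-like order on tableaux, with units on the diagonal (`isUnit_gram`).
For spanning, an element of `endAlg` is determined by its entries at sorted pairs of words, and
there are at most as many of these as pairs $(S,T)$, by an injection of Robinson–Schensted–Knuth
type (`rsk_injective`). An element killed by all the forms therefore vanishes, by a count of ranks,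
and the invertibility of the Gram matrix over $\mathcal R$ gives spanning over $\mathcal R$ itself
(`span_phiEnd`).

For (ii), let $P_\lambda$ be the projection to the words of content $\lambda$. A tableau of type
$\lambda$ has shape $\unrhd\lambda$, and if its shape is $\lambda$ its $\eta$ is $P_\lambda$.
Expanding in the basis, $FP_\lambda$ is a combination of the $\eta_U^{\mathsf T}$ with $U$ of shape
$\lambda$ and of $\varphi$'s of larger shape (`mem_sup_of_mul_contProj`). Applied to
$F\eta_S^{\mathsf T}$ and multiplied by $\eta_T$ this is the multiplication rule, with coefficients
independent of $T$, once the span of the larger shapes is known to be a right ideal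
(`mul_mem_shapeSpan`). -/

theorem lo_lt_hi (i : Fin (n - 1)) : lo i < hi i := by simp [lo, hi, Fin.lt_def]

theorem lo_ne_hi (i : Fin (n - 1)) : lo i ≠ hi i := (lo_lt_hi i).ne

@[simp] theorem simpleRefl_lo (i : Fin (n - 1)) : simpleRefl i (lo i) = hi i := by
  simp [simpleRefl]

@[simp] theorem simpleRefl_hi (i : Fin (n - 1)) : simpleRefl i (hi i) = lo i := by
  simp [simpleRefl]

@[simp] theorem simpleRefl_mul_self (i : Fin (n - 1)) : simpleRefl i * simpleRefl i = 1 := by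
  simp [simpleRefl]

@[simp] theorem simpleRefl_apply_apply (i : Fin (n - 1)) (a : Fin n) :
    simpleRefl i (simpleRefl i a) = a := by
  simp [simpleRefl]

@[simp] theorem simpleRefl_inv (i : Fin (n - 1)) : (simpleRefl i)⁻¹ = simpleRefl i := by
  simp [simpleRefl]

theorem comp_simpleRefl_comp {β : Type*} (v : Fin n → β) (i : Fin (n - 1)) :
    (v ∘ simpleRefl i) ∘ simpleRefl i = v := by
  funext a; simp

theorem simpleRefl_of_ne {i : Fin (n - 1)} {a : Fin n} (h1 : a ≠ lo i) (h2 : a ≠ hi i) :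
    simpleRefl i a = a := Equiv.swap_apply_of_ne_of_ne h1 h2

theorem simpleRefl_lt_iff (i : Fin (n - 1)) (a b : Fin n) (h1 : ¬(a = lo i ∧ b = hi i))
    (h2 : ¬(a = hi i ∧ b = lo i)) : simpleRefl i a < simpleRefl i b ↔ a < b := by
  simp only [simpleRefl, Equiv.swap_apply_def, lo, hi, Fin.ext_iff, Fin.lt_def] at *
  split_ifs <;> simp only [] <;> omega

theorem monotone_of_lo_le_hi {v : Fin n → α} (h : ∀ i, v (lo i) ≤ v (hi i)) : Monotone v := by
  rcases n with _ | n
  · exact fun a => a.elim0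
  · exact Fin.monotone_iff_le_succ.2 fun i => h i

/-- The number of inversions of a word. -/
def inv (v : Fin n → α) : ℕ :=
  (Finset.univ.filter fun p : Fin n × Fin n => p.1 < p.2 ∧ v p.2 < v p.1).card

/-- Transporting the inversions by $s_i$ changes the order of no pair of places except $(i,i+1)$,
and that pair becomes the one new inversion. -/
theorem inv_comp_simpleRefl {v : Fin n → α} {i : Fin (n - 1)} (h : v (lo i) < v (hi i)) :
    inv (v ∘ simpleRefl i) = inv v + 1 := by
  have hs : (Finset.univ.filter fun p : Fin n × Fin n =>
      p.1 < p.2 ∧ (v ∘ simpleRefl i) p.2 < (v ∘ simpleRefl i) p.1) =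
      insert (lo i, hi i) ((Finset.univ.filter fun p : Fin n × Fin n =>
        p.1 < p.2 ∧ v p.2 < v p.1).map
          ((simpleRefl i).prodCongr (simpleRefl i)).toEmbedding) := by
    ext ⟨a, b⟩
    simp only [Finset.mem_filter, Finset.mem_univ, true_and, Finset.mem_insert, Finset.mem_map_equiv,
      Prod.mk.injEq, Function.comp_apply, Equiv.prodCongr_symm, Equiv.prodCongr_apply,
      Prod.map_apply]
    have e : (simpleRefl i).symm = simpleRefl i := simpleRefl_inv i
    rw [e]
    by_cases h1 : a = lo i ∧ b = hi i
    · obtain ⟨rfl, rfl⟩ := h1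
      simp [h, lo_lt_hi]
    by_cases h2 : a = hi i ∧ b = lo i
    · obtain ⟨rfl, rfl⟩ := h2
      simp [h.le, (lo_ne_hi i).symm]
    rw [simpleRefl_lt_iff i a b h1 h2]
    simp [h1]
  rw [inv, hs, Finset.card_insert_of_notMem, Finset.card_map, inv]
  have e : (simpleRefl i).symm = simpleRefl i := simpleRefl_inv i
  simp [Finset.mem_map_equiv, e, (lo_lt_hi i).le]

theorem inv_of_desc {v : Fin n → α} {i : Fin (n - 1)} (h : v (hi i) < v (lo i)) :
    inv v = inv (v ∘ simpleRefl i) + 1 := by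
  conv_lhs => rw [← comp_simpleRefl_comp v i]
  exact inv_comp_simpleRefl (by simpa using h)

theorem inv_eq_zero {v : Fin n → α} (h : Monotone v) : inv v = 0 := by
  rw [inv, Finset.card_eq_zero, Finset.filter_eq_empty_iff]
  rintro ⟨a, b⟩ - ⟨h1, h2⟩
  exact absurd (h h1.le) (not_le.2 h2)

/-- Every word arises from a nondecreasing one by successively exchanging adjacent increasing
letters. -/
theorem word_induction {P : (Fin n → α) → Prop} (base : ∀ v, Monotone v → P v)
    (step : ∀ v i, v (lo i) < v (hi i) → P v → P (v ∘ simpleRefl i)) (v : Fin n → α) : P v := by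
  induction h : inv v using Nat.strong_induction_on generalizing v with
  | _ k ih =>
    by_cases hm : ∀ i, v (lo i) ≤ v (hi i)
    · exact base v (monotone_of_lo_le_hi hm)
    · push Not at hm
      obtain ⟨i, hi⟩ := hm
      rw [← comp_simpleRefl_comp v i]
      refine step _ i (by simpa using hi) (ih _ ?_ _ rfl)
      have := inv_of_desc hi
      omega

theorem perm_eq_one_of_monotone {w : Equiv.Perm (Fin n)} (h : Monotone w) : w = 1 :=
  (Equiv.Perm.monotone_iff w).1 h

theorem perm_induction {P : Equiv.Perm (Fin n) → Prop} (base : P 1)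
    (step : ∀ w i, w (lo i) < w (hi i) → P w → P (w * simpleRefl i)) (w : Equiv.Perm (Fin n)) :
    P w := by
  have := word_induction (P := fun v : Fin n → Fin n => ∀ w : Equiv.Perm (Fin n), ⇑w = v → P w)
    (fun v hv w hw => by rw [perm_eq_one_of_monotone (w := w) (by rw [hw]; exact hv)]; exact base)
    (fun v i hvi ih w hw => by
      have h2 : ⇑(w * simpleRefl i) = v := by
        rw [Equiv.Perm.coe_mul, hw, comp_simpleRefl_comp]
      have := step (w * simpleRefl i) i (by rw [h2]; exact hvi) (ih _ h2)
      rwa [mul_assoc, simpleRefl_mul_self, mul_one] at this) w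
  exact this w rfl

theorem inv_mul_simpleRefl {w : Equiv.Perm (Fin n)} {i : Fin (n - 1)} (h : w (lo i) < w (hi i)) :
    inv ⇑(w * simpleRefl i) = inv ⇑w + 1 := inv_comp_simpleRefl (v := w) h

theorem inv_perm_of_desc {w : Equiv.Perm (Fin n)} {i : Fin (n - 1)} (h : w (hi i) < w (lo i)) :
    inv ⇑w = inv ⇑(w * simpleRefl i) + 1 := inv_of_desc (v := w) h

theorem wordProd_append (l m : List (Fin (n - 1))) :
    wordProd (l ++ m) = wordProd l * wordProd m := by simp [wordProd]

@[simp] theorem wordProd_singleton (i : Fin (n - 1)) : wordProd [i] = simpleRefl i := by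
  simp [wordProd]

theorem inv_wordProd_le (l : List (Fin (n - 1))) : inv ⇑(wordProd l) ≤ l.length := by
  induction l using List.reverseRecOn with
  | nil => simp [wordProd, inv_eq_zero monotone_id]
  | append_singleton l i ih =>
    rw [wordProd_append, wordProd_singleton, List.length_append, List.length_singleton]
    rcases lt_or_gt_of_ne ((wordProd l).injective.ne (lo_ne_hi i)) with h | h
    · rw [inv_mul_simpleRefl h]; omega
    · have := inv_perm_of_desc h; omega

theorem exists_word_inv (w : Equiv.Perm (Fin n)) :
    ∃ l, wordProd l = w ∧ l.length = inv ⇑w := by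
  induction w using perm_induction with
  | base => exact ⟨[], rfl, by simp [inv_eq_zero monotone_id]⟩
  | step w i h ih =>
    obtain ⟨l, h1, h2⟩ := ih
    exact ⟨l ++ [i], by rw [wordProd_append, h1, wordProd_singleton],
      by rw [inv_mul_simpleRefl h, ← h2]; simp⟩

/-- A letter of a word changes the number of inversions by one, so inversions bound the length from
below; sorting by adjacent exchanges gives a word that attains the bound. -/
theorem len_eq_inv (w : Equiv.Perm (Fin n)) : len w = inv ⇑w := by
  apply le_antisymm
  · obtain ⟨l, h1, h2⟩ := exists_word_inv w
    exact Nat.sInf_le ⟨l, h1, h2⟩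
  · obtain ⟨l, h1, h2⟩ := exists_reducedWord w
    rw [← h2, ← h1]
    exact inv_wordProd_le l

theorem inv_perm_inv (w : Equiv.Perm (Fin n)) : inv ⇑w⁻¹ = inv ⇑w := by
  apply Finset.card_bij (fun p _ => (w⁻¹ p.2, w⁻¹ p.1))
  · rintro ⟨a, b⟩ h
    simpa [and_comm] using h
  · rintro ⟨a, b⟩ _ ⟨c, d⟩ _ h
    simp only [Prod.mk.injEq, EmbeddingLike.apply_eq_iff_eq] at h
    exact Prod.ext h.2 h.1
  · rintro ⟨a, b⟩ h
    exact ⟨(w b, w a), by simpa [and_comm] using h, by simp⟩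

theorem len_inv (w : Equiv.Perm (Fin n)) : len w⁻¹ = len w := by
  rw [len_eq_inv, len_eq_inv, inv_perm_inv]

theorem len_one : len (1 : Equiv.Perm (Fin n)) = 0 := by
  rw [len_eq_inv]; exact inv_eq_zero monotone_id

theorem len_mul_simpleRefl {w : Equiv.Perm (Fin n)} {i : Fin (n - 1)} (h : w (lo i) < w (hi i)) :
    len (w * simpleRefl i) = len w + 1 := by
  rw [len_eq_inv, len_eq_inv, inv_mul_simpleRefl h]

theorem len_simpleRefl_mul {w : Equiv.Perm (Fin n)} {i : Fin (n - 1)}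
    (h : w⁻¹ (lo i) < w⁻¹ (hi i)) : len (simpleRefl i * w) = len w + 1 := by
  rw [← len_inv, mul_inv_rev, simpleRefl_inv, len_mul_simpleRefl h, len_inv]

theorem simpleRefl_commute {i j : Fin (n - 1)} (h : (i : ℕ) + 2 ≤ j ∨ (j : ℕ) + 2 ≤ i) :
    simpleRefl i * simpleRefl j = simpleRefl j * simpleRefl i := by
  apply Equiv.Perm.Disjoint.commute
  intro a
  by_cases h1 : a = lo i ∨ a = hi i
  · right
    apply simpleRefl_of_ne <;> rcases h1 with rfl | rfl <;> simp [lo, hi, Fin.ext_iff] <;> omega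
  · push Not at h1
    exact Or.inl (simpleRefl_of_ne h1.1 h1.2)

theorem hi_eq_lo {i j : Fin (n - 1)} (h : (j : ℕ) = i + 1) : hi i = lo j := by
  simp [lo, hi, h]

theorem simpleRefl_braid {i j : Fin (n - 1)} (h : (j : ℕ) = i + 1) :
    simpleRefl i * simpleRefl j * simpleRefl i = simpleRefl j * simpleRefl i * simpleRefl j := by
  have e := hi_eq_lo h
  have h1 : lo i ≠ lo j := by rw [← e]; exact lo_ne_hi i
  have h2 : lo i ≠ hi j := by simp [lo, hi, Fin.ext_iff]; omega
  have h3 := lo_ne_hi j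
  ext a
  simp only [simpleRefl, e, Equiv.Perm.mul_apply, Equiv.swap_apply_def]
  split_ifs <;> simp_all

/-- Reduced words of a permutation have the same product in every monoid in which the braid
relations hold. -/
theorem matsumoto {M : Type*} [Monoid M] (f : Fin (n - 1) → M)
    (far : ∀ i j : Fin (n - 1), ((i : ℕ) + 2 ≤ j ∨ (j : ℕ) + 2 ≤ i) → f i * f j = f j * f i)
    (braid : ∀ i j : Fin (n - 1), (j : ℕ) = i + 1 → f i * f j * f i = f j * f i * f j) :
    ∀ (k : ℕ) (l m : List (Fin (n - 1))), l.length = k → m.length = k →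
      inv ⇑(wordProd l) = k → wordProd l = wordProd m → (l.map f).prod = (m.map f).prod := by
  intro k
  induction k using Nat.strong_induction_on with
  | _ k ih =>
  intro l m hl hm hk hw
  rcases List.eq_nil_or_concat l with rfl | ⟨a, i, rfl⟩
  · obtain rfl : m = [] := List.length_eq_zero_iff.1 (by rw [hm, ← hl]; rfl)
    rfl
  rcases List.eq_nil_or_concat m with rfl | ⟨a', j, rfl⟩
  · simp at hl hm; omega
  rw [List.concat_eq_append] at hl hk hw ⊢
  rw [List.concat_eq_append] at hm hw ⊢
  -- The last letter of a reduced word is a descent of its product, and deleting it leaves a reduced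
  -- word.
  have key : ∀ (a : List (Fin (n - 1))) (i : Fin (n - 1)), (a ++ [i]).length = k →
      inv ⇑(wordProd (a ++ [i])) = k → inv ⇑(wordProd a) + 1 = k ∧
      wordProd (a ++ [i]) (hi i) < wordProd (a ++ [i]) (lo i) := by
    intro a i h1 h2
    rw [wordProd_append, wordProd_singleton] at h2 ⊢
    rw [List.length_append, List.length_singleton] at h1
    have h3 := inv_wordProd_le a
    rcases lt_or_gt_of_ne ((wordProd a).injective.ne (lo_ne_hi i)) with h | h
    · rw [inv_mul_simpleRefl h] at h2
      exact ⟨h2, by simpa using h⟩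
    · have := inv_perm_of_desc h; omega
  have hi1 := key a i hl hk
  have hj1 := key a' j hm (hw ▸ hk)
  rw [← hw] at hj1
  obtain ⟨ha, hdi⟩ := hi1
  obtain ⟨ha', hdj⟩ := hj1
  rw [List.length_append, List.length_singleton] at hl hm
  set w := wordProd (a ++ [i]) with hwdef
  have wa : wordProd a = w * simpleRefl i := by
    rw [hwdef, wordProd_append, wordProd_singleton, mul_assoc, simpleRefl_mul_self, mul_one]
  have wa' : wordProd a' = w * simpleRefl j := by
    rw [hw, wordProd_append, wordProd_singleton, mul_assoc, simpleRefl_mul_self, mul_one]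
  have main3 : ∀ (a a' : List (Fin (n - 1))) (i j : Fin (n - 1)), (j : ℕ) = i + 1 →
      a.length + 1 = k → a'.length + 1 = k → inv ⇑(wordProd a) + 1 = k →
      inv ⇑(wordProd a') + 1 = k → wordProd a = w * simpleRefl i →
      wordProd a' = w * simpleRefl j → w (hi i) < w (lo i) → w (hi j) < w (lo j) →
      (a.map f).prod * f i = (a'.map f).prod * f j := by
    intro a a' i j hij hl hm ha ha' wa wa' hdi hdj
    have e := hi_eq_lo hij
    have n1 : hi j ≠ lo i := by simp [lo, hi, Fin.ext_iff]; omega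
    have n2 : hi j ≠ hi i := by rw [e]; exact (lo_ne_hi j).symm
    have n3 : lo i ≠ lo j := by rw [← e]; exact lo_ne_hi i
    have n4 : lo i ≠ hi j := n1.symm
    -- With descents at the neighbours $i$ and $j$, $w$ ends in $s_is_js_i$ with lengths adding. By
    -- induction `a` may be replaced by $c\,i\,j$ and `a'` by $c\,j\,i$, and one braid relation
    -- remains.
    obtain ⟨c, hc1, hc2⟩ := exists_word_inv (w * simpleRefl i * simpleRefl j * simpleRefl i)
    have d1 : inv ⇑w = inv ⇑(w * simpleRefl i) + 1 := inv_perm_of_desc hdi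
    have d2 : inv ⇑(w * simpleRefl i) = inv ⇑(w * simpleRefl i * simpleRefl j) + 1 := by
      apply inv_perm_of_desc
      rw [Equiv.Perm.mul_apply, Equiv.Perm.mul_apply, ← e, simpleRefl_hi, simpleRefl_of_ne n1 n2]
      rw [e] at hdi
      exact hdj.trans hdi
    have d3 : inv ⇑(w * simpleRefl i * simpleRefl j) =
        inv ⇑(w * simpleRefl i * simpleRefl j * simpleRefl i) + 1 := by
      apply inv_perm_of_desc
      simp only [Equiv.Perm.mul_apply]
      rw [simpleRefl_of_ne (i := j) n3 n4, simpleRefl_lo, e, simpleRefl_lo,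
        simpleRefl_of_ne n1 n2]
      exact hdj
    have ha2 := ha
    rw [wa] at ha2
    have e1 := ih (k - 1) (by omega) a (c ++ [i] ++ [j]) (by omega) (by simp only [List.length_append, List.length_singleton]; omega) (by omega)
      (by simp only [wordProd_append, wordProd_singleton, hc1, wa, mul_assoc, simpleRefl_mul_self]
          rw [one_mul,
            simpleRefl_mul_self, mul_one])
    have e2 := ih (k - 1) (by omega) a' (c ++ [j] ++ [i]) (by omega) (by simp only [List.length_append, List.length_singleton]; omega) (by omega)
      (by simp only [wordProd_append, wordProd_singleton, hc1, wa', mul_assoc]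
          rw [← mul_assoc (simpleRefl i) (simpleRefl j), ← mul_assoc (simpleRefl i * simpleRefl j),
            simpleRefl_braid hij]
          simp only [mul_assoc]
          rw [← mul_assoc (simpleRefl j) (simpleRefl j) (simpleRefl i), simpleRefl_mul_self,
            one_mul, simpleRefl_mul_self, mul_one])
    rw [e1, e2]
    simp only [List.map_append, List.map_cons, List.map_nil, List.prod_append, List.prod_cons,
      List.prod_nil, mul_one, mul_assoc]
    rw [← mul_assoc (f i), ← mul_assoc (f j), braid i j hij]
  simp only [List.map_append, List.map_cons, List.map_nil, List.prod_append, List.prod_cons,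
    List.prod_nil, mul_one]
  by_cases hij : i = j
  · subst hij
    rw [ih (k - 1) (by omega) a a' (by omega) (by omega) (by omega) (by rw [wa, wa'])]
  by_cases hij1 : (j : ℕ) = i + 1
  · exact main3 a a' i j hij1 hl hm ha ha' wa wa' hdi hdj
  by_cases hij2 : (i : ℕ) = j + 1
  · exact (main3 a' a j i hij2 hm hl ha' ha wa' wa hdj hdi).symm
  have hf : (i : ℕ) + 2 ≤ j ∨ (j : ℕ) + 2 ≤ i := by
    have : (i : ℕ) ≠ j := fun h => hij (Fin.ext h)
    omega
  -- For distant descents $w=c\,s_js_i=c\,s_is_j$ with lengths adding, and the commutation relation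
  -- finishes.
  obtain ⟨c, hc1, hc2⟩ := exists_word_inv (w * simpleRefl i * simpleRefl j)
  have d1 : inv ⇑w = inv ⇑(w * simpleRefl i) + 1 := inv_perm_of_desc hdi
  have d2 : inv ⇑(w * simpleRefl i) = inv ⇑(w * simpleRefl i * simpleRefl j) + 1 := by
    apply inv_perm_of_desc
    rw [Equiv.Perm.mul_apply, Equiv.Perm.mul_apply, simpleRefl_of_ne, simpleRefl_of_ne]
    · exact hdj
    all_goals simp [lo, hi, Fin.ext_iff]; omega
  have ha2 := ha
  rw [wa] at ha2
  have e1 := ih (k - 1) (by omega) a (c ++ [j]) (by omega) (by simp only [List.length_append, List.length_singleton]; omega) (by omega)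
    (by simp only [wordProd_append, wordProd_singleton, hc1, wa, mul_assoc, simpleRefl_mul_self,
      mul_one])
  have e2 := ih (k - 1) (by omega) a' (c ++ [i]) (by omega) (by simp only [List.length_append, List.length_singleton]; omega) (by omega)
    (by simp only [wordProd_append, wordProd_singleton, hc1, wa', mul_assoc]
        rw [simpleRefl_commute hf.symm, ← mul_assoc (simpleRefl i), simpleRefl_mul_self, one_mul])
  rw [e1, e2]
  simp only [List.map_append, List.map_cons, List.map_nil, List.prod_append, List.prod_cons,
    List.prod_nil, mul_one, mul_assoc]
  rw [far j i hf.symm]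

end Inversions

/-! ### The elements $g_w$, their multiplication by generators and their images under $*$ -/

section Products

variable {R : Type*} [CommRing R] {r n : ℕ} [Invertible (r : R)] {q : Rˣ}

theorem gPerm_eq_of_word (l : List (Fin (n - 1))) (h : l.length = len (wordProd l)) :
    gPerm R r q (wordProd l) = (l.map (gY R r q)).prod := by
  obtain ⟨h1, h2⟩ := (exists_reducedWord (wordProd l)).choose_spec
  refine matsumoto (gY R r q) gY_far gY_braid (len (wordProd l)) _ _ h2 h ?_ h1
  exact (congrArg (fun w : Equiv.Perm (Fin n) => inv ⇑w) h1).trans (len_eq_inv _).symm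

theorem gPerm_one : gPerm R r q (1 : Equiv.Perm (Fin n)) = 1 := by
  have h : wordProd ([] : List (Fin (n - 1))) = 1 := rfl
  rw [← h, gPerm_eq_of_word _ (by rw [h, len_one]; rfl)]
  rfl

theorem gPerm_mul_gY {w : Equiv.Perm (Fin n)} {i : Fin (n - 1)} (h : w (lo i) < w (hi i)) :
    gPerm R r q (w * simpleRefl i) = gPerm R r q w * gY R r q i := by
  obtain ⟨l, hl, h2⟩ := exists_reducedWord w
  have e : wordProd (l ++ [i]) = w * simpleRefl i := by
    rw [wordProd_append, hl, wordProd_singleton]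
  rw [← e, gPerm_eq_of_word, ← hl, gPerm_eq_of_word]
  · simp
  · rw [hl, h2]
  · rw [e, len_mul_simpleRefl h, ← h2]; simp

theorem gY_mul_gPerm {w : Equiv.Perm (Fin n)} {i : Fin (n - 1)} (h : w⁻¹ (lo i) < w⁻¹ (hi i)) :
    gPerm R r q (simpleRefl i * w) = gY R r q i * gPerm R r q w := by
  obtain ⟨l, hl, h2⟩ := exists_reducedWord w
  have e : wordProd ([i] ++ l) = simpleRefl i * w := by
    rw [wordProd_append, hl, wordProd_singleton]
  rw [← e, gPerm_eq_of_word, ← hl, gPerm_eq_of_word]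
  · simp
  · rw [hl, h2]
  · rw [e, len_simpleRefl_mul h, ← h2]; simp [add_comm]

theorem starY_one : starY (1 : Y R r n q) = 1 := by simp [starY]

theorem starY_gPerm (w : Equiv.Perm (Fin n)) :
    starY (gPerm R r q w) = gPerm R r q w⁻¹ := by
  induction w using perm_induction with
  | base => rw [inv_one, gPerm_one, starY_one]
  | step w i h ih =>
    rw [gPerm_mul_gY h, starY_mul, ih, starY_gY, mul_inv_rev, simpleRefl_inv, gY_mul_gPerm]
    simpa using h

theorem gPerm_mul_tY (w : Equiv.Perm (Fin n)) (j : Fin n) :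
    gPerm R r q w * tY R r q j = tY R r q (w j) * gPerm R r q w := by
  induction w using perm_induction generalizing j with
  | base => simp [gPerm_one]
  | step w i h ih =>
    rw [gPerm_mul_gY h, mul_assoc, gY_mul_tY, ← mul_assoc, ih, mul_assoc, Equiv.Perm.mul_apply]

end Products

end

end YokonumaSchur

namespace YokonumaSchur

noncomputable section

/-! ### The initial tableau -/

section Initial

variable {r n : ℕ}

theorem sum_castLE {N : ℕ} (f : Fin N → ℕ) (k : Fin N) :
    ∑ i : Fin (k : ℕ), f (Fin.castLE k.2.le i) = ∑ i ∈ Finset.univ.filter (· < k), f i := by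
  refine Finset.sum_nbij (fun i => Fin.castLE k.2.le i) ?_ ?_ ?_ ?_
  · intro i _
    simpa using Fin.lt_def.2 (by simp)
  · intro i _ j _ h
    simpa using h
  · intro j hj
    have hj : j < k := by simpa using hj
    exact ⟨⟨j, hj⟩, by simp, rfl⟩
  · intro i _
    rfl

theorem sum_lt_add_le {N : ℕ} (f : Fin N → ℕ) {a b : Fin N} (h : a < b) :
    ∑ i ∈ Finset.univ.filter (· < a), f i + f a ≤ ∑ i ∈ Finset.univ.filter (· < b), f i := by
  rw [add_comm, ← Finset.sum_insert (by simp)]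
  apply Finset.sum_le_sum_of_subset
  intro i hi
  simp only [Finset.mem_insert, Finset.mem_filter, Finset.mem_univ, true_and] at hi ⊢
  rcases hi with rfl | hi
  · exact h
  · exact hi.trans h

theorem sum_lt_add_eq {N : ℕ} (f : Fin N → ℕ) (a : Fin N) :
    ∑ i ∈ Finset.univ.filter (· < a), f i + f a = ∑ i ∈ Finset.univ.filter (· ≤ a), f i := by
  rw [add_comm, ← Finset.sum_insert (by simp)]
  congr 1
  ext i
  simp [le_iff_eq_or_lt]

theorem sum_lt_add_le_sum {N : ℕ} (f : Fin N → ℕ) (a : Fin N) :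
    ∑ i ∈ Finset.univ.filter (· < a), f i + f a ≤ ∑ i, f i := by
  rw [sum_lt_add_eq]
  exact Finset.sum_le_sum_of_subset (Finset.filter_subset _ _)

theorem tInit_val (μ : RComp r n) (k : Fin r) (i : Fin n) (j : Fin (μ.part k i)) :
    (tInit μ ⟨k, i, j⟩ : ℕ) = ∑ k' ∈ Finset.univ.filter (· < k), μ.size k' +
      (∑ i' ∈ Finset.univ.filter (· < i), μ.part k i' + j) := by
  rw [← sum_castLE, ← sum_castLE]
  have h1 := finSigmaFinEquiv_apply (n := fun k => ∑ i, μ.1 k i)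
    ⟨k, finSigmaFinEquiv (n := μ.1 k) ⟨i, j⟩⟩
  have h2 := finSigmaFinEquiv_apply (n := μ.1 k) ⟨i, j⟩
  change ((finSigmaFinEquiv (n := fun k => ∑ i, μ.1 k i)
    ⟨k, finSigmaFinEquiv (n := μ.1 k) ⟨i, j⟩⟩ : Fin _) : ℕ) = _
  rw [h1, h2]
  rfl

theorem tInit_lower (μ : RComp r n) (x : Node μ) :
    ∑ k' ∈ Finset.univ.filter (· < x.1), μ.size k' ≤ tInit μ x := by
  obtain ⟨k, i, j⟩ := x
  rw [tInit_val]
  exact Nat.le_add_right _ _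

theorem tInit_upper (μ : RComp r n) (x : Node μ) :
    (tInit μ x : ℕ) < ∑ k' ∈ Finset.univ.filter (· < x.1), μ.size k' + μ.size x.1 := by
  obtain ⟨k, i, j⟩ := x
  rw [tInit_val]
  have := sum_lt_add_le_sum (μ.part k) i
  have h := j.2
  simp only [RComp.size] at *
  omega

@[simp] theorem rowOf_tInit (μ : RComp r n) (x : Node μ) :
    rowOf μ (tInit μ x) = toLex (x.1, x.2.1) := by
  rw [rowOf, Equiv.symm_apply_apply]

theorem compOf_eq (μ : RComp r n) (m : Fin n) : compOf μ m = (ofLex (rowOf μ m)).1 := rfl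

theorem rowOf_monotone (μ : RComp r n) : Monotone (rowOf μ) := by
  intro m m' h
  obtain ⟨x, rfl⟩ := (tInit μ).surjective m
  obtain ⟨y, rfl⟩ := (tInit μ).surjective m'
  rw [rowOf_tInit, rowOf_tInit]
  by_contra hc
  rw [not_le, Prod.Lex.toLex_lt_toLex] at hc
  rw [Fin.le_def] at h
  rcases hc with hc | ⟨hc1, hc2⟩
  · have h1 := sum_lt_add_le μ.size hc
    have h2 := tInit_upper μ y
    have h3 := tInit_lower μ x
    simp only at h1
    omega
  · obtain ⟨k, i, j⟩ := x
    obtain ⟨k', i', j'⟩ := y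
    simp only at hc1 hc2
    subst hc1
    rw [tInit_val, tInit_val] at h
    have h1 := sum_lt_add_le (μ.part k') hc2
    have h2 := j'.2
    omega

theorem tInit_row_lt (μ : RComp r n) (k : Fin r) (i : Fin n) (j j' : Fin (μ.part k i)) :
    tInit μ ⟨k, i, j⟩ < tInit μ ⟨k, i, j'⟩ ↔ j < j' := by
  rw [Fin.lt_def, tInit_val, tInit_val, Fin.lt_def]
  omega

theorem card_rowOf (μ : RComp r n) (k : Fin r) (i : Fin n) :
    Nat.card {m // rowOf μ m = toLex (k, i)} = μ.part k i := by
  have h : Function.Bijective (fun j : Fin (μ.part k i) =>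
      (⟨tInit μ ⟨k, i, j⟩, by simp⟩ : {m // rowOf μ m = toLex (k, i)})) := by
    constructor
    · intro j j' h
      simpa using h
    · rintro ⟨m, hm⟩
      obtain ⟨⟨k', i', j⟩, rfl⟩ := (tInit μ).surjective m
      rw [rowOf_tInit] at hm
      simp only [EmbeddingLike.apply_eq_iff_eq, Prod.mk.injEq] at hm
      obtain ⟨rfl, rfl⟩ := hm
      exact ⟨j, rfl⟩
  rw [← Nat.card_eq_of_bijective _ h, Nat.card_eq_fintype_card, Fintype.card_fin]

/-- The component of $m$ is the one whose interval of partial sums of sizes contains $m$, and these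
intervals are disjoint. -/
theorem compOf_eq_of_size {μ ν : RComp r n} (h : μ.size = ν.size) : compOf μ = compOf ν := by
  funext m
  have key : ∀ μ : RComp r n, ∑ k' ∈ Finset.univ.filter (· < compOf μ m), μ.size k' ≤ m ∧
      (m : ℕ) < ∑ k' ∈ Finset.univ.filter (· < compOf μ m), μ.size k' + μ.size (compOf μ m) := by
    intro μ
    have h1 := tInit_lower μ ((tInit μ).symm m)
    have h2 := tInit_upper μ ((tInit μ).symm m)
    rw [Equiv.apply_symm_apply] at h1 h2
    exact ⟨h1, h2⟩
  have h1 := key μ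
  have h2 := key ν
  rw [← h] at h2
  by_contra hne
  rcases lt_or_gt_of_ne hne with hlt | hlt
  · have := sum_lt_add_le μ.size hlt
    omega
  · have := sum_lt_add_le μ.size hlt
    omega

/-- The last index of the `k`-th component. -/
def lastIdx (μ : RComp r n) (k : Fin r) (h : 0 < μ.size k) : Fin n :=
  ⟨∑ j ∈ Finset.univ.filter (· ≤ k), μ.size j - 1, μ.sum_le_lt k h⟩

theorem compOf_lastIdx (μ : RComp r n) (k : Fin r) (h : 0 < μ.size k) :
    compOf μ (lastIdx μ k h) = k := by
  set m := lastIdx μ k h with hm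
  have h1 := tInit_lower μ ((tInit μ).symm m)
  have h2 := tInit_upper μ ((tInit μ).symm m)
  rw [Equiv.apply_symm_apply] at h1 h2
  have h3 : (m : ℕ) = ∑ j ∈ Finset.univ.filter (· ≤ k), μ.size j - 1 := rfl
  rw [← sum_lt_add_eq] at h3
  change ((tInit μ).symm m).1 = k
  by_contra hne
  rcases lt_or_gt_of_ne hne with hlt | hlt
  · have := sum_lt_add_le μ.size hlt
    omega
  · have := sum_lt_add_le μ.size hlt
    omega

theorem size_compOf_pos (μ : RComp r n) (m : Fin n) : 0 < μ.size (compOf μ m) := by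
  have h1 := tInit_lower μ ((tInit μ).symm m)
  have h2 := tInit_upper μ ((tInit μ).symm m)
  change 0 < μ.size ((tInit μ).symm m).1
  omega

theorem le_lastIdx (μ : RComp r n) (m : Fin n) :
    m ≤ lastIdx μ (compOf μ m) (size_compOf_pos μ m) := by
  have h2 := tInit_upper μ ((tInit μ).symm m)
  rw [Equiv.apply_symm_apply, sum_lt_add_eq] at h2
  rw [Fin.le_def]
  change (m : ℕ) ≤ ∑ j ∈ Finset.univ.filter (· ≤ ((tInit μ).symm m).1), μ.size j - 1
  omega

end Initial

/-! ### The parameters -/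

open Polynomial in
/-- The properties of the ground ring and the parameters that are used. -/
structure Params {R : Type*} [CommRing R] {r : ℕ} (q : Rˣ) (z : Fin r → R) : Prop where
  prod_eq : ∏ l, (X - C (z l)) = X ^ r - 1
  inj : Function.Injective z
  q_add : (q : R) + ((q⁻¹ : Rˣ) : R) ≠ 0
  poincare : ∀ (n : ℕ) (s : Finset (Equiv.Perm (Fin n))), s.Nonempty →
    ∑ w ∈ s, (q : R) ^ (2 * len w) ≠ 0

section ParamFacts

variable {R : Type*} [CommRing R] {r n : ℕ} {q : Rˣ} {z : Fin r → R}

theorem Params.pow_eq_one (hp : Params q z) (k : Fin r) : z k ^ r = 1 := by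
  have h := congrArg (Polynomial.eval (z k)) hp.prod_eq
  rw [Polynomial.eval_prod, Finset.prod_eq_zero (Finset.mem_univ k) (by simp)] at h
  simp only [Polynomial.eval_sub, Polynomial.eval_pow, Polynomial.eval_X, Polynomial.eval_one] at h
  exact (sub_eq_zero.1 h.symm)

variable [Invertible (r : R)]

/-- Up to the factor $\zeta_l$ the sum is geometric; multiplied by $\zeta_k-\zeta_l\ne0$ it becomes
$\zeta_k^r-\zeta_l^r=0$. -/
theorem Params.eElt_ne [IsDomain R] (hp : Params q z) {k l : Fin r} (h : k ≠ l) :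
    eElt R r (z k) (z l) = 0 := by
  have h1 : (∑ s ∈ Finset.range r, z k ^ s * z l ^ (r - s)) =
      z l * ∑ s ∈ Finset.range r, z k ^ s * z l ^ (r - 1 - s) := by
    rw [Finset.mul_sum]
    refine Finset.sum_congr rfl fun s hs => ?_
    have hs := Finset.mem_range.1 hs
    rw [show r - s = r - 1 - s + 1 by omega, pow_succ]
    ring
  have h2 := (Commute.all (z k) (z l)).geom_sum₂_mul r
  rw [hp.pow_eq_one, hp.pow_eq_one, sub_self] at h2
  have h3 := (mul_eq_zero.1 h2).resolve_right (sub_ne_zero.2 (hp.inj.ne h))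
  rw [eElt, h1, h3, mul_zero, smul_zero]

theorem eElt_self {A : Type*} [Ring A] [Algebra R A] {a : A} (h : a ^ r = 1) :
    eElt R r a a = 1 := by
  have : ∑ s ∈ Finset.range r, a ^ s * a ^ (r - s) = (r : A) := by
    rw [Finset.sum_congr rfl (g := fun _ => (1 : A))]
    · simp
    · intro s hs
      rw [← pow_add, Nat.add_sub_cancel' (Finset.mem_range.1 hs).le, h]
  rw [eElt, this, ← map_natCast (algebraMap R A), Algebra.smul_def, ← map_mul, invOf_mul_self,
    map_one]

/-- The product is the derivative of $\prod_l(X-\zeta_l)=X^r-1$ at $\zeta_k$, that is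
$r\zeta_k^{r-1}$, and $r$ is invertible. -/
theorem Params.isUnit_prod (hp : Params q z) (k : Fin r) :
    IsUnit (∏ l ∈ Finset.univ.erase k, (z k - z l)) := by
  have h := hp.prod_eq
  rw [← Finset.mul_prod_erase _ _ (Finset.mem_univ k)] at h
  have h2 := congrArg (fun p => Polynomial.eval (z k) (Polynomial.derivative p)) h
  simp only [Polynomial.derivative_mul, Polynomial.eval_add, Polynomial.eval_mul,
    Polynomial.derivative_sub, Polynomial.derivative_X, Polynomial.derivative_C,
    Polynomial.eval_sub, Polynomial.eval_X, Polynomial.eval_C, sub_self, zero_mul, add_zero,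
    sub_zero, one_mul, Polynomial.eval_prod, Polynomial.derivative_X_pow,
    Polynomial.derivative_one, Polynomial.eval_pow] at h2
  rw [h2]
  exact (isUnit_of_invertible (r : R)).mul
    (IsUnit.pow _ (IsUnit.of_pow_eq_one (hp.pow_eq_one k) (by have := k.2; omega)))

end ParamFacts

end

end YokonumaSchur

namespace YokonumaSchur

noncomputable section

open scoped RightActions IsMulCommutative

/-! ### The idempotents `u_μ E_μ` -/

section Eps

variable {R : Type*} [CommRing R] {r n : ℕ} [Invertible (r : R)] {q : Rˣ} {z : Fin r → R}

section Generic

variable {A B : Type*} [Ring A] [Algebra R A] [Ring B] [Algebra R B]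

/-- `u_μ` for an arbitrary family in place of the `t_j`. -/
def uOf (z : Fin r → R) (t : Fin n → A) (ν : RComp r n) : A :=
  ((List.finRange r).map fun k =>
    if h : 0 < ν.size k then
      (((List.finRange r).filter (· ≠ k)).map
        fun l => t (lastIdx ν k h) - algebraMap R A (z l)).prod
    else 1).prod

/-- `E_μ` for an arbitrary family in place of the `t_j`. -/
def EOf (R : Type*) [CommRing R] [Invertible (r : R)] {A : Type*} [Ring A] [Algebra R A]
    (t : Fin n → A) (ν : RComp r n) : A :=
  (((List.finRange n ×ˢ List.finRange n).filter
      fun p => p.1 < p.2 ∧ compOf ν p.1 = compOf ν p.2).map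
    fun p => eElt R r (t p.1) (t p.2)).prod

/-- `u_μ E_μ` for an arbitrary family in place of the `t_j`. -/
def epsOf (z : Fin r → R) (t : Fin n → A) (ν : RComp r n) : A := uOf z t ν * EOf R t ν

theorem map_epsOf (f : A →ₐ[R] B) (t : Fin n → A) (ν : RComp r n) :
    f (epsOf z t ν) = epsOf z (f ∘ t) ν := by
  have h1 : f (uOf z t ν) = uOf z (f ∘ t) ν := by
    rw [uOf, map_list_prod, List.map_map, uOf]
    congr 2
    funext k
    simp only [Function.comp_apply]
    split_ifs
    · rw [map_list_prod, List.map_map]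
      congr 2
      funext l
      simp
    · simp
  have h2 : f (EOf R t ν) = EOf R (f ∘ t) ν := by
    rw [EOf, map_list_prod, List.map_map, EOf]
    congr 2
    funext k
    simp [map_eElt]
  rw [epsOf, map_mul, h1, h2, epsOf]

/-- The polynomial expression of `u_μ E_μ`. -/
def epsFree (z : Fin r → R) (ν : RComp r n) : FreeAlgebra R (Fin n) :=
  epsOf z (FreeAlgebra.ι R) ν

/-- One formal expression is to be evaluated at the $t_j$, at permuted $t_j$ and at characters; the
free algebra makes these evaluations comparable. -/
theorem lift_epsFree (t : Fin n → A) (ν : RComp r n) :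
    FreeAlgebra.lift R t (epsFree z ν) = epsOf z t ν := by
  rw [epsFree, map_epsOf]
  congr 1
  funext j
  simp

theorem lift_eElt (t : Fin n → A) (a b : Fin n) :
    FreeAlgebra.lift R t (eElt R r (FreeAlgebra.ι R a) (FreeAlgebra.ι R b)) =
      eElt R r (t a) (t b) := by
  rw [map_eElt, FreeAlgebra.lift_ι_apply, FreeAlgebra.lift_ι_apply]

end Generic

/-- The constant by which `u_μ E_μ` acts on its eigenspace. -/
def epsConst (z : Fin r → R) (ν : RComp r n) : R :=
  ((List.finRange r).map fun k =>
    if 0 < ν.size k then ∏ l ∈ Finset.univ.erase k, (z k - z l) else 1).prod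

theorem isUnit_epsConst (hp : Params q z) (ν : RComp r n) : IsUnit (epsConst z ν) := by
  rw [epsConst]
  generalize List.finRange r = L
  induction L with
  | nil => simp
  | cons k L ih =>
    rw [List.map_cons, List.prod_cons]
    refine IsUnit.mul ?_ ih
    split_ifs
    · exact hp.isUnit_prod k
    · exact isUnit_one

omit [Invertible (r : R)] in
theorem epsConst_eq_of_size {μ ν : RComp r n} (h : μ.size = ν.size) :
    epsConst z μ = epsConst z ν := by
  rw [epsConst, epsConst, h]

theorem epsOf_char (hp : Params q z) (ν : RComp r n) :
    epsOf z (fun j => z (compOf ν j)) ν = epsConst z ν := by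
  have h1 : EOf R (fun j => z (compOf ν j)) ν = 1 := by
    apply List.prod_eq_one
    intro x hx
    obtain ⟨p, hp1, rfl⟩ := List.mem_map.1 hx
    have := (List.mem_filter.1 hp1).2
    simp only [decide_eq_true_eq] at this
    simp only [this.2, eElt_self (hp.pow_eq_one _)]
  rw [epsOf, h1, mul_one, uOf, epsConst]
  congr 2
  funext k
  by_cases h : 0 < ν.size k
  · rw [dif_pos h, if_pos h, compOf_lastIdx, ← List.prod_toFinset _ ((List.nodup_finRange r).filter _)]
    apply Finset.prod_congr
    · ext l
      simp
    · simp
  · rw [dif_neg h, if_neg h]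

/-- Multiplying by $a$ or by $b$ shifts the exponents, and the two shifted sums differ only by
boundary terms that agree because $a^r=b^r=1$. -/
theorem eElt_mul_left {A : Type*} [CommRing A] [Algebra R A] {a b : A} (ha : a ^ r = 1)
    (hb : b ^ r = 1) : eElt R r a b * a = eElt R r a b * b := by
  rw [eElt, smul_mul_assoc, smul_mul_assoc, Finset.sum_mul, Finset.sum_mul]
  congr 1
  have h1 : ∀ s ∈ Finset.range r, a ^ s * b ^ (r - s) * a = a ^ (s + 1) * b ^ (r + 1 - (s + 1)) := by
    intro s hs
    rw [Nat.add_sub_add_right]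
    ring
  have h2 : ∀ s ∈ Finset.range r, a ^ s * b ^ (r - s) * b = a ^ s * b ^ (r + 1 - s) := by
    intro s hs
    rw [Nat.sub_add_comm (Finset.mem_range.1 hs).le]
    ring
  rw [Finset.sum_congr rfl h1, Finset.sum_congr rfl h2]
  have h3 := Finset.sum_range_succ (fun s => a ^ s * b ^ (r + 1 - s)) r
  rw [Finset.sum_range_succ'] at h3
  simp only [pow_zero, one_mul, Nat.sub_zero, ha, Nat.add_sub_cancel_left, pow_one, pow_succ b r,
    hb] at h3
  exact add_right_cancel h3

/-- Let $a$ be the last place of the component of $j$. The factor $e_{j,a}$ of $E_\nu$ turns $t_j$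
into $t_a$, and $u_\nu$ contains every factor of $\prod_l(t_a-\zeta_l)=t_a^r-1=0$ except
$t_a-\zeta_k$, so it is a $\zeta_k$-eigenvector of $t_a$. -/
theorem epsOf_mul_comm {A : Type*} [CommRing A] [Algebra R A] (hp : Params q z) {t : Fin n → A}
    (ht : ∀ j, t j ^ r = 1) (ν : RComp r n) (j : Fin n) :
    epsOf z t ν * t j = z (compOf ν j) • epsOf z t ν := by
  set k := compOf ν j with hk
  set a := lastIdx ν k (size_compOf_pos ν j) with ha
  have hE : EOf R t ν * t j = EOf R t ν * t a := by
    rcases eq_or_lt_of_le (le_lastIdx ν j) with h | h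
    · rw [ha, ← h]
    · have hd : eElt R r (t j) (t a) ∣ EOf R t ν := by
        apply List.dvd_prod
        refine List.mem_map.2 ⟨(j, a), List.mem_filter.2 ⟨by simp, ?_⟩, rfl⟩
        simp only [decide_eq_true_eq]
        exact ⟨h, (compOf_lastIdx ν k _).symm⟩
      obtain ⟨c, hc⟩ := hd
      rw [hc, mul_right_comm, eElt_mul_left (ht _) (ht _), mul_right_comm]
  have hu : uOf z t ν * t a = z k • uOf z t ν := by
    have hd : (((List.finRange r).filter (· ≠ k)).map
        fun l => t a - algebraMap R A (z l)).prod ∣ uOf z t ν := by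
      apply List.dvd_prod
      refine List.mem_map.2 ⟨k, List.mem_finRange k, ?_⟩
      rw [dif_pos (size_compOf_pos ν j)]
    obtain ⟨c, hc⟩ := hd
    have h0 : (((List.finRange r).filter (· ≠ k)).map
        fun l => t a - algebraMap R A (z l)).prod * (t a - algebraMap R A (z k)) = 0 := by
      rw [← List.prod_toFinset _ ((List.nodup_finRange r).filter _)]
      have e : ((List.finRange r).filter (· ≠ k)).toFinset = Finset.univ.erase k := by
        ext l
        simp
      rw [e, Finset.prod_erase_mul _ _ (Finset.mem_univ k)]
      have h := congrArg (Polynomial.aeval (t a)) hp.prod_eq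
      simpa [ht] using h
    rw [mul_sub, sub_eq_zero] at h0
    rw [hc, mul_right_comm, h0, Algebra.smul_def]
    ring
  rw [epsOf, mul_assoc, hE, ← mul_assoc, mul_right_comm, hu, smul_mul_assoc]

/-- The commutative subalgebra generated by the `t_j`. -/
def tAlg (R : Type*) [CommRing R] (r n : ℕ) [Invertible (r : R)] (q : Rˣ) :
    Subalgebra R (Y R r n q) := Algebra.adjoin R (Set.range (tY R r q))

theorem tY_mem (j : Fin n) : tY R r q j ∈ tAlg R r n q := Algebra.subset_adjoin ⟨j, rfl⟩

instance : IsMulCommutative (tAlg R r n q) :=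
  Algebra.isMulCommutative_adjoin R (by
    rintro _ ⟨i, rfl⟩ _ ⟨j, rfl⟩
    exact tY_comm i j)

theorem tAlg_comm (a b : tAlg R r n q) : a * b = b * a := mul_comm' a b

theorem epsOf_perm_eq (w : Equiv.Perm (Fin n)) (ν : RComp r n) :
    epsOf z (tY R r q ∘ w) ν =
      ((epsOf z (fun j => (⟨tY R r q (w j), tY_mem _⟩ : tAlg R r n q)) ν : tAlg R r n q) :
        Y R r n q) := by
  have h := map_epsOf (z := z) (tAlg R r n q).val
    (fun j => (⟨tY R r q (w j), tY_mem _⟩ : tAlg R r n q)) ν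
  rw [Subalgebra.coe_val] at h
  rw [h]
  rfl

theorem epsOf_perm_mem (w : Equiv.Perm (Fin n)) (ν : RComp r n) :
    epsOf z (tY R r q ∘ w) ν ∈ tAlg R r n q := by
  rw [epsOf_perm_eq]
  exact Subtype.prop _

theorem epsOf_perm_mul_tY (hp : Params q z) (w : Equiv.Perm (Fin n)) (ν : RComp r n) (j : Fin n) :
    epsOf z (tY R r q ∘ w) ν * tY R r q (w j) = z (compOf ν j) • epsOf z (tY R r q ∘ w) ν := by
  rw [epsOf_perm_eq]
  exact congrArg (Subtype.val) (epsOf_mul_comm hp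
    (t := fun j => (⟨tY R r q (w j), tY_mem _⟩ : tAlg R r n q))
    (fun j => Subtype.ext (tY_pow (w j))) ν j)

/-- `u_μ E_μ`. -/
def eps (q : Rˣ) (z : Fin r → R) (ν : RComp r n) : Y R r n q := epsOf z (tY R r q) ν

theorem mElt_eq (ν : RComp r n) : mElt q z ν = eps q z ν * xElt q ν := rfl

theorem eps_mem (ν : RComp r n) : eps q z ν ∈ tAlg R r n q := epsOf_perm_mem 1 ν

theorem eps_mul_tY (hp : Params q z) (ν : RComp r n) (j : Fin n) :
    eps q z ν * tY R r q j = z (compOf ν j) • eps q z ν := epsOf_perm_mul_tY hp 1 ν j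

section Modules

variable {N : Type*} [AddCommGroup N] [Module (Y R r n q)ᵐᵒᵖ N]

theorem ract_mul (x : N) (a b : Y R r n q) : x <• (a * b) = (x <• a) <• b := by
  rw [MulOpposite.op_mul, mul_smul]

theorem ract_add (x : N) (a b : Y R r n q) : x <• (a + b) = x <• a + x <• b := by
  rw [MulOpposite.op_add, add_smul]

theorem ract_one (x : N) : x <• (1 : Y R r n q) = x := by
  rw [MulOpposite.op_one, one_smul]

variable [Module R N] [IsScalarTower R (Y R r n q)ᵐᵒᵖ N]

theorem ract_algebraMap (x : N) (c : R) : x <• algebraMap R (Y R r n q) c = c • x := by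
  have : MulOpposite.op (algebraMap R (Y R r n q) c) = c • (1 : (Y R r n q)ᵐᵒᵖ) := by
    rw [Algebra.algebraMap_eq_smul_one]; rfl
  rw [this, smul_assoc, one_smul]

theorem ract_smul (x : N) (c : R) (h : Y R r n q) : x <• (c • h) = c • (x <• h) := by
  rw [MulOpposite.op_smul, smul_assoc]

theorem smul_ract (x : N) (c : R) (h : Y R r n q) : (c • x) <• h = c • (x <• h) := by
  rw [← ract_algebraMap (r := r) (n := n) (q := q) x, ← ract_smul, smul_smul, ← MulOpposite.op_mul,
    Algebra.smul_def]

/-- A common eigenvector of the `t_j` is an eigenvector of every polynomial in them. -/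
theorem ract_lift {x : N} {χ : Fin n → R} (h : ∀ j, x <• tY R r q j = χ j • x)
    (p : FreeAlgebra R (Fin n)) :
    x <• FreeAlgebra.lift R (tY R r q) p = FreeAlgebra.lift R χ p • x := by
  induction p using FreeAlgebra.induction with
  | grade0 c => simp only [AlgHom.commutes, ract_algebraMap]; rfl
  | grade1 j => simpa using h j
  | mul a b ha hb =>
    rw [map_mul, ract_mul, ha, smul_ract, hb, smul_smul, map_mul]
  | add a b ha hb => rw [map_add, ract_add, ha, hb, map_add, add_smul]

end Modules

theorem gPerm_mul_lift (w : Equiv.Perm (Fin n)) (p : FreeAlgebra R (Fin n)) :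
    gPerm R r q w * FreeAlgebra.lift R (tY R r q) p =
      FreeAlgebra.lift R (tY R r q ∘ w) p * gPerm R r q w := by
  induction p using FreeAlgebra.induction with
  | grade0 c => simp only [AlgHom.commutes]; exact (Algebra.commutes _ _).symm
  | grade1 j => simpa using gPerm_mul_tY w j
  | mul a b ha hb => rw [map_mul, ← mul_assoc, ha, mul_assoc, hb, map_mul, mul_assoc]
  | add a b ha hb => rw [map_add, mul_add, ha, hb, map_add, add_mul]

/-- Two polynomial expressions of the same type in the `t_j` that are eigenvectors with the same
character are equal. -/
theorem eps_unique (hp : Params q z) {μ ν : RComp r n} (w : Equiv.Perm (Fin n))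
    (hs : epsConst z μ = epsConst z ν) (h1 : ∀ j, compOf μ j = compOf ν j)
    (h2 : ∀ j, compOf ν (w j) = compOf ν j) : epsOf z (tY R r q ∘ w) μ = eps q z ν := by
  set ε' := epsOf z (tY R r q ∘ w) μ with hε'
  have e1 : ∀ j, ε' * tY R r q j = z (compOf ν j) • ε' := by
    intro j
    have := epsOf_perm_mul_tY (q := q) hp w μ (w⁻¹ j)
    have e : w (w⁻¹ j) = j := w.apply_symm_apply j
    rw [e, h1] at this
    rw [this, ← h2 (w⁻¹ j), e]
  -- The product is evaluated in two ways: each factor is an eigenvector of the $t_j$ with the same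
  -- character, and the other acts on it as a polynomial in the $t_j$. The two factors commute, and
  -- the common constant is a unit.
  have e2 : ε' * eps q z ν = epsConst z ν • ε' := by
    have := ract_lift (r := r) (q := q) (N := Y R r n q) (x := ε') (χ := fun j => z (compOf ν j)) e1 (epsFree z ν)
    rw [lift_epsFree, lift_epsFree, epsOf_char hp] at this
    exact this
  have e3 : eps q z ν * ε' = epsConst z ν • eps q z ν := by
    have hfree : ε' = FreeAlgebra.lift R (tY R r q)
        (FreeAlgebra.lift R (FreeAlgebra.ι R ∘ w) (epsFree z μ)) := by
      rw [lift_epsFree, map_epsOf, hε']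
      congr 1
      funext j
      simp
    have := ract_lift (r := r) (q := q) (N := Y R r n q) (x := eps q z ν)
      (χ := fun j => z (compOf ν j)) (eps_mul_tY hp ν)
      (FreeAlgebra.lift R (FreeAlgebra.ι R ∘ w) (epsFree z μ))
    rw [← hfree, lift_epsFree, map_epsOf] at this
    have e : ((FreeAlgebra.lift R fun j => z (compOf ν j)) ∘ (FreeAlgebra.ι R ∘ w)) =
        fun j => z (compOf μ j) := by
      funext j
      simp [h2, h1]
    rw [e, epsOf_char hp, hs] at this
    exact this
  have e4 : ε' * eps q z ν = eps q z ν * ε' :=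
    congrArg Subtype.val (tAlg_comm ⟨ε', epsOf_perm_mem w μ⟩ ⟨eps q z ν, eps_mem ν⟩)
  rw [e2, e3] at e4
  obtain ⟨c, hc⟩ := isUnit_epsConst hp ν
  rw [← hc] at e4
  exact smul_left_cancel c e4

theorem eps_eq_of_size (hp : Params q z) {μ ν : RComp r n} (h : μ.size = ν.size) :
    eps q z μ = eps q z ν :=
  eps_unique hp 1 (epsConst_eq_of_size h) (fun _ => by rw [compOf_eq_of_size h]) fun _ => rfl

/-- Moving $g_w$ across permutes the $t_j$; a permutation that preserves the components preserves
the character, so `eps_unique` identifies the permuted expression with the original. -/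
theorem gPerm_mul_eps (hp : Params q z) (ν : RComp r n) {w : Equiv.Perm (Fin n)}
    (hw : ∀ j, compOf ν (w j) = compOf ν j) :
    gPerm R r q w * eps q z ν = eps q z ν * gPerm R r q w := by
  have := gPerm_mul_lift (R := R) (r := r) (q := q) w (epsFree z ν)
  rw [lift_epsFree, lift_epsFree, eps_unique hp w rfl (fun _ => rfl) hw] at this
  exact this

theorem starY_add (a b : Y R r n q) : starY (a + b) = starY a + starY b := by
  simp [starY]

theorem starY_smul (c : R) (a : Y R r n q) : starY (c • a) = c • starY a := by
  simp [starY]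

theorem starY_sum {ι : Type*} (s : Finset ι) (f : ι → Y R r n q) :
    starY (∑ i ∈ s, f i) = ∑ i ∈ s, starY (f i) := by
  simp [starY, Finset.unop_sum]

theorem starY_of_mem {a : Y R r n q} (ha : a ∈ tAlg R r n q) : starY a = a := by
  induction ha using Algebra.adjoin_induction with
  | mem x hx => obtain ⟨j, rfl⟩ := hx; exact starY_tY j
  | algebraMap c => rw [Algebra.algebraMap_eq_smul_one, starY_smul, starY_one]
  | add x y _ _ hx hy => rw [starY_add, hx, hy]
  | mul x y h1 h2 hx hy =>
    rw [starY_mul, hx, hy]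
    exact congrArg Subtype.val (tAlg_comm ⟨y, h2⟩ ⟨x, h1⟩)

theorem starY_eps (ν : RComp r n) : starY (eps q z ν) = eps q z ν := starY_of_mem (eps_mem ν)

/-! ### The Young subgroup and the eigenvector relations of $m_\nu$ -/

theorem mem_youngSubgroup {ν : RComp r n} {w : Equiv.Perm (Fin n)} :
    w ∈ youngSubgroup ν ↔ ∀ m, rowOf ν (w m) = rowOf ν m := by
  simp [youngSubgroup]

theorem simpleRefl_rowOf {ν : RComp r n} {i : Fin (n - 1)}
    (h : rowOf ν (lo i) = rowOf ν (hi i)) (m : Fin n) :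
    rowOf ν (simpleRefl i m) = rowOf ν m := by
  by_cases h1 : m = lo i
  · rw [h1, simpleRefl_lo, h]
  by_cases h2 : m = hi i
  · rw [h2, simpleRefl_hi, h]
  rw [simpleRefl_of_ne h1 h2]

theorem compOf_of_mem {ν : RComp r n} {w : Equiv.Perm (Fin n)} (hw : w ∈ youngSubgroup ν)
    (m : Fin n) : compOf ν (w m) = compOf ν m := by
  rw [compOf_eq, mem_youngSubgroup.1 hw, compOf_eq]

section Eigen

variable {N : Type*} [AddCommGroup N] [Module R N] [Module (Y R r n q)ᵐᵒᵖ N]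
  [IsScalarTower R (Y R r n q)ᵐᵒᵖ N]

theorem ract_eElt [IsDomain R] (hp : Params q z) {x : N} {c : Fin n → Fin r}
    (h : ∀ j, x <• tY R r q j = z (c j) • x) (a b : Fin n) :
    x <• eElt R r (tY R r q a) (tY R r q b) = if c a = c b then x else 0 := by
  have := ract_lift h (eElt R r (FreeAlgebra.ι R a) (FreeAlgebra.ι R b))
  rw [lift_eElt, lift_eElt] at this
  rw [this]
  split_ifs with hc
  · rw [hc, eElt_self (hp.pow_eq_one _), one_smul]
  · rw [hp.eElt_ne hc, zero_smul]

theorem ract_gPerm_tY {x : N} {c : Fin n → Fin r}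
    (h : ∀ j, x <• tY R r q j = z (c j) • x) (w : Equiv.Perm (Fin n)) (j : Fin n) :
    (x <• gPerm R r q w) <• tY R r q j = z (c (w j)) • (x <• gPerm R r q w) := by
  rw [← ract_mul, gPerm_mul_tY, ract_mul, h, smul_ract]

/-- On a common eigenvector of the $t_j$ the element $e_{i,i+1}$ is $1$ or $0$, so $g_i$ satisfies
the Hecke relation when the two characters agree and squares to the identity when they differ. -/
theorem ract_gY_gY [IsDomain R] (hp : Params q z) {x : N} {c : Fin n → Fin r}
    (h : ∀ j, x <• tY R r q j = z (c j) • x) (i : Fin (n - 1)) :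
    (x <• gY R r q i) <• gY R r q i =
      x + if c (lo i) = c (hi i) then ((q : R) - ((q⁻¹ : Rˣ) : R)) • (x <• gY R r q i) else 0 := by
  rw [← ract_mul, gY_quad, ract_add, ract_one, ract_smul, ract_mul, ract_eElt hp h]
  split_ifs
  · rfl
  · simp

end Eigen

/-- The terms of $x_\nu$ pair off as $w$, $ws_i$ with $w$ the shorter one, and the contribution of
each pair to $m_\nu g_i-qm_\nu$ cancels by the Hecke relation. This relation is available because
both places lie in one component. -/
theorem mElt_mul_gY [IsDomain R] (hp : Params q z) (ν : RComp r n) {i : Fin (n - 1)}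
    (h : rowOf ν (lo i) = rowOf ν (hi i)) :
    mElt q z ν * gY R r q i = (q : R) • mElt q z ν := by
  rw [mElt_eq, xElt, Finset.mul_sum, Finset.sum_mul, Finset.smul_sum, ← sub_eq_zero,
    ← Finset.sum_sub_distrib]
  have key : ∀ w ∈ youngSubgroup ν, w (lo i) < w (hi i) →
      (eps q z ν * ((q : R) ^ len w • gPerm R r q w) * gY R r q i -
        (q : R) • (eps q z ν * ((q : R) ^ len w • gPerm R r q w))) +
      (eps q z ν * ((q : R) ^ len (w * simpleRefl i) • gPerm R r q (w * simpleRefl i)) *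
          gY R r q i -
        (q : R) • (eps q z ν *
          ((q : R) ^ len (w * simpleRefl i) • gPerm R r q (w * simpleRefl i)))) = 0 := by
    intro w hw hlt
    have ht := ract_gPerm_tY (q := q) (z := z) (N := Y R r n q) (x := eps q z ν) (c := compOf ν)
      (eps_mul_tY hp ν) w
    have h2 : (eps q z ν * gPerm R r q w * gY R r q i) * gY R r q i = eps q z ν * gPerm R r q w +
        ((q : R) - ((q⁻¹ : Rˣ) : R)) • (eps q z ν * gPerm R r q w * gY R r q i) := by
      have := ract_gY_gY (N := Y R r n q) (c := fun j => compOf ν (w j)) hp ht i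
      rw [if_pos] at this
      · exact this
      · rw [compOf_of_mem hw, compOf_of_mem hw, compOf_eq, compOf_eq, h]
    rw [len_mul_simpleRefl hlt, gPerm_mul_gY hlt]
    simp only [mul_smul_comm, smul_mul_assoc, ← mul_assoc]
    rw [h2]
    have hq : (q : R) * ((q⁻¹ : Rˣ) : R) = 1 := q.mul_inv
    generalize eps q z ν * gPerm R r q w * gY R r q i = x
    generalize eps q z ν * gPerm R r q w = y
    rw [pow_succ]
    match_scalars
    · linear_combination (-(q : R) ^ len w) * hq
    · ring
  have hinv : ∀ w ∈ youngSubgroup ν, w * simpleRefl i ∈ youngSubgroup ν := by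
    intro w hw
    rw [mem_youngSubgroup] at hw ⊢
    intro m
    rw [Equiv.Perm.mul_apply, hw, simpleRefl_rowOf h]
  refine Finset.sum_involution (fun w _ => w * simpleRefl i) ?_ ?_ (fun w hw => hinv w hw) ?_
  · intro w hw
    rcases lt_or_gt_of_ne (w.injective.ne (lo_ne_hi i)) with hlt | hlt
    · exact key w hw hlt
    · have := key (w * simpleRefl i) (hinv w hw) (by simpa using hlt)
      rw [mul_assoc w, simpleRefl_mul_self, mul_one, add_comm] at this
      exact this
  · intro w _ _ he
    have := congrArg (fun σ : Equiv.Perm (Fin n) => σ (lo i)) he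
    simp only [Equiv.Perm.mul_apply, simpleRefl_lo] at this
    exact lo_ne_hi i (w.injective this).symm
  · intro w _
    rw [mul_assoc, simpleRefl_mul_self, mul_one]

theorem mElt_mul_tY (hp : Params q z) (ν : RComp r n) (j : Fin n) :
    mElt q z ν * tY R r q j = z (compOf ν j) • mElt q z ν := by
  rw [mElt_eq, xElt, Finset.mul_sum, Finset.sum_mul, Finset.smul_sum]
  refine Finset.sum_congr rfl fun w hw => ?_
  have := ract_gPerm_tY (q := q) (z := z) (N := Y R r n q) (x := eps q z ν) (c := compOf ν) (eps_mul_tY hp ν) w j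
  rw [compOf_of_mem hw] at this
  rw [mul_smul_comm, smul_mul_assoc, smul_comm]
  congr 1

end Eps

end

end YokonumaSchur

namespace YokonumaSchur

noncomputable section

open scoped RightActions Matrix

/-! ### Words -/

section Words

variable {r n : ℕ}

/-- Letters: a colour and a row. -/
abbrev Letter (r n : ℕ) : Type := Fin r ×ₗ Fin n

instance : Fintype (Letter r n) := inferInstanceAs (Fintype (Fin r × Fin n))

/-- The colour of a letter. -/
def colour (x : Letter r n) : Fin r := (ofLex x).1

theorem colour_mono {x y : Letter r n} (h : x ≤ y) : colour x ≤ colour y := by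
  rcases Prod.Lex.le_iff.1 h with h | h
  · exact h.le
  · exact h.1.le

/-- Words of length `n`. -/
abbrev Word (r n : ℕ) : Type := Fin n → Letter r n

/-- The multiplicities determine the number of places with value at most $a$, and for a monotone
sequence these are an initial segment, so the comparison of each value with every $a$ is known. -/
theorem eq_of_monotone_of_card {α : Type*} [LinearOrder α] {v v' : Fin n → α}
    (hv : Monotone v) (hv' : Monotone v')
    (h : ∀ a, (Finset.univ.filter fun p => v p = a).card =
      (Finset.univ.filter fun p => v' p = a).card) : v = v' := by
  have key : ∀ a, (Finset.univ.filter fun p => v p ≤ a).card =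
      (Finset.univ.filter fun p => v' p ≤ a).card := by
    intro a
    have e : ∀ u : Fin n → α, (∀ p, u p ∈ Finset.univ.image v ∪ Finset.univ.image v') →
        (Finset.univ.filter fun p => u p ≤ a).card =
        ∑ b ∈ (Finset.univ.image v ∪ Finset.univ.image v').filter (· ≤ a),
          (Finset.univ.filter fun p => u p = b).card := by
      intro u hu
      rw [Finset.card_eq_sum_card_fiberwise (f := u)
        (t := (Finset.univ.image v ∪ Finset.univ.image v').filter (· ≤ a))]
      · refine Finset.sum_congr rfl fun b hb => ?_
        rw [Finset.filter_filter]
        congr 1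
        ext p
        simp only [Finset.mem_filter, Finset.mem_univ, true_and, and_iff_right_iff_imp]
        rintro rfl
        exact (Finset.mem_filter.1 hb).2
      · intro p hp
        exact Finset.mem_coe.2 (Finset.mem_filter.2 ⟨hu p, (Finset.mem_filter.1 hp).2⟩)
    rw [e v (fun p => by simp), e v' (fun p => by simp)]
    exact Finset.sum_congr rfl fun b _ => h b
  funext p
  apply eq_of_forall_ge_iff
  intro a
  rw [← Tuple.lt_card_le_iff_apply_le_of_monotone hv,
    ← Tuple.lt_card_le_iff_apply_le_of_monotone hv', key a]

/-- The content of a word. -/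
def contentOf (v : Word r n) : RComp r n :=
  ⟨fun k i => (Finset.univ.filter fun p => v p = toLex (k, i)).card, by
    have h := Finset.card_eq_sum_card_fiberwise (s := (Finset.univ : Finset (Fin n)))
      (t := (Finset.univ : Finset (Fin r × Fin n))) (f := fun p => ofLex (v p)) (by simp)
    rw [Finset.card_univ, Fintype.card_fin, ← Finset.univ_product_univ, Finset.sum_product] at h
    exact h.symm⟩

theorem contentOf_part (v : Word r n) (k : Fin r) (i : Fin n) :
    (contentOf v).part k i = (Finset.univ.filter fun p => v p = toLex (k, i)).card := rfl

theorem card_filter_rowOf (ν : RComp r n) (k : Fin r) (i : Fin n) :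
    (Finset.univ.filter fun p => rowOf ν p = toLex (k, i)).card = ν.part k i := by
  rw [← card_rowOf, Nat.card_eq_fintype_card, Fintype.card_subtype]

@[simp] theorem contentOf_rowOf (ν : RComp r n) : contentOf (rowOf ν) = ν := by
  apply Subtype.ext
  funext k i
  exact card_filter_rowOf ν k i

theorem card_filter_comp {α : Type*} [DecidableEq α] (v : Fin n → α) (w : Equiv.Perm (Fin n))
    (a : α) : (Finset.univ.filter fun p => (v ∘ w) p = a).card =
      (Finset.univ.filter fun p => v p = a).card :=
  Finset.card_bij (fun p _ => w p) (by simp) (by simp) (fun p hp => ⟨w⁻¹ p, by simpa using hp⟩)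

@[simp] theorem contentOf_comp (v : Word r n) (w : Equiv.Perm (Fin n)) :
    contentOf (v ∘ w) = contentOf v := by
  apply Subtype.ext
  funext k i
  exact card_filter_comp v w _

theorem comp_sort (v : Word r n) : v ∘ Tuple.sort v = rowOf (contentOf v) := by
  apply eq_of_monotone_of_card (Tuple.monotone_sort v) (rowOf_monotone _)
  intro a
  rw [card_filter_comp]
  exact (card_filter_rowOf (contentOf v) (ofLex a).1 (ofLex a).2).symm

theorem eq_rowOf_of_monotone {v : Word r n} (h : Monotone v) : v = rowOf (contentOf v) := by
  rw [← comp_sort, Tuple.sort_eq_refl_iff_monotone.2 h]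
  rfl

/-- The shortest permutation that takes the nondecreasing word to `v`. -/
def dWord (v : Word r n) : Equiv.Perm (Fin n) := (Tuple.sort v)⁻¹

theorem rowOf_dWord (v : Word r n) (p : Fin n) : rowOf (contentOf v) (dWord v p) = v p := by
  rw [← comp_sort]
  exact congrArg v ((Tuple.sort v).apply_symm_apply p)

theorem rowOf_comp_dWord (v : Word r n) : rowOf (contentOf v) ∘ dWord v = v :=
  funext (rowOf_dWord v)

/-- The inverse of the stable sort is the permutation in its coset of the Young subgroup that keeps
places with equal letters in order; all later identifications of $d(\mathfrak s)$ and of double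
coset representatives go through this characterisation. -/
theorem dWord_eq_iff {v : Word r n} {w : Equiv.Perm (Fin n)} :
    w = dWord v ↔ rowOf (contentOf v) ∘ w = v ∧ ∀ p p', p < p' → v p = v p' → w p < w p' := by
  rw [dWord, eq_inv_iff_mul_eq_one, ← inv_eq_iff_mul_eq_one, Tuple.eq_sort_iff]
  have e1 : ∀ p, w⁻¹ (w p) = p := w.symm_apply_apply
  have e2 : ∀ p, w (w⁻¹ p) = p := w.apply_symm_apply
  constructor
  · rintro ⟨h1, h2⟩
    have h3 := eq_rowOf_of_monotone (v := v ∘ (w⁻¹ : Equiv.Perm (Fin n))) h1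
    rw [contentOf_comp] at h3
    refine ⟨by rw [← h3]; funext p; simp, fun p p' hp hv => ?_⟩
    by_contra hc
    rcases lt_or_eq_of_le (not_lt.1 hc) with hc | hc
    · have := h2 _ _ hc (by simp [hv])
      rw [e1, e1] at this
      exact absurd hp (not_lt.2 this.le)
    · exact hp.ne (w.injective hc.symm)
  · rintro ⟨h1, h2⟩
    refine ⟨?_, fun p p' hp hv => ?_⟩
    · have : v ∘ (w⁻¹ : Equiv.Perm (Fin n)) = rowOf (contentOf v) := by
        conv_lhs => rw [← h1]
        funext p
        simp
      rw [this]
      exact rowOf_monotone _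
    · by_contra hc
      rcases lt_or_eq_of_le (not_lt.1 hc) with hc | hc
      · have := h2 _ _ hc hv.symm
        rw [e2, e2] at this
        exact absurd hp (not_lt.2 this.le)
      · exact hp.ne (w⁻¹.injective hc.symm)

theorem dWord_lt_of_eq {v : Word r n} {p p' : Fin n} (h : p < p') (hv : v p = v p') :
    dWord v p < dWord v p' := (dWord_eq_iff.1 rfl).2 p p' h hv

theorem dWord_lt_of_lt {v : Word r n} {p p' : Fin n} (hv : v p < v p') :
    dWord v p < dWord v p' := by
  by_contra hc
  have := rowOf_monotone (contentOf v) (not_lt.1 hc)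
  rw [rowOf_dWord, rowOf_dWord] at this
  exact absurd hv (not_lt.2 this)

theorem dWord_lt_of_le {v : Word r n} {p p' : Fin n} (h : p < p') (hv : v p ≤ v p') :
    dWord v p < dWord v p' := by
  rcases hv.eq_or_lt with hv | hv
  · exact dWord_lt_of_eq h hv
  · exact dWord_lt_of_lt hv

theorem dWord_of_monotone {v : Word r n} (h : Monotone v) : dWord v = 1 := by
  rw [dWord, Tuple.sort_eq_refl_iff_monotone.2 h]
  rfl

theorem dWord_comp {v : Word r n} {i : Fin (n - 1)} (h : v (lo i) < v (hi i)) :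
    dWord (v ∘ simpleRefl i) = dWord v * simpleRefl i := by
  symm
  rw [dWord_eq_iff, contentOf_comp]
  constructor
  · rw [Equiv.Perm.coe_mul, ← Function.comp_assoc, rowOf_comp_dWord]
  · intro p p' hp hv
    refine dWord_lt_of_eq ?_ hv
    rw [simpleRefl_lt_iff]
    · exact hp
    · rintro ⟨rfl, rfl⟩
      simp only [Function.comp_apply, simpleRefl_lo, simpleRefl_hi] at hv
      exact h.ne hv.symm
    · rintro ⟨rfl, rfl⟩
      exact absurd hp (not_lt.2 (lo_lt_hi i).le)

theorem len_dWord (v : Word r n) : len (dWord v) = inv v := by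
  induction v using word_induction with
  | base v h => rw [dWord_of_monotone h, len_one, inv_eq_zero h]
  | step v i h ih =>
    rw [dWord_comp h, len_mul_simpleRefl (dWord_lt_of_lt h), ih, inv_comp_simpleRefl h]

/-- A place sorted strictly between two equal neighbours would carry the same letter, and stability
would put it strictly between them in the word. This is what turns $g_i$ on the right of $g_{d}$
into a generator of the Young subgroup on the left. -/
theorem dWord_hi_of_eq {v : Word r n} {i : Fin (n - 1)} (h : v (lo i) = v (hi i)) :
    ((dWord v (hi i) : Fin n) : ℕ) = dWord v (lo i) + 1 := by
  have h1 := dWord_lt_of_eq (lo_lt_hi i) h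
  by_contra hne
  have h2 : (dWord v (lo i) : ℕ) + 1 < dWord v (hi i) := by
    rw [Fin.lt_def] at h1
    omega
  obtain ⟨p, hp⟩ := (dWord v).surjective ⟨dWord v (lo i) + 1, h2.trans (Fin.is_lt _)⟩
  have h3 : dWord v (lo i) < dWord v p := by rw [hp, Fin.lt_def]; simp
  have h4 : dWord v p < dWord v (hi i) := by rw [hp, Fin.lt_def]; simpa using h2
  have m1 := rowOf_monotone (contentOf v) h3.le
  have m2 := rowOf_monotone (contentOf v) h4.le
  rw [rowOf_dWord, rowOf_dWord] at m1 m2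
  have e1 : v p = v (lo i) := le_antisymm (h ▸ m2) m1
  have c1 : lo i < p := by
    by_contra hc
    rcases lt_or_eq_of_le (not_lt.1 hc) with hc | hc
    · exact absurd (dWord_lt_of_eq hc e1) (not_lt.2 h3.le)
    · exact h3.ne (by rw [hc])
  have c2 : p < hi i := by
    by_contra hc
    rcases lt_or_eq_of_le (not_lt.1 hc) with hc | hc
    · exact absurd (dWord_lt_of_eq hc (h ▸ e1.symm)) (not_lt.2 h4.le)
    · exact h4.ne (by rw [hc])
  simp only [lo, hi, Fin.lt_def] at c1 c2
  omega

theorem comp_simpleRefl_of_eq {β : Type*} {v : Fin n → β} {i : Fin (n - 1)}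
    (h : v (lo i) = v (hi i)) : v ∘ simpleRefl i = v := by
  funext m
  by_cases h1 : m = lo i
  · rw [h1, Function.comp_apply, simpleRefl_lo, h]
  by_cases h2 : m = hi i
  · rw [h2, Function.comp_apply, simpleRefl_hi, h]
  rw [Function.comp_apply, simpleRefl_of_ne h1 h2]

end Words

/-! ### The matrix representation on words -/

section Representation

variable {R : Type*} [CommRing R] {r n : ℕ} {q : Rˣ} {z : Fin r → R}

/-- The diagonal coefficient of `g_i` on a word with letters `x`, `y` in places `i`, `i+1`. -/
def bCoef (q : Rˣ) (x y : Letter r n) : R :=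
  if x = y then (q : R) - 1
  else if colour x = colour y ∧ y < x then (q : R) - ((q⁻¹ : Rˣ) : R) else 0

theorem bCoef_self (x : Letter r n) : bCoef q x x = (q : R) - 1 := if_pos rfl

theorem bCoef_lt {x y : Letter r n} (h : x < y) : bCoef q x y = (0 : R) := by
  rw [bCoef, if_neg h.ne, if_neg fun h' => absurd h (not_lt.2 h'.2.le)]

theorem bCoef_gt {x y : Letter r n} (h : y < x) (hc : colour x = colour y) :
    bCoef q x y = (q : R) - ((q⁻¹ : Rˣ) : R) := by
  rw [bCoef, if_neg h.ne', if_pos ⟨hc, h⟩]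

theorem bCoef_colour {x y : Letter r n} (hc : colour x ≠ colour y) : bCoef q x y = (0 : R) := by
  rw [bCoef, if_neg (fun h => hc (by rw [h])), if_neg fun h => hc h.1]

/-- The matrix of `t_j`. -/
def tMat (z : Fin r → R) (j : Fin n) : Matrix (Word r n) (Word r n) R :=
  Matrix.diagonal fun v => z (colour (v j))

/-- The matrix of `g_i`. -/
def gMat (q : Rˣ) (i : Fin (n - 1)) : Matrix (Word r n) (Word r n) R :=
  fun v u => (if v = u ∘ simpleRefl i then 1 else 0) +
    if v = u then bCoef q (u (lo i)) (u (hi i)) else 0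

theorem vecMul_tMat (x : Word r n → R) (j : Fin n) (u : Word r n) :
    Matrix.vecMul x (tMat z j) u = z (colour (u j)) * x u := by
  rw [tMat, Matrix.vecMul_diagonal, mul_comm]

theorem vecMul_gMat (x : Word r n → R) (i : Fin (n - 1)) (u : Word r n) :
    Matrix.vecMul x (gMat q i) u =
      x (u ∘ simpleRefl i) + bCoef q (u (lo i)) (u (hi i)) * x u := by
  simp [Matrix.vecMul, dotProduct, gMat, mul_add, Finset.sum_add_distrib, mul_comm]

theorem matrix_eq_of_vecMul {ι : Type*} [Fintype ι] [DecidableEq ι] {A B : Matrix ι ι R}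
    (h : ∀ x : ι → R, Matrix.vecMul x A = Matrix.vecMul x B) : A = B := by
  ext i j
  have := congrFun (h (Pi.single i 1)) j
  simpa using this

theorem gMat_transpose (i : Fin (n - 1)) : (gMat (r := r) q i)ᵀ = gMat q i := by
  ext u v
  simp only [Matrix.transpose_apply, gMat]
  congr 1
  · refine if_congr ⟨?_, ?_⟩ rfl rfl <;> rintro rfl <;> rw [comp_simpleRefl_comp]
  · by_cases h : u = v
    · simp [h]
    · simp [h, Ne.symm h]

theorem tMat_transpose (j : Fin n) : (tMat z j)ᵀ = tMat z j := Matrix.diagonal_transpose _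

theorem gMat_far {i j : Fin (n - 1)} (h : (i : ℕ) + 2 ≤ j ∨ (j : ℕ) + 2 ≤ i) :
    gMat (r := r) q i * gMat q j = gMat q j * gMat q i := by
  apply matrix_eq_of_vecMul
  intro x
  funext u
  rw [← Matrix.vecMul_vecMul, ← Matrix.vecMul_vecMul]
  simp only [vecMul_gMat]
  have hc : (u ∘ simpleRefl j) ∘ simpleRefl i = (u ∘ simpleRefl i) ∘ simpleRefl j := by
    have := simpleRefl_commute h
    rw [Function.comp_assoc, Function.comp_assoc, ← Equiv.Perm.coe_mul, ← Equiv.Perm.coe_mul, this]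
  have n1 : lo i ≠ lo j := by simp [lo, Fin.ext_iff]; omega
  have n2 : lo i ≠ hi j := by simp [lo, hi, Fin.ext_iff]; omega
  have n3 : hi i ≠ lo j := by simp [lo, hi, Fin.ext_iff]; omega
  have n4 : hi i ≠ hi j := by simp [hi, Fin.ext_iff]; omega
  rw [hc]
  simp only [Function.comp_apply, simpleRefl_of_ne n1 n2, simpleRefl_of_ne n3 n4,
    simpleRefl_of_ne n1.symm n3.symm, simpleRefl_of_ne n2.symm n4.symm]
  ring

theorem bCoef_mul_swap {x y : Letter r n} (h : x ≠ y) :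
    bCoef q x y * bCoef q y x = (0 : R) := by
  rcases lt_or_gt_of_ne h with h | h
  · rw [bCoef_lt h, zero_mul]
  · rw [bCoef_lt h, mul_zero]

theorem bCoef_eq_or {x y : Letter r n} (h : x ≠ y) :
    bCoef q x y = (0 : R) ∨ bCoef q x y = (q : R) - ((q⁻¹ : Rˣ) : R) := by
  rw [bCoef, if_neg h]
  split_ifs
  · exact Or.inr rfl
  · exact Or.inl rfl

theorem bCoef_mul_self {x y : Letter r n} (h : x ≠ y) :
    bCoef q x y * ((q : R) ^ 2 - 1) = (q : R) * bCoef q x y * bCoef q x y := by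
  have hq : (q : R) * ((q⁻¹ : Rˣ) : R) = 1 := q.mul_inv
  rcases bCoef_eq_or (q := q) h with h | h <;> rw [h]
  · ring
  · linear_combination ((q : R) - ((q⁻¹ : Rˣ) : R)) * hq

/-- A finite check over the orders of three distinct letters; since letters are ordered by colour
first, equal colours at the extremes force the middle colour. -/
theorem bCoef_triple {x y w : Letter r n} (hxy : x ≠ y) (hyw : y ≠ w) (hxw : x ≠ w) :
    bCoef q x w * bCoef q y x + bCoef q x y * bCoef q y w = bCoef q y w * (bCoef q x w : R) ∧
    bCoef q x y * bCoef q x w = bCoef q x w * bCoef q w y + bCoef q y w * (bCoef q x y : R) ∧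
    bCoef q x y * bCoef q x y * bCoef q y w = bCoef q y w * bCoef q y w * (bCoef q x y : R) := by
  have key : ∀ a b : Letter r n, a < b → colour a ≤ colour b := fun a b h => colour_mono h.le
  have h1 := key x y
  have h2 := key y w
  have h3 := key x w
  have h4 := key y x
  have h5 := key w y
  have h6 := key w x
  refine ⟨?_, ?_, ?_⟩
  · rcases lt_or_gt_of_ne hxy with a | a <;> rcases lt_or_gt_of_ne hyw with b | b <;>
      rcases lt_or_gt_of_ne hxw with c | c <;>
      simp only [bCoef_lt a, bCoef_lt b, bCoef_lt c, zero_mul, mul_zero, add_zero, zero_add] <;>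
      grind [bCoef]
  · rcases lt_or_gt_of_ne hxy with a | a <;> rcases lt_or_gt_of_ne hyw with b | b <;>
      rcases lt_or_gt_of_ne hxw with c | c <;>
      simp only [bCoef_lt a, bCoef_lt b, bCoef_lt c, zero_mul, mul_zero, add_zero, zero_add] <;>
      grind [bCoef]
  · rcases bCoef_eq_or (q := q) hxy with h | h <;> rcases bCoef_eq_or (q := q) hyw with h' | h' <;>
      rw [h, h'] <;> ring

/-- The part of the braid relation that is not formal. The letters $x,y,w$ stand in three
consecutive places and $f,g,h$ are the values at the word and at its two adjacent exchanges; a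
repeated letter makes an exchange trivial, which identifies two of these values. -/
theorem bCoef_braid (x y w : Letter r n) (f g h : R) (h1 : y = x → f = g) (h2 : w = y → f = h) :
    bCoef q x w * bCoef q y x * g + bCoef q x y * bCoef q x w * h + bCoef q x y * bCoef q y w * g +
      bCoef q x y * bCoef q x y * bCoef q y w * f =
    bCoef q x w * bCoef q w y * h + bCoef q y w * bCoef q x w * g + bCoef q y w * bCoef q x y * h +
      bCoef q y w * bCoef q y w * bCoef q x y * f := by
  have hq : (q : R) * ((q⁻¹ : Rˣ) : R) = 1 := q.mul_inv
  by_cases exy : y = x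
  · subst exy
    rw [← h1 rfl]
    rcases eq_or_ne w y with rfl | hne
    · rw [h2 rfl]
    · have e1 := bCoef_mul_swap (q := q) hne
      have e2 := bCoef_mul_self (q := q) hne.symm
      rw [bCoef_self]
      linear_combination f * e2 - h * e1
  by_cases eyw : w = y
  · subst eyw
    rw [← h2 rfl]
    have e1 := bCoef_mul_swap (q := q) exy
    have e2 := bCoef_mul_self (q := q) (Ne.symm exy)
    rw [bCoef_self]
    linear_combination g * e1 - f * e2
  by_cases exw : w = x
  · subst exw
    have e1 := bCoef_mul_swap (q := q) exy
    linear_combination (h - g + bCoef q y w * f - bCoef q w y * f) * (- e1)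
  · obtain ⟨e1, e2, e3⟩ := bCoef_triple (q := q) (Ne.symm exy) (Ne.symm eyw) (Ne.symm exw)
    linear_combination g * e1 + h * e2 + f * e3

theorem gMat_braid {i j : Fin (n - 1)} (hij : (j : ℕ) = i + 1) :
    gMat (r := r) q i * gMat q j * gMat q i = gMat q j * gMat q i * gMat q j := by
  apply matrix_eq_of_vecMul
  intro f
  funext u
  simp only [← Matrix.vecMul_vecMul]
  simp only [vecMul_gMat]
  have e := hi_eq_lo hij
  have n1 : hi j ≠ lo i := by simp [lo, hi, Fin.ext_iff]; omega
  have n2 : hi j ≠ hi i := by rw [e]; exact (lo_ne_hi j).symm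
  have n3 : lo i ≠ lo j := by rw [← e]; exact lo_ne_hi i
  have n4 : lo i ≠ hi j := n1.symm
  have s1 : simpleRefl i (lo j) = lo i := by rw [← e, simpleRefl_hi]
  have s2 : simpleRefl i (hi j) = hi j := simpleRefl_of_ne n1 n2
  have s3 : simpleRefl j (lo i) = lo i := simpleRefl_of_ne n3 n4
  have s5 : hi i = lo j := e
  have hb : ((u ∘ simpleRefl i) ∘ simpleRefl j) ∘ simpleRefl i =
      ((u ∘ simpleRefl j) ∘ simpleRefl i) ∘ simpleRefl j := by
    have := simpleRefl_braid hij
    simp only [Function.comp_assoc]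
    simp only [← Equiv.Perm.coe_mul, ← mul_assoc, this]
  have key := bCoef_braid (q := q) (u (lo i)) (u (lo j)) (u (hi j)) (f u) (f (u ∘ simpleRefl i))
    (f (u ∘ simpleRefl j)) (fun h => by rw [comp_simpleRefl_of_eq]; rw [s5, h])
    (fun h => by rw [comp_simpleRefl_of_eq]; rw [h])
  simp only [Function.comp_apply, simpleRefl_lo, simpleRefl_hi, s1, s2, s3, s5,
    comp_simpleRefl_comp, hb] at key ⊢
  linear_combination key

end Representation

end

end YokonumaSchur

namespace YokonumaSchur

noncomputable section

open scoped RightActions Matrix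

section Representation

variable {R : Type*} [CommRing R] {r n : ℕ} {q : Rˣ} {z : Fin r → R}

theorem tMat_comm (i j : Fin n) : tMat z i * tMat z j = tMat z j * tMat z i := by
  simp only [tMat, Matrix.diagonal_mul_diagonal, mul_comm]

theorem gMat_mul_tMat (i : Fin (n - 1)) (j : Fin n) :
    gMat q i * tMat z j = tMat z (simpleRefl i j) * gMat q i := by
  apply matrix_eq_of_vecMul
  intro x
  funext u
  rw [← Matrix.vecMul_vecMul, ← Matrix.vecMul_vecMul]
  simp only [vecMul_gMat, vecMul_tMat, Function.comp_apply, simpleRefl_apply_apply]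
  have key : bCoef q (u (lo i)) (u (hi i)) * z (colour (u (simpleRefl i j))) =
      bCoef q (u (lo i)) (u (hi i)) * z (colour (u j)) := by
    by_cases hc : colour (u (lo i)) = colour (u (hi i))
    · by_cases h1 : j = lo i
      · rw [h1, simpleRefl_lo, hc]
      by_cases h2 : j = hi i
      · rw [h2, simpleRefl_hi, hc]
      rw [simpleRefl_of_ne h1 h2]
    · rw [bCoef_colour hc, zero_mul, zero_mul]
  linear_combination (-x u) * key

theorem tMat_pow (hp : Params q z) (j : Fin n) : tMat z j ^ r = 1 := by
  rw [tMat, Matrix.diagonal_pow, ← Matrix.diagonal_one]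
  congr 1
  funext v
  exact hp.pow_eq_one _

variable [Invertible (r : R)]

theorem eElt_diagonal {ι : Type*} [Fintype ι] [DecidableEq ι] (a b : ι → R) :
    eElt R r (Matrix.diagonal a) (Matrix.diagonal b) =
      Matrix.diagonal fun i => eElt R r (a i) (b i) := by
  have h := map_eElt (r := r) (Matrix.diagonalAlgHom R (n := ι) (α := R)) a b
  simp only [Matrix.diagonalAlgHom_apply] at h
  rw [← h]
  congr 1
  funext i
  exact map_eElt (Pi.evalAlgHom R (fun _ : ι => R) i) a b

variable [IsDomain R]

theorem eElt_colour (hp : Params q z) (k l : Fin r) :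
    eElt R r (z k) (z l) = if k = l then 1 else 0 := by
  split_ifs with h
  · rw [h, eElt_self (hp.pow_eq_one _)]
  · exact hp.eElt_ne h

/-- Here $e_{i,i+1}$ is the diagonal indicator of equal colours. For equal colours the relation is
checked for ascending, equal and descending letters; for different colours $g_i$ is a mere exchange.
-/
theorem gMat_quad (hp : Params q z) (i : Fin (n - 1)) :
    gMat q i * gMat q i = 1 + ((q : R) - ((q⁻¹ : Rˣ) : R)) •
      (eElt R r (tMat z (lo i)) (tMat z (hi i)) * gMat q i) := by
  apply matrix_eq_of_vecMul
  intro x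
  funext u
  have hq : (q : R) * ((q⁻¹ : Rˣ) : R) = 1 := q.mul_inv
  rw [Matrix.vecMul_add, Matrix.vecMul_one, Matrix.vecMul_smul, ← Matrix.vecMul_vecMul,
    ← Matrix.vecMul_vecMul, tMat, tMat, eElt_diagonal, Pi.add_apply, Pi.smul_apply]
  simp only [vecMul_gMat, Matrix.vecMul_diagonal, Function.comp_apply, simpleRefl_lo,
    simpleRefl_hi, comp_simpleRefl_comp, eElt_colour hp, smul_eq_mul]
  by_cases hc : colour (u (lo i)) = colour (u (hi i))
  · rw [if_pos hc, if_pos hc.symm]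
    rcases lt_trichotomy (u (lo i)) (u (hi i)) with h | h | h
    · rw [bCoef_lt h, bCoef_gt h hc.symm]
      ring
    · rw [comp_simpleRefl_of_eq h, h, bCoef_self]
      linear_combination x u * hq
    · rw [bCoef_lt h, bCoef_gt h hc]
      ring
  · rw [if_neg hc, if_neg (Ne.symm hc), bCoef_colour hc, bCoef_colour (Ne.symm hc)]
    ring

/-- The representation of `Y` on words. -/
def rep (hp : Params q z) (n : ℕ) : Y R r n q →ₐ[R] Matrix (Word r n) (Word r n) R :=
  RingQuot.liftAlgHom R ⟨FreeAlgebra.lift R (Sum.elim (tMat z) (gMat q)), by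
    have hT : ∀ j : Fin n, FreeAlgebra.lift R (Sum.elim (tMat z) (gMat q)) (freeT R j) =
        tMat z j := fun j => by simp [freeT]
    have hG : ∀ i : Fin (n - 1), FreeAlgebra.lift R (Sum.elim (tMat z) (gMat q)) (freeG R i) =
        gMat q i := fun i => by simp [freeG]
    intro x y h
    cases h with
    | far i j h => simp only [map_mul, hG, gMat_far h]
    | braid i j h => simp only [map_mul, hG, gMat_braid h]
    | t_comm i j => simp only [map_mul, hT, tMat_comm i j]
    | g_t i j => simp only [map_mul, hT, hG, gMat_mul_tMat]
    | t_pow j => simp only [map_pow, hT, map_one, tMat_pow hp]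
    | quad i =>
      simp only [map_mul, map_add, map_one, map_smul, map_eElt, hT, hG]
      exact gMat_quad hp i⟩

theorem rep_mkY (hp : Params q z) (x : FreeAlgebra R (Fin n ⊕ Fin (n - 1))) :
    rep hp n (mkY R r n q x) = FreeAlgebra.lift R (Sum.elim (tMat z) (gMat q)) x :=
  RingQuot.liftAlgHom_mkAlgHom_apply R _ _ x

theorem rep_tY (hp : Params q z) (j : Fin n) : rep hp n (tY R r q j) = tMat z j := by
  rw [tY, rep_mkY, freeT, FreeAlgebra.lift_ι_apply]
  rfl

theorem rep_gY (hp : Params q z) (i : Fin (n - 1)) : rep hp n (gY R r q i) = gMat q i := by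
  rw [gY, rep_mkY, freeG, FreeAlgebra.lift_ι_apply]
  rfl

omit [IsDomain R] in
theorem Y_induction {P : Y R r n q → Prop} (hc : ∀ c, P (algebraMap R _ c))
    (ht : ∀ j, P (tY R r q j)) (hg : ∀ i, P (gY R r q i)) (hm : ∀ a b, P a → P b → P (a * b))
    (ha : ∀ a b, P a → P b → P (a + b)) (y : Y R r n q) : P y := by
  obtain ⟨x, rfl⟩ : ∃ x, mkY R r n q x = y := RingQuot.mkAlgHom_surjective R _ y
  induction x using FreeAlgebra.induction with
  | grade0 c => rw [AlgHom.commutes]; exact hc c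
  | grade1 x =>
    rcases x with j | i
    · exact ht j
    · exact hg i
  | mul a b h1 h2 => rw [map_mul]; exact hm _ _ h1 h2
  | add a b h1 h2 => rw [map_add]; exact ha _ _ h1 h2

/-- Transposition and $*$ are both anti-homomorphisms, and the matrices of all the generators are
symmetric. -/
theorem rep_starY (hp : Params q z) (h : Y R r n q) : rep hp n (starY h) = (rep hp n h)ᵀ := by
  induction h using Y_induction with
  | hc c =>
    rw [Algebra.algebraMap_eq_smul_one, starY_smul, starY_one, map_smul, map_one,
      Matrix.transpose_smul, Matrix.transpose_one]
  | ht j => rw [starY_tY, rep_tY, tMat_transpose]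
  | hg i => rw [starY_gY, rep_gY, gMat_transpose]
  | hm a b ha hb => rw [starY_mul, map_mul, ha, hb, map_mul, Matrix.transpose_mul]
  | ha a b ha hb => rw [starY_add, map_add, ha, hb, map_add, Matrix.transpose_add]

/-! ### The module of words -/

/-- The right `Y`-module with basis the words. -/
def WMod {R : Type*} [CommRing R] {r : ℕ} {q : Rˣ} {z : Fin r → R} (_hp : Params q z) (n : ℕ) :
    Type _ := Word r n → R

instance (hp : Params q z) : AddCommGroup (WMod hp n) :=
  inferInstanceAs (AddCommGroup (Word r n → R))

instance (hp : Params q z) : Module R (WMod hp n) := inferInstanceAs (Module R (Word r n → R))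

/-- The right action of `h` on row vectors. -/
def wAct (hp : Params q z) (h : Y R r n q) (x : Word r n → R) : Word r n → R :=
  Matrix.vecMul x (rep hp n h)

theorem wAct_one (hp : Params q z) (x : Word r n → R) : wAct hp (1 : Y R r n q) x = x := by
  rw [wAct, map_one, Matrix.vecMul_one]

theorem wAct_mul (hp : Params q z) (a b : Y R r n q) (x : Word r n → R) :
    wAct hp (b * a) x = wAct hp a (wAct hp b x) := by
  rw [wAct, map_mul, ← Matrix.vecMul_vecMul]
  rfl

theorem wAct_add (hp : Params q z) (a b : Y R r n q) (x : Word r n → R) :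
    wAct hp (a + b) x = wAct hp a x + wAct hp b x := by
  rw [wAct, map_add, Matrix.vecMul_add]
  rfl

theorem wAct_smul (hp : Params q z) (c : R) (a : Y R r n q) (x : Word r n → R) :
    wAct hp (c • a) x = c • wAct hp a x := by
  rw [wAct, map_smul, Matrix.vecMul_smul]
  rfl

theorem wAct_zero (hp : Params q z) (x : Word r n → R) : wAct hp (0 : Y R r n q) x = 0 := by
  rw [wAct, map_zero, Matrix.vecMul_zero]

instance (hp : Params q z) : Module (Y R r n q)ᵐᵒᵖ (WMod hp n) where
  smul h x := wAct hp h.unop x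
  one_smul x := wAct_one hp x
  mul_smul a b x := wAct_mul hp a.unop b.unop x
  smul_zero a := Matrix.zero_vecMul _
  smul_add a x y := Matrix.add_vecMul _ _ _
  add_smul a b x := wAct_add hp a.unop b.unop x
  zero_smul x := wAct_zero hp x

theorem WMod.ract_def (hp : Params q z) (x : WMod hp n) (h : Y R r n q) :
    x <• h = (Matrix.vecMul (x : Word r n → R) (rep hp n h) : Word r n → R) := rfl

instance (hp : Params q z) : IsScalarTower R (Y R r n q)ᵐᵒᵖ (WMod hp n) where
  smul_assoc c h x := wAct_smul hp c h.unop x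

/-- The basis vector of `WMod` attached to a word. -/
def wv (hp : Params q z) (v : Word r n) : WMod hp n := (Pi.single v 1 : Word r n → R)

theorem ract_tY_apply (hp : Params q z) (x : WMod hp n) (j : Fin n) (u : Word r n) :
    (x <• tY R r q j : WMod hp n) u = z (colour (u j)) * x u := by
  rw [WMod.ract_def, rep_tY]
  exact vecMul_tMat _ _ _

theorem ract_gY_apply (hp : Params q z) (x : WMod hp n) (i : Fin (n - 1)) (u : Word r n) :
    (x <• gY R r q i : WMod hp n) u =
      x (u ∘ simpleRefl i) + bCoef q (u (lo i)) (u (hi i)) * x u := by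
  rw [WMod.ract_def, rep_gY]
  exact vecMul_gMat _ _ _

theorem wv_tY (hp : Params q z) (v : Word r n) (j : Fin n) :
    wv hp v <• tY R r q j = z (colour (v j)) • wv hp v := by
  funext u
  rw [ract_tY_apply]
  change _ = z (colour (v j)) * wv hp v u
  by_cases h : u = v
  · rw [h]
  · simp [wv, h]

theorem wv_gY (hp : Params q z) (v : Word r n) (i : Fin (n - 1)) :
    wv hp v <• gY R r q i =
      wv hp (v ∘ simpleRefl i) + (bCoef q (v (lo i)) (v (hi i)) : R) • wv hp v := by
  funext u
  rw [ract_gY_apply]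
  change _ = wv hp (v ∘ simpleRefl i) u + bCoef q (v (lo i)) (v (hi i)) * wv hp v u
  congr 1
  · have : u ∘ simpleRefl i = v ↔ u = v ∘ simpleRefl i := by
      constructor <;> rintro rfl <;> rw [comp_simpleRefl_comp]
    simp only [wv, Pi.single_apply, this]
  · by_cases h : u = v
    · rw [h]
    · simp [wv, h]

/-! ### The universal property of the modules of words of given content -/

/-- Vectors that satisfy the relations of `m_ν`. -/
structure IsVec (z : Fin r → R) (ν : RComp r n) {N : Type*} [AddCommGroup N] [Module R N]
    [Module (Y R r n q)ᵐᵒᵖ N] (x : N) : Prop where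
  tY_act : ∀ j, x <• tY R r q j = z (compOf ν j) • x
  gY_act : ∀ i, rowOf ν (lo i) = rowOf ν (hi i) → x <• gY R r q i = (q : R) • x

theorem isVec_mElt (hp : Params q z) (ν : RComp r n) : IsVec (q := q) z ν (mElt q z ν) where
  tY_act := mElt_mul_tY hp ν
  gY_act _ h := mElt_mul_gY hp ν h

theorem isVec_wv (hp : Params q z) (ν : RComp r n) :
    IsVec (q := q) z ν (wv hp (rowOf ν)) where
  tY_act j := wv_tY hp _ j
  gY_act i h := by
    rw [wv_gY, comp_simpleRefl_of_eq h, h, bCoef_self]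
    module

section Universal

variable {N : Type*} [AddCommGroup N] [Module R N] [Module (Y R r n q)ᵐᵒᵖ N]
  [IsScalarTower R (Y R r n q)ᵐᵒᵖ N]

theorem IsVec.dWord_tY {ν : RComp r n} {x : N} (hx : IsVec (q := q) z ν x) {v : Word r n}
    (hv : contentOf v = ν) (j : Fin n) :
    (x <• gPerm R r q (dWord v)) <• tY R r q j =
      z (colour (v j)) • (x <• gPerm R r q (dWord v)) := by
  rw [ract_gPerm_tY hx.tY_act, compOf_eq, ← hv, rowOf_dWord]
  rfl

/-- The vectors $xg_{d(v)}$ obey the same formulas as the words $v$, whatever module $x$ lies in.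
This is the universal property: sending $v$ to $xg_{d(v)}$ respects the action. -/
theorem IsVec.dWord_gY (hp : Params q z) {ν : RComp r n} {x : N} (hx : IsVec (q := q) z ν x)
    {v : Word r n} (hv : contentOf v = ν) (i : Fin (n - 1)) :
    (x <• gPerm R r q (dWord v)) <• gY R r q i =
      x <• gPerm R r q (dWord (v ∘ simpleRefl i)) +
        (bCoef q (v (lo i)) (v (hi i)) : R) • (x <• gPerm R r q (dWord v)) := by
  rcases lt_trichotomy (v (lo i)) (v (hi i)) with h | h | h
  · rw [bCoef_lt h, zero_smul, add_zero, dWord_comp h, gPerm_mul_gY (dWord_lt_of_lt h), ract_mul]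
  · rw [comp_simpleRefl_of_eq h, h, bCoef_self, ← ract_mul]
    have hlt := dWord_lt_of_eq (lo_lt_hi i) h
    have hs := dWord_hi_of_eq h
    obtain ⟨j, hj⟩ : ∃ j : Fin (n - 1), lo j = dWord v (lo i) :=
      ⟨⟨dWord v (lo i), by have := (dWord v (hi i)).2; omega⟩, rfl⟩
    have hj2 : hi j = dWord v (hi i) := by
      apply Fin.ext
      rw [hs, ← hj]
      rfl
    -- Equal letters in places $i,i+1$ are sorted to neighbouring places $j,j+1$ of one row of
    -- $\nu$, so $g_{d}g_i=g_jg_{d}$ and $xg_j=qx$.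
    have e1 : dWord v * simpleRefl i = simpleRefl j * dWord v := by
      rw [simpleRefl, simpleRefl, hj, hj2, Equiv.mul_swap_eq_swap_mul]
    rw [← gPerm_mul_gY hlt, e1, gY_mul_gPerm, ract_mul, hx.gY_act, smul_ract]
    · rw [sub_smul, one_smul, add_sub_cancel]
    · rw [hj, hj2, ← hv, rowOf_dWord, rowOf_dWord, h]
    · rw [hj, hj2]
      have e : ∀ p, (dWord v)⁻¹ (dWord v p) = p := (dWord v).symm_apply_apply
      rw [e, e]
      exact lo_lt_hi i
  -- At a descent $g_{d(v)}=g_{d(u)}g_i$ for the shorter word $u$, and the quadratic relation on an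
  -- eigenvector applies.
  · set u := v ∘ simpleRefl i with hu
    have h' : u (lo i) < u (hi i) := by simpa [hu] using h
    have hvu : v = u ∘ simpleRefl i := by rw [hu, comp_simpleRefl_comp]
    have e1 : x <• gPerm R r q (dWord v) = (x <• gPerm R r q (dWord u)) <• gY R r q i := by
      rw [hvu, dWord_comp h', gPerm_mul_gY (dWord_lt_of_lt h'), ract_mul]
    have hcu : contentOf u = ν := by rw [hu, contentOf_comp, hv]
    rw [e1, ract_gY_gY (c := fun j => colour (u j)) hp (hx.dWord_tY hcu)]
    congr 1
    have e2 : v (lo i) = u (hi i) := by simp [hu]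
    have e3 : v (hi i) = u (lo i) := by simp [hu]
    rw [e2, e3]
    split_ifs with hc
    · rw [bCoef_gt h' hc.symm]
    · rw [bCoef_colour (Ne.symm hc), zero_smul]

/-- The image of a word under the homomorphism determined by `x`. -/
def uFun (q : Rˣ) {N : Type*} [AddCommGroup N] [Module (Y R r n q)ᵐᵒᵖ N]
    (ν : RComp r n) (x : N) (v : Word r n) : N :=
  if contentOf v = ν then x <• gPerm R r q (dWord v) else 0

theorem uFun_gY (hp : Params q z) {ν : RComp r n} {x : N} (hx : IsVec (q := q) z ν x)
    (v : Word r n) (i : Fin (n - 1)) :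
    uFun q ν x v <• gY R r q i = uFun q ν x (v ∘ simpleRefl i) +
      (bCoef q (v (lo i)) (v (hi i)) : R) • uFun q ν x v := by
  simp only [uFun, contentOf_comp]
  split_ifs with h
  · exact hx.dWord_gY hp h i
  · simp

theorem uFun_tY {ν : RComp r n} {x : N} (hx : IsVec (q := q) z ν x)
    (v : Word r n) (j : Fin n) :
    uFun q ν x v <• tY R r q j = z (colour (v j)) • uFun q ν x v := by
  simp only [uFun]
  split_ifs with h
  · exact hx.dWord_tY h j
  · simp

/-- The linear extension of `uFun`. -/
def uLin (hp : Params q z) (ν : RComp r n) (x : N) : WMod hp n →ₗ[R] N :=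
  Fintype.linearCombination R (uFun q ν x)

theorem uLin_apply (hp : Params q z) (ν : RComp r n) (x : N) (y : WMod hp n) :
    uLin hp ν x y = ∑ v, y v • uFun q ν x v := rfl

theorem uLin_wv (hp : Params q z) (ν : RComp r n) (x : N) (v : Word r n) :
    uLin hp ν x (wv hp v) = uFun q ν x v := by
  rw [uLin_apply, Finset.sum_eq_single v]
  · simp [wv]
  · intro u _ hu
    simp [wv, hu]
  · simp

theorem WMod.eq_sum (hp : Params q z) (y : WMod hp n) : y = ∑ v, y v • wv hp v := by
  funext u
  have : (∑ v, y v • wv hp v : WMod hp n) u = ∑ v, y v * wv hp v u := by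
    exact Finset.sum_apply u Finset.univ fun v => (y v • wv hp v : Word r n → R)
  rw [this, Finset.sum_eq_single u]
  · simp [wv]
  · intro v _ hv
    simp [wv, hv.symm]
  · simp

theorem uLin_ract (hp : Params q z) {ν : RComp r n} {x : N} (hx : IsVec (q := q) z ν x)
    (h : Y R r n q) (y : WMod hp n) : uLin hp ν x (y <• h) = uLin hp ν x y <• h := by
  have red : ∀ h : Y R r n q, (∀ v, uLin hp ν x (wv hp v <• h) = uLin hp ν x (wv hp v) <• h) →
      ∀ y : WMod hp n, uLin hp ν x (y <• h) = uLin hp ν x y <• h := by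
    intro h hv y
    have e1 : y <• h = ∑ v, y v • (wv hp v <• h) := by
      conv_lhs => rw [WMod.eq_sum hp y, Finset.smul_sum]
      exact Finset.sum_congr rfl fun v _ => smul_ract _ _ _
    have e2 : uLin hp ν x y = ∑ v, y v • uLin hp ν x (wv hp v) := by
      conv_lhs => rw [WMod.eq_sum hp y, map_sum]
      exact Finset.sum_congr rfl fun v _ => LinearMap.map_smul _ _ _
    rw [e1, e2, map_sum, Finset.smul_sum]
    refine Finset.sum_congr rfl fun v _ => ?_
    rw [LinearMap.map_smul, hv, smul_ract]
  induction h using Y_induction generalizing y with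
  | hc c => rw [ract_algebraMap, ract_algebraMap, map_smul]
  | ht j =>
    refine red _ (fun v => ?_) y
    rw [wv_tY, map_smul, uLin_wv, uFun_tY hx]
  | hg i =>
    refine red _ (fun v => ?_) y
    rw [wv_gY, map_add, map_smul, uLin_wv, uLin_wv, uFun_gY hp hx]
  | hm a b ha hb => rw [ract_mul, hb, ha, ← ract_mul]
  | ha a b ha hb => rw [ract_add, map_add, ha, hb, ract_add]

/-- The homomorphism that takes the nondecreasing word of content `ν` to `x` and kills the words
of other contents. -/
def uHom (hp : Params q z) {ν : RComp r n} {x : N} (hx : IsVec (q := q) z ν x) :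
    WMod hp n →ₗ[(Y R r n q)ᵐᵒᵖ] N where
  toFun := uLin hp ν x
  map_add' := map_add _
  map_smul' h y := uLin_ract hp hx h.unop y

theorem uHom_wv (hp : Params q z) {ν : RComp r n} {x : N} (hx : IsVec (q := q) z ν x)
    (v : Word r n) : uHom hp hx (wv hp v) = uFun q ν x v := uLin_wv hp ν x v

theorem uHom_rowOf (hp : Params q z) {ν : RComp r n} {x : N} (hx : IsVec (q := q) z ν x) :
    uHom hp hx (wv hp (rowOf ν)) = x := by
  rw [uHom_wv, uFun, if_pos (contentOf_rowOf ν), dWord_of_monotone (rowOf_monotone ν), gPerm_one,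
    ract_one]

end Universal

theorem wv_rowOf_gPerm (hp : Params q z) (v : Word r n) :
    wv hp (rowOf (contentOf v)) <• gPerm R r q (dWord v) = wv hp v := by
  induction v using word_induction with
  | base v h =>
    rw [dWord_of_monotone h, gPerm_one, ract_one, ← eq_rowOf_of_monotone h]
  | step v i h ih =>
    rw [contentOf_comp, dWord_comp h, gPerm_mul_gY (dWord_lt_of_lt h), ract_mul, ih, wv_gY,
      bCoef_lt h, zero_smul, add_zero]

theorem IsVec.ract_gPerm {N : Type*} [AddCommGroup N] [Module R N] [Module (Y R r n q)ᵐᵒᵖ N]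
    [IsScalarTower R (Y R r n q)ᵐᵒᵖ N] {ν : RComp r n} {x : N} (hx : IsVec (q := q) z ν x)
    (w : Equiv.Perm (Fin n)) (hw : w ∈ youngSubgroup ν) :
    x <• gPerm R r q w = (q : R) ^ len w • x := by
  induction w using perm_induction with
  | base => rw [gPerm_one, ract_one, len_one, pow_zero, one_smul]
  | step w i h ih =>
    have h0 := mem_youngSubgroup.1 hw
    have h1 := h0 (lo i)
    have h2 := h0 (hi i)
    simp only [Equiv.Perm.mul_apply, simpleRefl_lo, simpleRefl_hi] at h1 h2
    have h3 : rowOf ν (lo i) = rowOf ν (hi i) := by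
      apply le_antisymm (rowOf_monotone ν (lo_lt_hi i).le)
      rw [← h1, ← h2]
      exact rowOf_monotone ν h.le
    have hw' : w ∈ youngSubgroup ν := by
      rw [mem_youngSubgroup]
      intro m
      have := h0 (simpleRefl i m)
      rwa [Equiv.Perm.mul_apply, simpleRefl_apply_apply, simpleRefl_rowOf h3] at this
    rw [gPerm_mul_gY h, ract_mul, ih hw', smul_ract, hx.gY_act i h3, smul_smul,
      len_mul_simpleRefl h, pow_succ]

/-- The scalar by which `m_ν` acts on the nondecreasing word of content `ν`. -/
def mConst (q : Rˣ) (z : Fin r → R) (ν : RComp r n) : R :=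
  epsConst z ν * ∑ w ∈ youngSubgroup ν, (q : R) ^ (2 * len w)

theorem mConst_ne_zero (hp : Params q z) (ν : RComp r n) : mConst q z ν ≠ 0 :=
  mul_ne_zero (isUnit_epsConst hp ν).ne_zero
    (hp.poincare n _ ⟨1, mem_youngSubgroup.2 fun _ => rfl⟩)

/-- The factor $u_\nu E_\nu$ acts by its value at the character, and each $q^{l(w)}g_w$ by
$q^{2l(w)}$. The resulting scalar need only be nonzero: it is used for injectivity over a domain. -/
theorem IsVec.ract_mElt (hp : Params q z) {N : Type*} [AddCommGroup N] [Module R N]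
    [Module (Y R r n q)ᵐᵒᵖ N] [IsScalarTower R (Y R r n q)ᵐᵒᵖ N] {ν : RComp r n} {x : N}
    (hx : IsVec (q := q) z ν x) : x <• mElt q z ν = mConst q z ν • x := by
  have h1 : x <• eps q z ν = epsConst z ν • x := by
    have := ract_lift hx.tY_act (epsFree z ν)
    rwa [lift_epsFree, lift_epsFree, epsOf_char hp] at this
  have h2 : x <• xElt q ν = (∑ w ∈ youngSubgroup ν, (q : R) ^ (2 * len w)) • x := by
    rw [xElt, Finset.op_sum, Finset.sum_smul, Finset.sum_smul]
    refine Finset.sum_congr rfl fun w hw => ?_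
    rw [ract_smul, hx.ract_gPerm w hw, smul_smul, two_mul, pow_add]
  rw [mElt_eq, ract_mul, h1, smul_ract, h2, smul_smul, mConst]

end Representation

end

end YokonumaSchur

namespace YokonumaSchur

noncomputable section

open scoped RightActions Matrix

section Endo

variable {R : Type*} [CommRing R] {r n : ℕ} {q : Rˣ} {z : Fin r → R}

/-! ### The endomorphism algebra as a matrix algebra -/

/-- The matrices that commute with the generators of `Y`. -/
def endAlg (n : ℕ) (q : Rˣ) (z : Fin r → R) : Subalgebra R (Matrix (Word r n) (Word r n) R) :=
  Subalgebra.centralizer R (Set.range (gMat q) ∪ Set.range (tMat z))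

theorem mem_endAlg {F : Matrix (Word r n) (Word r n) R} :
    F ∈ endAlg n q z ↔ (∀ i, gMat q i * F = F * gMat q i) ∧ ∀ j, tMat z j * F = F * tMat z j := by
  rw [endAlg, Subalgebra.mem_centralizer_iff]
  constructor
  · exact fun h => ⟨fun i => h _ (Or.inl ⟨i, rfl⟩), fun j => h _ (Or.inr ⟨j, rfl⟩)⟩
  · rintro ⟨h1, h2⟩ _ (⟨i, rfl⟩ | ⟨j, rfl⟩)
    · exact h1 i
    · exact h2 j

theorem transpose_mem_endAlg {F : Matrix (Word r n) (Word r n) R} (h : F ∈ endAlg n q z) :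
    Fᵀ ∈ endAlg n q z := by
  rw [mem_endAlg] at h ⊢
  constructor
  · intro i
    have := congrArg Matrix.transpose (h.1 i)
    rw [Matrix.transpose_mul, Matrix.transpose_mul, gMat_transpose] at this
    exact this.symm
  · intro j
    have := congrArg Matrix.transpose (h.2 j)
    rw [Matrix.transpose_mul, Matrix.transpose_mul, tMat_transpose] at this
    exact this.symm

theorem vecMul_gMat_eq (x : Word r n → R) (i : Fin (n - 1)) :
    x ᵥ* gMat q i = gMat q i *ᵥ x := by
  conv_rhs => rw [← gMat_transpose, Matrix.mulVec_transpose]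

theorem vecMul_tMat_eq (x : Word r n → R) (j : Fin n) :
    x ᵥ* tMat z j = tMat z j *ᵥ x := by
  conv_rhs => rw [← tMat_transpose, Matrix.mulVec_transpose]

/-- The idempotent that projects to the words of content `ν`. -/
def contProj (R : Type*) [CommRing R] (ν : RComp r n) : Matrix (Word r n) (Word r n) R :=
  Matrix.diagonal fun v => if contentOf v = ν then 1 else 0

theorem contProj_mem (ν : RComp r n) : contProj R ν ∈ endAlg n q z := by
  rw [mem_endAlg]
  constructor
  · intro i
    ext u v
    rw [contProj, Matrix.diagonal_mul, Matrix.mul_diagonal]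
    by_cases h : contentOf u = contentOf v
    · rw [h, mul_comm]
    · have : gMat q i u v = (0 : R) := by
        rw [gMat, if_neg, if_neg, add_zero]
        · rintro rfl
          exact h rfl
        · rintro rfl
          exact h (contentOf_comp _ _)
      rw [this, mul_zero, zero_mul]
  · intro j
    rw [contProj, tMat, Matrix.diagonal_mul_diagonal, Matrix.diagonal_mul_diagonal]
    simp only [mul_comm]

@[simp] theorem contProj_transpose (ν : RComp r n) : (contProj R ν)ᵀ = contProj R ν :=
  Matrix.diagonal_transpose _

theorem contProj_mul_self (ν : RComp r n) : contProj R ν * contProj R ν = contProj R ν := by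
  rw [contProj, Matrix.diagonal_mul_diagonal]
  congr 1
  funext v
  split_ifs <;> simp

theorem contProj_mul_apply (ν : RComp r n) (F : Matrix (Word r n) (Word r n) R) (u v : Word r n) :
    (contProj R ν * F) u v = if contentOf u = ν then F u v else 0 := by
  rw [contProj, Matrix.diagonal_mul]
  split_ifs <;> simp

theorem mul_contProj_apply (ν : RComp r n) (F : Matrix (Word r n) (Word r n) R) (u v : Word r n) :
    (F * contProj R ν) u v = if contentOf v = ν then F u v else 0 := by
  rw [contProj, Matrix.mul_diagonal]
  split_ifs <;> simp

/-- The basic relation between the entries of an element of `endAlg`. -/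
theorem entry_rel {F : Matrix (Word r n) (Word r n) R} (h : F ∈ endAlg n q z) (i : Fin (n - 1))
    (u v : Word r n) :
    F (u ∘ simpleRefl i) v + bCoef q (u (lo i)) (u (hi i)) * F u v =
      F u (v ∘ simpleRefl i) + bCoef q (v (lo i)) (v (hi i)) * F u v := by
  have h1 := congrFun (congrFun ((mem_endAlg.1 h).1 i) u) v
  have h2 : (F * gMat q i : Matrix (Word r n) (Word r n) R) u v = (F u ᵥ* gMat q i) v := rfl
  have h3 : (gMat q i * F : Matrix (Word r n) (Word r n) R) u v = ((fun u => F u v) ᵥ* gMat q i) u := by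
    rw [vecMul_gMat_eq]
    rfl
  rw [h2, h3, vecMul_gMat, vecMul_gMat] at h1
  exact h1

theorem entry_colour [IsDomain R] (hp : Params q z) {F : Matrix (Word r n) (Word r n) R}
    (h : F ∈ endAlg n q z) {u v : Word r n} (hF : F u v ≠ 0) (j : Fin n) :
    colour (u j) = colour (v j) := by
  have h1 := congrFun (congrFun ((mem_endAlg.1 h).2 j) u) v
  rw [tMat, Matrix.diagonal_mul, Matrix.mul_diagonal, mul_comm] at h1
  exact hp.inj (mul_left_cancel₀ hF h1)

variable [Invertible (r : R)] [IsDomain R]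

theorem mulVec_wAct (hp : Params q z) {F : Matrix (Word r n) (Word r n) R} (hF : F ∈ endAlg n q z)
    (h : Y R r n q) (x : Word r n → R) : F *ᵥ wAct hp h x = wAct hp h (F *ᵥ x) := by
  rw [mem_endAlg] at hF
  induction h using Y_induction generalizing x with
  | hc c =>
    rw [Algebra.algebraMap_eq_smul_one, wAct_smul, wAct_one, wAct_smul, wAct_one,
      Matrix.mulVec_smul]
  | ht j =>
    rw [wAct, wAct, rep_tY, vecMul_tMat_eq, vecMul_tMat_eq, Matrix.mulVec_mulVec,
      Matrix.mulVec_mulVec, hF.2 j]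
  | hg i =>
    rw [wAct, wAct, rep_gY, vecMul_gMat_eq, vecMul_gMat_eq, Matrix.mulVec_mulVec,
      Matrix.mulVec_mulVec, hF.1 i]
  | hm a b ha hb => rw [wAct_mul, wAct_mul, hb, ha]
  | ha a b ha hb => rw [wAct_add, wAct_add, Matrix.mulVec_add, ha, hb]

/-- The endomorphism of the module of words given by a matrix. -/
def toEnd (hp : Params q z) : endAlg n q z →ₐ[R] Module.End (Y R r n q)ᵐᵒᵖ (WMod hp n) where
  toFun F :=
    { toFun := fun x => (F.1 *ᵥ (x : Word r n → R) : Word r n → R)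
      map_add' := fun x y => Matrix.mulVec_add F.1 x y
      map_smul' := fun h x => mulVec_wAct hp F.2 h.unop x }
  map_one' := LinearMap.ext fun x => Matrix.one_mulVec (x : Word r n → R)
  map_mul' F G := LinearMap.ext fun x => (Matrix.mulVec_mulVec (x : Word r n → R) F.1 G.1).symm
  map_zero' := LinearMap.ext fun x => Matrix.zero_mulVec (x : Word r n → R)
  map_add' F G := LinearMap.ext fun x => Matrix.add_mulVec F.1 G.1 (x : Word r n → R)
  commutes' c := LinearMap.ext fun x => by
    change (algebraMap R (Matrix (Word r n) (Word r n) R) c) *ᵥ (x : Word r n → R) = c • x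
    rw [Algebra.algebraMap_eq_smul_one]
    exact (Matrix.smul_mulVec c 1 (x : Word r n → R)).trans
      (congrArg (c • ·) (Matrix.one_mulVec (x : Word r n → R)))

theorem toEnd_apply (hp : Params q z) (F : endAlg n q z) (x : WMod hp n) :
    toEnd hp F x = (F.1 *ᵥ (x : Word r n → R) : Word r n → R) := rfl

theorem toEnd_wv (hp : Params q z) (F : endAlg n q z) (u v : Word r n) :
    toEnd hp F (wv hp v) u = F.1 u v := by
  rw [toEnd_apply]
  exact congrFun (Matrix.mulVec_single_one F.1 v) u

theorem WMod.hom_ext (hp : Params q z) {N : Type*} [AddCommGroup N] [Module R N]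
    [Module (Y R r n q)ᵐᵒᵖ N] [IsScalarTower R (Y R r n q)ᵐᵒᵖ N]
    {f g : WMod hp n →ₗ[(Y R r n q)ᵐᵒᵖ] N}
    (h : ∀ v, f (wv hp v) = g (wv hp v)) : f = g := by
  ext x
  rw [WMod.eq_sum hp x, map_sum, map_sum]
  refine Finset.sum_congr rfl fun v _ => ?_
  rw [← ract_algebraMap (r := r) (n := n) (q := q) (wv hp v), map_smul, map_smul, h]

theorem WMod.hom_ext_rowOf (hp : Params q z) {N : Type*} [AddCommGroup N] [Module R N]
    [Module (Y R r n q)ᵐᵒᵖ N] [IsScalarTower R (Y R r n q)ᵐᵒᵖ N]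
    {f g : WMod hp n →ₗ[(Y R r n q)ᵐᵒᵖ] N}
    (h : ∀ ν, f (wv hp (rowOf ν)) = g (wv hp (rowOf ν))) : f = g := by
  refine WMod.hom_ext hp fun v => ?_
  rw [← wv_rowOf_gPerm, map_smul, map_smul, h]

theorem endAlg_ext (hp : Params q z) {F G : Matrix (Word r n) (Word r n) R}
    (hF : F ∈ endAlg n q z) (hG : G ∈ endAlg n q z)
    (h : ∀ (ν : RComp r n) u, F u (rowOf ν) = G u (rowOf ν)) : F = G := by
  have : toEnd hp ⟨F, hF⟩ = toEnd hp ⟨G, hG⟩ := by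
    refine WMod.hom_ext_rowOf hp fun ν => ?_
    funext u
    rw [toEnd_wv, toEnd_wv]
    exact h ν u
  ext u v
  exact (toEnd_wv hp ⟨F, hF⟩ u v).symm.trans ((congrArg (fun f => f (wv hp v) u) this).trans
    (toEnd_wv hp ⟨G, hG⟩ u v))

/-- The matrix of an endomorphism of the module of words. -/
def endMat (hp : Params q z) (f : Module.End (Y R r n q)ᵐᵒᵖ (WMod hp n)) :
    Matrix (Word r n) (Word r n) R := fun u v => (f (wv hp v) : WMod hp n) u

theorem endMat_mem (hp : Params q z) (f : Module.End (Y R r n q)ᵐᵒᵖ (WMod hp n)) :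
    endMat hp f ∈ endAlg n q z := by
  rw [mem_endAlg]
  constructor
  · intro i
    ext u v
    have h1 : (endMat hp f * gMat q i : Matrix (Word r n) (Word r n) R) u v = (endMat hp f u ᵥ* gMat q i) v := rfl
    have h2 : (gMat q i * endMat hp f : Matrix (Word r n) (Word r n) R) u v = ((fun u => endMat hp f u v) ᵥ* gMat q i) u := by
      rw [vecMul_gMat_eq]
      rfl
    have h3 : f (wv hp v <• gY R r q i) u =
        (((fun u => endMat hp f u v) : Word r n → R) ᵥ* gMat q i) u := by
      rw [map_smul, vecMul_gMat]
      exact ract_gY_apply hp (f (wv hp v)) i u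
    rw [h1, h2, ← h3, vecMul_gMat, wv_gY, map_add, ← ract_algebraMap (r := r) (n := n) (q := q) (wv hp v), map_smul,
      ract_algebraMap]
    rfl
  · intro j
    ext u v
    rw [tMat, Matrix.diagonal_mul, Matrix.mul_diagonal]
    have h3 : f (wv hp v <• tY R r q j) u = z (colour (u j)) * endMat hp f u v := by
      rw [map_smul]
      exact ract_tY_apply hp (f (wv hp v)) j u
    rw [← h3, wv_tY, ← ract_algebraMap (r := r) (n := n) (q := q) (wv hp v), map_smul,
      ract_algebraMap, mul_comm]
    rfl

/-- `endAlg` is the endomorphism algebra of the module of words. -/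
def endEquiv (hp : Params q z) : endAlg n q z ≃ₐ[R] Module.End (Y R r n q)ᵐᵒᵖ (WMod hp n) :=
  AlgEquiv.ofBijective (toEnd hp) (by
    constructor
    · intro F G h
      apply Subtype.ext
      ext u v
      rw [← toEnd_wv hp F, h, toEnd_wv]
    · intro f
      refine ⟨⟨endMat hp f, endMat_mem hp f⟩, ?_⟩
      refine WMod.hom_ext hp fun v => ?_
      funext u
      rw [toEnd_wv]
      rfl)

/-! ### The module of words and the permutation modules -/

/-- `m_ν` as an element of `M^ν`. -/
def mGen (q : Rˣ) (z : Fin r → R) (ν : RComp r n) : MType q z ν :=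
  MType.mk (mElt q z ν) (Submodule.subset_span rfl)

theorem isVec_mGen (hp : Params q z) (ν : RComp r n) : IsVec (q := q) z ν (mGen q z ν) where
  tY_act j := Subtype.ext ((isVec_mElt hp ν).tY_act j)
  gY_act i h := Subtype.ext ((isVec_mElt hp ν).gY_act i h)

/-- The homomorphism from the module of words to the sum of the `M^ν`. -/
def toMSum (hp : Params q z) : WMod hp n →ₗ[(Y R r n q)ᵐᵒᵖ] MSum n q z :=
  ∑ ν, incl q z ν ∘ₗ uHom hp (isVec_mGen hp ν)

theorem toMSum_wv (hp : Params q z) (v : Word r n) :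
    toMSum hp (wv hp v) = incl q z (contentOf v) (mGen q z (contentOf v) <• gPerm R r q (dWord v)) := by
  rw [toMSum, LinearMap.sum_apply, Finset.sum_eq_single (contentOf v)]
  · rw [LinearMap.comp_apply, uHom_wv, uFun, if_pos rfl]
  · intro ν _ hν
    rw [LinearMap.comp_apply, uHom_wv, uFun, if_neg hν.symm, map_zero]
  · simp

theorem toMSum_rowOf (hp : Params q z) (ν : RComp r n) :
    toMSum hp (wv hp (rowOf ν)) = incl q z ν (mGen q z ν) := by
  rw [toMSum_wv, dWord_of_monotone (rowOf_monotone ν), gPerm_one, ract_one, contentOf_rowOf]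

/-- The action on the nondecreasing words. -/
def ofMSum (hp : Params q z) : MSum n q z →ₗ[(Y R r n q)ᵐᵒᵖ] WMod hp n :=
  DirectSum.toModule _ _ _ fun ν =>
    { toFun := fun y : MMod q z ν => wv hp (rowOf ν) <• y.1
      map_add' := fun _ _ => ract_add _ _ _
      map_smul' := fun _ _ => ract_mul _ _ _ }

/-- Letting $M^\nu\subseteq Y$ act on $v_\nu$ gives an inverse of `toMSum` up to nonzero scalars. -/
theorem ofMSum_toMSum (hp : Params q z) (v : Word r n) :
    ofMSum hp (toMSum hp (wv hp v)) = mConst q z (contentOf v) • wv hp v := by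
  rw [toMSum_wv]
  have : ofMSum hp (incl q z (contentOf v) (mGen q z (contentOf v) <• gPerm R r q (dWord v))) =
      wv hp (rowOf (contentOf v)) <• (mElt q z (contentOf v) * gPerm R r q (dWord v)) :=
    DirectSum.toModule_lof _ _ _
  rw [this, ract_mul, (isVec_wv hp _).ract_mElt hp, smul_ract, wv_rowOf_gPerm]

theorem ofMSum_toMSum_apply (hp : Params q z) (x : WMod hp n) (u : Word r n) :
    ofMSum hp (toMSum hp x) u = mConst q z (contentOf u) * x u := by
  have h : ofMSum hp (toMSum hp x) = ∑ v, x v • (mConst q z (contentOf v) • wv hp v) := by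
    conv_lhs => rw [WMod.eq_sum hp x, map_sum, map_sum]
    refine Finset.sum_congr rfl fun v _ => ?_
    rw [← ract_algebraMap (r := r) (n := n) (q := q) (wv hp v), map_smul, map_smul, ofMSum_toMSum,
      ract_algebraMap]
  have h2 : (∑ v, x v • (mConst q z (contentOf v) • wv hp v) : WMod hp n) =
      fun v => mConst q z (contentOf v) * x v := by
    rw [WMod.eq_sum hp fun v => mConst q z (contentOf v) * x v]
    refine Finset.sum_congr rfl fun v _ => ?_
    rw [smul_smul, mul_comm]
  rw [h, h2]

theorem MType.exists_eq {ν : RComp r n} (y : MType q z ν) :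
    ∃ h : Y R r n q, y = mGen q z ν <• h := by
  obtain ⟨h, hh⟩ := Submodule.mem_span_singleton.1 y.2
  exact ⟨h.unop, Subtype.ext hh.symm⟩

/-- Injectivity follows from the inverse up to scalars, since the ground ring is a domain;
surjectivity holds because each $M^\nu$ is generated by $m_\nu$, the image of $v_\nu$. -/
theorem toMSum_bijective (hp : Params q z) : Function.Bijective (toMSum hp (n := n)) := by
  constructor
  · rw [injective_iff_map_eq_zero]
    intro x hx
    funext u
    have := ofMSum_toMSum_apply hp x u
    rw [hx, map_zero] at this
    exact (mul_eq_zero.1 this.symm).resolve_left (mConst_ne_zero hp _)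
  · rw [← LinearMap.range_eq_top, eq_top_iff]
    rintro x -
    induction x using DirectSum.induction_on with
    | zero => exact Submodule.zero_mem _
    | of ν y =>
      obtain ⟨h, rfl⟩ := MType.exists_eq y
      refine ⟨wv hp (rowOf ν) <• h, ?_⟩
      rw [map_smul, toMSum_rowOf]
      exact ((incl q z ν).map_smul _ _).symm
    | add x y hx hy => exact Submodule.add_mem _ hx hy

/-- The module of words is the sum of the modules `M^ν`. -/
def msumEquiv (hp : Params q z) : WMod hp n ≃ₗ[(Y R r n q)ᵐᵒᵖ] MSum n q z :=
  LinearEquiv.ofBijective (toMSum hp) (toMSum_bijective hp)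

/-- The Yokonuma–Schur algebra as a matrix algebra. -/
def ysEquiv (hp : Params q z) : endAlg n q z ≃ₐ[R] YS n q z :=
  (endEquiv hp).trans ((msumEquiv hp).conjAlgEquiv R)

theorem ysEquiv_apply (hp : Params q z) (F : endAlg n q z) (x : WMod hp n) :
    ysEquiv hp F (toMSum hp x) = toMSum hp (toEnd hp F x) := by
  change msumEquiv hp (toEnd hp F ((msumEquiv hp).symm (msumEquiv hp x))) = _
  rw [LinearEquiv.symm_apply_apply]
  rfl

/-- The condition on a matrix to correspond to `φ_{ST}`. -/
theorem isPhi_of_matrix (hp : Params q z) {l : RPart r n} {S T : SST l} (F : endAlg n q z)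
    (h1 : ∀ κ, κ ≠ T.type → ∀ u, F.1 u (rowOf κ) = 0)
    (h2 : ∀ u, F.1 u (rowOf T.type) ≠ 0 → contentOf u = S.type)
    (h3 : ∑ u, F.1 u (rowOf T.type) • (mElt q z S.type * gPerm R r q (dWord u)) = mSST q z S T) :
    IsPhi S T (ysEquiv hp F) := by
  have key : ysEquiv hp F (incl q z T.type (mGen q z T.type)) =
      incl q z S.type (∑ u, F.1 u (rowOf T.type) • (mGen q z S.type <• gPerm R r q (dWord u))) := by
    rw [← toMSum_rowOf hp, ysEquiv_apply, WMod.eq_sum hp (toEnd hp F _), map_sum, map_sum]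
    refine Finset.sum_congr rfl fun u _ => ?_
    rw [toEnd_wv, ← ract_algebraMap (r := r) (n := n) (q := q),
      ← ract_algebraMap (r := r) (n := n) (q := q), map_smul, map_smul]
    by_cases hu : F.1 u (rowOf T.type) = 0
    · rw [hu, map_zero, MulOpposite.op_zero, zero_smul, zero_smul]
    · rw [toMSum_wv, h2 u hu]
  have hsum : (∑ u, F.1 u (rowOf T.type) • (mGen q z S.type <• gPerm R r q (dWord u)) :
      MType q z S.type).1 = mSST q z S T := by
    rw [← h3]
    exact map_sum (MMod q z S.type).subtype _ _
  constructor
  · intro h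
    have hm : mSST q z S T * h ∈ MMod q z S.type := by
      rw [← hsum]
      exact (MMod q z S.type).smul_mem (MulOpposite.op h) (Subtype.prop _)
    refine ⟨hm, ?_⟩
    have e1 : incl q z T.type (MType.mk (mElt q z T.type * h) (mElt_mul_mem q z T.type h)) =
        incl q z T.type (mGen q z T.type) <• h :=
      (incl q z T.type).map_smul (MulOpposite.op h) (mGen q z T.type)
    rw [e1, map_smul, key, ← (incl q z S.type).map_smul]
    congr 1
    exact Subtype.ext (congrArg (· * h) hsum)
  · intro κ hκ x
    obtain ⟨h, rfl⟩ := MType.exists_eq x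
    rw [map_smul, ← toMSum_rowOf hp, map_smul, ysEquiv_apply]
    have : toEnd hp F (wv hp (rowOf κ)) = 0 := by
      funext u
      rw [toEnd_wv]
      exact h1 κ hκ u
    rw [this, map_zero, smul_zero]

end Endo

end

end YokonumaSchur

namespace YokonumaSchur

noncomputable section

open scoped RightActions Matrix

/-! ### Pairs of words with prescribed joint multiplicities -/

section Counts

variable {r n : ℕ}

/-- The pair `(u, v)` has `N a b` places where `v` has the letter `a` and `u` has the letter `b`. -/
def Rel (N : Letter r n → Letter r n → ℕ) (u v : Word r n) : Prop :=
  ∀ a b, (Finset.univ.filter fun p => v p = a ∧ u p = b).card = N a b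

/-- `N` has row and column sums `ν` and `κ` and is supported on pairs of letters of equal colour. -/
structure IsCount (N : Letter r n → Letter r n → ℕ) (κ ν : RComp r n) : Prop where
  left : ∀ k i, ∑ a, N a (toLex (k, i)) = κ.part k i
  right : ∀ k i, ∑ b, N (toLex (k, i)) b = ν.part k i
  colour_eq : ∀ a b, N a b ≠ 0 → colour a = colour b

variable {N : Letter r n → Letter r n → ℕ} {κ ν : RComp r n} {u v : Word r n}

theorem IsCount.swap (h : IsCount N κ ν) : IsCount (Function.swap N) ν κ where
  left := h.right
  right := h.left
  colour_eq a b hab := (h.colour_eq b a hab).symm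

theorem rel_swap : Rel (Function.swap N) v u ↔ Rel N u v := by
  simp only [Rel, Function.swap]
  constructor
  · intro h a b
    rw [← h b a]
    simp only [and_comm]
  · intro h a b
    rw [← h b a]
    simp only [and_comm]

theorem rel_comp (w : Equiv.Perm (Fin n)) : Rel N (u ∘ w) (v ∘ w) ↔ Rel N u v := by
  have key : ∀ a b, (Finset.univ.filter fun p => (v ∘ w) p = a ∧ (u ∘ w) p = b).card =
      (Finset.univ.filter fun p => v p = a ∧ u p = b).card := fun a b =>
    Finset.card_bij (fun p _ => w p) (by simp) (by simp) (fun p hp => ⟨w⁻¹ p, by simpa using hp⟩)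
  simp only [Rel, key]

theorem Rel.contentOf_left (h : Rel N u v) (hN : IsCount N κ ν) : contentOf u = κ := by
  apply Subtype.ext
  funext k i
  change (contentOf u).part k i = κ.part k i
  rw [contentOf_part, ← hN.left, Finset.card_eq_sum_card_fiberwise (f := v) (t := Finset.univ)
    (by simp)]
  refine Finset.sum_congr rfl fun a _ => ?_
  rw [← h a, Finset.filter_filter]
  simp only [and_comm]

theorem Rel.contentOf_right (h : Rel N u v) (hN : IsCount N κ ν) : contentOf v = ν :=
  (rel_swap.2 h).contentOf_left hN.swap

theorem Rel.colour_eq (h : Rel N u v) (hN : IsCount N κ ν) (p : Fin n) :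
    colour (u p) = colour (v p) := by
  refine (hN.colour_eq (v p) (u p) ?_).symm
  rw [← h, Finset.card_ne_zero]
  exact ⟨p, by simp⟩

end Counts

/-! ### The homomorphisms attached to double cosets of Young subgroups -/

section Eta

variable {R : Type*} [CommRing R] {r n : ℕ} {q : Rˣ} {z : Fin r → R}
variable {N : Letter r n → Letter r n → ℕ} {κ ν : RComp r n} {u v : Word r n}

open scoped Classical in
/-- The weighted sum of the words `u` such that `(u, v_ν)` has joint multiplicities `N`. -/
def etaVec (q : Rˣ) (N : Letter r n → Letter r n → ℕ) (ν : RComp r n) (u : Word r n) : R :=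
  if Rel N u (rowOf ν) then (q : R) ^ inv u else 0

variable [Invertible (r : R)] [IsDomain R]

theorem wv_self (hp : Params q z) (v : Word r n) : wv hp v v = (1 : R) := by simp [wv]

theorem wv_of_ne (hp : Params q z) (h : u ≠ v) : wv hp v u = (0 : R) := by simp [wv, h]

/-- Ascents suffice: the value at a descent is obtained from the exchanged word, and the diagonal
coefficient $q-q^{-1}$ supplies exactly the difference between $q^{-1}$ and $q$. -/
theorem isVec_of_step (hp : Params q z) {x : WMod hp n}
    (h1 : ∀ u, x u ≠ 0 → ∀ p, colour (u p) = colour (rowOf ν p))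
    (h2 : ∀ u i, rowOf ν (lo i) = rowOf ν (hi i) → u (lo i) < u (hi i) →
      x (u ∘ simpleRefl i) = (q : R) * x u) : IsVec (q := q) z ν x where
  tY_act j := by
    funext u
    rw [ract_tY_apply]
    change _ = z (compOf ν j) * x u
    by_cases h : x u = 0
    · rw [h, mul_zero, mul_zero]
    · rw [h1 u h j]
      rfl
  gY_act i hi' := by
    funext u
    rw [ract_gY_apply]
    change _ = (q : R) * x u
    rcases lt_trichotomy (u (lo i)) (u (hi i)) with h | h | h
    · rw [h2 u i hi' h, bCoef_lt h, zero_mul, add_zero]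
    · rw [comp_simpleRefl_of_eq h, h, bCoef_self]
      ring
    · have e := h2 (u ∘ simpleRefl i) i hi' (by simpa using h)
      rw [comp_simpleRefl_comp] at e
      by_cases h0 : x u = 0
      · rw [h0, mul_zero, mul_zero, add_zero]
        rw [h0] at e
        exact (mul_eq_zero.1 e.symm).resolve_left q.ne_zero
      · rw [bCoef_gt h, e]
        · linear_combination (-x (u ∘ simpleRefl i)) * q.inv_mul
        · rw [h1 u h0, h1 u h0, hi']

theorem etaVec_step {i : Fin (n - 1)} (hi' : rowOf ν (lo i) = rowOf ν (hi i))
    (h : u (lo i) < u (hi i)) :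
    etaVec q N ν (u ∘ simpleRefl i) = (q : R) * etaVec q N ν u := by
  have e : Rel N (u ∘ simpleRefl i) (rowOf ν) ↔ Rel N u (rowOf ν) := by
    conv_lhs => rw [← comp_simpleRefl_of_eq hi']
    exact rel_comp _
  by_cases hR : Rel N u (rowOf ν)
  · rw [etaVec, etaVec, if_pos (e.2 hR), if_pos hR, inv_comp_simpleRefl h, pow_succ']
  · rw [etaVec, etaVec, if_neg (fun h' => hR (e.1 h')), if_neg hR, mul_zero]

theorem isVec_etaVec (hp : Params q z) (hN : IsCount N κ ν) :
    IsVec (q := q) z ν (N := WMod hp n) (etaVec q N ν) := by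
  refine isVec_of_step hp (fun u hu p => ?_) fun u i hi' h => etaVec_step hi' h
  unfold etaVec at hu
  exact Rel.colour_eq (by_contra fun hc => hu (if_neg hc)) hN p

/-- The matrix in `endAlg` whose column at `v_ν` is `etaVec`, with zero columns at the words of
other contents. -/
def eta (hp : Params q z) (hN : IsCount N κ ν) : Matrix (Word r n) (Word r n) R :=
  endMat hp (uHom hp (isVec_etaVec hp hN))

theorem eta_mem (hp : Params q z) (hN : IsCount N κ ν) : eta hp hN ∈ endAlg n q z :=
  endMat_mem hp _

theorem eta_rowOf (hp : Params q z) (hN : IsCount N κ ν) (u : Word r n) :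
    eta hp hN u (rowOf ν) = etaVec q N ν u :=
  congrFun (uHom_rowOf hp (isVec_etaVec hp hN)) u

theorem eta_of_ne (hp : Params q z) (hN : IsCount N κ ν) (hv : contentOf v ≠ ν) (u : Word r n) :
    eta hp hN u v = 0 := by
  have : uHom hp (isVec_etaVec hp hN) (wv hp v) = 0 := (uHom_wv hp _ v).trans (if_neg hv)
  exact congrFun this u

theorem contProj_mul_eta (hp : Params q z) (hN : IsCount N κ ν) :
    contProj R κ * eta hp hN = eta hp hN := by
  refine endAlg_ext hp (mul_mem (contProj_mem κ) (eta_mem hp hN)) (eta_mem hp hN) fun μ u => ?_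
  rw [contProj_mul_apply]
  split_ifs with h
  · rfl
  · by_cases hμ : μ = ν
    · subst hμ
      rw [eta_rowOf, etaVec, if_neg]
      exact fun h' => h (h'.contentOf_left hN)
    · rw [eta_of_ne hp hN (by rwa [contentOf_rowOf])]

theorem eta_of_ne_left (hp : Params q z) (hN : IsCount N κ ν) (hu : contentOf u ≠ κ)
    (v : Word r n) : eta hp hN u v = 0 := by
  rw [← contProj_mul_eta, contProj_mul_apply, if_neg hu]

theorem wv_rowOf_gPerm_of_lt (hp : Params q z) {w : Equiv.Perm (Fin n)}
    (h : ∀ p p', p < p' → rowOf κ (w p) = rowOf κ (w p') → w p < w p') :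
    wv hp (rowOf κ) <• gPerm R r q w = wv hp (rowOf κ ∘ w) := by
  have e : w = dWord (rowOf κ ∘ w) := by
    rw [dWord_eq_iff, contentOf_comp, contentOf_rowOf]
    exact ⟨rfl, h⟩
  have := wv_rowOf_gPerm hp (rowOf κ ∘ w)
  rwa [← e, contentOf_comp, contentOf_rowOf] at this

/-- The column at $v$ is the column at its sorted word acted on by $g_d$, $d=d(v)$. By the symmetry
of the representation, column $v_\kappa$ of the matrix of $g_d$ is the vector $v_\kappa g_{d^{-1}}$.
Since $v$ is sorted along the rows of $\kappa$, $d^{-1}$ is also shortest in its coset for $\kappa$,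
so this vector is a single word. -/
theorem entry_rowOf (hp : Params q z) {F : Matrix (Word r n) (Word r n) R} (hF : F ∈ endAlg n q z)
    (h : ∀ p p', p < p' → rowOf κ p = rowOf κ p' → v p ≤ v p') :
    F (rowOf κ) v = F (rowOf κ ∘ ⇑(dWord v)⁻¹) (rowOf (contentOf v)) := by
  have e1 : ∀ u, rep hp n (gPerm R r q (dWord v)) u (rowOf κ) =
      (wv hp (rowOf κ ∘ ⇑(dWord v)⁻¹) : WMod hp n) u := by
    intro u
    have e := rep_starY hp (gPerm R r q (dWord v))
    rw [starY_gPerm] at e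
    have e' := congrFun (congrFun e (rowOf κ)) u
    rw [Matrix.transpose_apply] at e'
    rw [← e', ← wv_rowOf_gPerm_of_lt hp]
    · exact (congrFun (Matrix.single_one_vecMul (rowOf κ)
        (rep hp n (gPerm R r q (dWord v)⁻¹))) u).symm
    · intro p p' hpp hr
      have f1 : ∀ p, dWord v ((dWord v)⁻¹ p) = p := (dWord v).apply_symm_apply
      rcases lt_trichotomy ((dWord v)⁻¹ p) ((dWord v)⁻¹ p') with hlt | heq | hgt
      · exact hlt
      · exact absurd ((dWord v)⁻¹.injective heq) hpp.ne
      · have := dWord_lt_of_le hgt (h _ _ hgt hr.symm)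
        rw [f1, f1] at this
        exact absurd this (not_lt.2 hpp.le)
  refine (toEnd_wv hp ⟨F, hF⟩ (rowOf κ) v).symm.trans ?_
  rw [← wv_rowOf_gPerm hp v, map_smul]
  change (∑ u, (toEnd hp ⟨F, hF⟩ (wv hp (rowOf (contentOf v))) : Word r n → R) u *
    rep hp n (gPerm R r q (dWord v)) u (rowOf κ)) = _
  simp only [e1]
  rw [Finset.sum_eq_single (rowOf κ ∘ ⇑(dWord v)⁻¹)]
  · rw [toEnd_wv, wv_self, mul_one]
  · intro u _ hu
    rw [wv_of_ne hp hu, mul_zero]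
  · simp

/-- Vectors that are compatible with the rows of `κ` agree if they agree at the words that
increase along the rows of `κ`. -/
theorem eq_of_row_sorted {x y : Word r n → R}
    (hx : ∀ u i, rowOf κ (lo i) = rowOf κ (hi i) → u (lo i) < u (hi i) →
      x (u ∘ simpleRefl i) = (q : R) * x u)
    (hy : ∀ u i, rowOf κ (lo i) = rowOf κ (hi i) → u (lo i) < u (hi i) →
      y (u ∘ simpleRefl i) = (q : R) * y u)
    (h : ∀ u, (∀ p p', p < p' → rowOf κ p = rowOf κ p' → u p ≤ u p') → x u = y u) : x = y := by
  funext u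
  induction hu : inv u using Nat.strong_induction_on generalizing u with
  | _ k ih =>
    by_cases hm : ∀ i, rowOf κ (lo i) = rowOf κ (hi i) → u (lo i) ≤ u (hi i)
    · refine h u fun p p' hpp hr => ?_
      obtain ⟨p, hp⟩ := p
      obtain ⟨p', hp'⟩ := p'
      have hle : p ≤ p' := (Fin.lt_def.1 hpp).le
      clear hpp
      induction p', hle using Nat.le_induction with
      | base => rfl
      | succ m hmn ih2 =>
        have m1 : rowOf κ ⟨p, hp⟩ = rowOf κ ⟨m, by omega⟩ := by
          apply le_antisymm (rowOf_monotone κ hmn)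
          rw [hr]
          exact rowOf_monotone κ (Nat.le_succ m)
        refine (ih2 (by omega) m1).trans ?_
        exact hm ⟨m, by omega⟩ (m1.symm.trans hr)
    · push Not at hm
      obtain ⟨i, hr, hlt⟩ := hm
      have e1 : (u ∘ simpleRefl i) (lo i) < (u ∘ simpleRefl i) (hi i) := by simpa using hlt
      have := ih (inv (u ∘ simpleRefl i)) (by rw [← hu, inv_of_desc hlt]; omega) _ rfl
      rw [← comp_simpleRefl_comp u i, hx _ i hr e1, hy _ i hr e1, this]

theorem row_step_of_isVec (hp : Params q z) {x : WMod hp n} (hx : IsVec (q := q) z κ x)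
    (u : Word r n) (i : Fin (n - 1)) (hr : rowOf κ (lo i) = rowOf κ (hi i))
    (h : u (lo i) < u (hi i)) : x (u ∘ simpleRefl i) = (q : R) * x u := by
  have := congrFun (hx.gY_act i hr) u
  rw [ract_gY_apply, bCoef_lt h, zero_mul, add_zero] at this
  exact this

/-- The image of a vector of type `κ` under a homomorphism is of type `κ`. -/
theorem IsVec.map {N N' : Type*} [AddCommGroup N] [Module R N]
    [Module (Y R r n q)ᵐᵒᵖ N] [IsScalarTower R (Y R r n q)ᵐᵒᵖ N] [AddCommGroup N'] [Module R N']
    [Module (Y R r n q)ᵐᵒᵖ N'] [IsScalarTower R (Y R r n q)ᵐᵒᵖ N'] {x : N}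
    (hx : IsVec (q := q) z κ x) (f : N →ₗ[(Y R r n q)ᵐᵒᵖ] N') : IsVec (q := q) z κ (f x) where
  tY_act j := by
    rw [← map_smul, hx.tY_act, ← ract_algebraMap (r := r) (n := n) (q := q) x, map_smul,
      ract_algebraMap]
  gY_act i h := by
    rw [← map_smul, hx.gY_act i h, ← ract_algebraMap (r := r) (n := n) (q := q) x, map_smul,
      ract_algebraMap]

/-- The column of an element of `endAlg` at `v_κ`. -/
theorem isVec_col (hp : Params q z) {F : Matrix (Word r n) (Word r n) R} (hF : F ∈ endAlg n q z)
    (κ : RComp r n) : IsVec (q := q) z κ (N := WMod hp n) (fun u => F u (rowOf κ)) := by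
  have e : (fun u => F u (rowOf κ)) = toEnd hp ⟨F, hF⟩ (wv hp (rowOf κ)) :=
    funext fun u => (toEnd_wv hp ⟨F, hF⟩ u (rowOf κ)).symm
  have := (isVec_wv hp κ).map (toEnd hp ⟨F, hF⟩)
  rwa [← e] at this

/-- Both sides are determined by their columns at $v_\kappa$, and there by the words sorted along
the rows of $\kappa$. For such a word $d$ is shortest on both sides of the double coset, and the two
entries are $q^{l(d)}$ and $q^{l(d^{-1})}$. -/
theorem eta_transpose (hp : Params q z) (hN : IsCount N κ ν) :
    (eta hp hN)ᵀ = eta hp hN.swap := by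
  have hE := transpose_mem_endAlg (eta_mem hp hN)
  refine endAlg_ext hp hE (eta_mem hp _) fun μ => ?_
  by_cases hμ : μ = κ
  · subst hμ
    refine congrFun (eq_of_row_sorted (q := q) (κ := μ)
      (row_step_of_isVec hp (isVec_col hp hE μ))
      (row_step_of_isVec hp (isVec_col hp (eta_mem hp hN.swap) μ)) fun v hv => ?_)
    rw [Matrix.transpose_apply, entry_rowOf hp (eta_mem hp hN) hv, eta_rowOf]
    by_cases hc : contentOf v = ν
    · have e2 : Rel N (rowOf μ ∘ ⇑(dWord v)⁻¹) (rowOf ν) ↔ Rel (Function.swap N) v (rowOf μ) := by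
        rw [rel_swap, ← rel_comp (dWord v), ← hc, rowOf_comp_dWord, Function.comp_assoc,
          ← Equiv.Perm.coe_mul, inv_mul_cancel, Equiv.Perm.coe_one, Function.comp_id]
      have e3 : inv (rowOf μ ∘ ⇑(dWord v)⁻¹) = inv v := by
        rw [← len_dWord v, ← len_inv, ← len_dWord]
        congr 1
        symm
        rw [dWord_eq_iff, contentOf_comp, contentOf_rowOf]
        refine ⟨rfl, fun p p' hpp hr => ?_⟩
        have f1 : ∀ p, dWord v ((dWord v)⁻¹ p) = p := (dWord v).apply_symm_apply
        rcases lt_trichotomy ((dWord v)⁻¹ p) ((dWord v)⁻¹ p') with hlt | heq | hgt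
        · exact hlt
        · exact absurd ((dWord v)⁻¹.injective heq) hpp.ne
        · have := dWord_lt_of_le hgt (hv _ _ hgt hr.symm)
          rw [f1, f1] at this
          exact absurd this (not_lt.2 hpp.le)
      rw [hc, eta_rowOf, etaVec, etaVec, e3]
      classical
      exact if_congr e2 rfl rfl
    · rw [eta_of_ne hp hN (by rwa [contentOf_rowOf]), etaVec, if_neg]
      exact fun h => hc (h.contentOf_left hN.swap)
  · intro u
    rw [Matrix.transpose_apply, eta_of_ne_left hp hN (by rwa [contentOf_rowOf]),
      eta_of_ne hp hN.swap (by rwa [contentOf_rowOf])]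

end Eta

end

end YokonumaSchur

namespace YokonumaSchur

noncomputable section

open scoped RightActions Matrix

/-! ### Semistandard tableaux and joint multiplicities -/

section Tableaux

variable {r n : ℕ}

/-- The row of a node, as a letter. -/
def nodeRow {μ : RComp r n} (x : Node μ) : Letter r n := toLex (x.1, x.2.1)

open scoped Classical in
/-- The number of entries `a` in the row `b` of a tableau. -/
def tabCount {μ : RComp r n} (S : Node μ → Letter r n) (a b : Letter r n) : ℕ :=
  (Finset.univ.filter fun x => S x = a ∧ nodeRow x = b).card

theorem rowOf_tInit_eq (μ : RComp r n) (x : Node μ) : rowOf μ (tInit μ x) = nodeRow x := by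
  simp [nodeRow]

theorem letter_eq_iff {x : Letter r n} {k : Fin r} {i : Fin n} :
    x = toLex (k, i) ↔ colour x = k ∧ (ofLex x).2 = i :=
  ⟨fun h => h ▸ ⟨rfl, rfl⟩, fun h => ofLex.injective (Prod.ext h.1 h.2)⟩

theorem card_nodeRow (μ : RComp r n) (k : Fin r) (i : Fin n) :
    (Finset.univ.filter fun x : Node μ => nodeRow x = toLex (k, i)).card = μ.part k i := by
  rw [← card_filter_rowOf]
  refine Finset.card_bij (fun x _ => tInit μ x) ?_ (by simp) fun p hp => ⟨(tInit μ).symm p, ?_⟩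
  · intro x hx
    rw [Finset.mem_filter] at hx ⊢
    rw [rowOf_tInit_eq]
    exact ⟨Finset.mem_univ _, hx.2⟩
  · rw [Finset.mem_filter] at hp
    refine ⟨?_, Equiv.apply_symm_apply _ _⟩
    rw [Finset.mem_filter, ← rowOf_tInit_eq, Equiv.apply_symm_apply]
    exact ⟨Finset.mem_univ _, hp.2⟩

theorem card_comp (μ : RComp r n) (k : Fin r) :
    (Finset.univ.filter fun x : Node μ => x.1 = k).card = μ.size k := by
  rw [RComp.size, Finset.card_eq_sum_card_fiberwise (f := fun x : Node μ => x.2.1)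
    (t := Finset.univ) (by simp)]
  refine Finset.sum_congr rfl fun i _ => ?_
  rw [← card_nodeRow, Finset.filter_filter]
  congr 1
  ext x
  simp [nodeRow, Prod.ext_iff]

section SST

variable {l : RPart r n}

theorem SST.mem (S : SST l) : S.tab ∈ T0plus l S.type := S.2.2

theorem SST.card_type (S : SST l) (k : Fin r) (i : Fin n) :
    (Finset.univ.filter fun x => S.tab x = toLex (k, i)).card = S.type.part k i := by
  rw [← S.mem.1.1 k i, Nat.card_eq_fintype_card, Fintype.card_subtype]

theorem SST.row_mono (S : SST l) (k : Fin r) (i : Fin n) :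
    Monotone fun j : Fin (l.toComp.part k i) => S.tab ⟨k, i, j⟩ := S.mem.1.2.1 k i

theorem SST.col_lt (S : SST l) {k : Fin r} {i i' : Fin n} {j : ℕ} (h : j < l.toComp.part k i)
    (h' : j < l.toComp.part k i') (hi : i < i') :
    S.tab ⟨k, i, ⟨j, h⟩⟩ < S.tab ⟨k, i', ⟨j, h'⟩⟩ := S.mem.1.2.2.1 k i i' j h h' hi

theorem SST.size_eq (S : SST l) : l.toComp.size = S.type.size := S.mem.2

theorem SST.card_colour (S : SST l) (k : Fin r) :
    (Finset.univ.filter fun x => colour (S.tab x) = k).card = l.toComp.size k := by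
  rw [S.size_eq, RComp.size, Finset.card_eq_sum_card_fiberwise
    (f := fun x => (ofLex (S.tab x)).2) (t := Finset.univ) (by simp)]
  refine Finset.sum_congr rfl fun i _ => ?_
  rw [← S.card_type, Finset.filter_filter]
  congr 1
  ext x
  simp only [Finset.mem_filter, Finset.mem_univ, true_and, letter_eq_iff]

/-- Every entry has colour at least its component, while each colour occurs as often as the
component has nodes. The two sums of colours therefore agree and all the inequalities are
equalities. Hence semistandard tableaux of the right type split by colour. -/
theorem SST.colour_tab (S : SST l) (x : Node l.toComp) : colour (S.tab x) = x.1 := by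
  have h1 : ∑ x : Node l.toComp, (x.1 : ℕ) = ∑ x, (colour (S.tab x) : ℕ) := by
    rw [← Finset.sum_fiberwise_of_maps_to (s := Finset.univ) (t := Finset.univ)
      (g := fun x : Node l.toComp => x.1) (by simp),
      ← Finset.sum_fiberwise_of_maps_to (s := Finset.univ) (t := Finset.univ)
      (g := fun x : Node l.toComp => colour (S.tab x)) (by simp)]
    refine Finset.sum_congr rfl fun k _ => ?_
    rw [Finset.sum_eq_card_nsmul (b := (k : ℕ)) fun x hx => by rw [(Finset.mem_filter.1 hx).2],
      Finset.sum_eq_card_nsmul (b := (k : ℕ)) fun x hx => by rw [(Finset.mem_filter.1 hx).2],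
      card_comp, S.card_colour]
  have h2 := (Finset.sum_eq_sum_iff_of_le
    (fun x _ => Fin.le_def.1 (S.mem.1.2.2.2 x))).1 h1 x (Finset.mem_univ x)
  exact (Fin.ext h2).symm

theorem SST.isCount (S : SST l) : IsCount (tabCount S.tab) l.toComp S.type where
  left k i := by
    rw [← card_nodeRow, Finset.card_eq_sum_card_fiberwise (f := S.tab) (t := Finset.univ) (by simp)]
    refine Finset.sum_congr rfl fun a _ => ?_
    rw [tabCount, Finset.filter_filter]
    simp only [and_comm]
  right k i := by
    rw [← S.card_type, Finset.card_eq_sum_card_fiberwise (f := nodeRow) (t := Finset.univ)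
      (by simp)]
    refine Finset.sum_congr rfl fun a _ => ?_
    rw [tabCount, Finset.filter_filter]
  colour_eq a b h := by
    rw [tabCount, Finset.card_ne_zero] at h
    obtain ⟨x, hx⟩ := h
    simp only [Finset.mem_filter, Finset.mem_univ, true_and] at hx
    rw [← hx.1, ← hx.2, S.colour_tab]
    rfl

/-! ### Standard tableaux and words -/

theorem dPerm_apply {μ : RComp r n} (s : Tableau μ) (x : Node μ) :
    dPerm s (s x) = tInit μ x := by
  simp [dPerm]

/-- The word whose letter at place `m` is the row of `m` in `s`. -/
def tabWord {μ : RComp r n} (s : Tableau μ) : Word r n := rowOf μ ∘ dPerm s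

theorem tabWord_apply {μ : RComp r n} (s : Tableau μ) (x : Node μ) :
    tabWord s (s x) = nodeRow x := by
  rw [tabWord, Function.comp_apply, dPerm_apply, rowOf_tInit_eq]

/-- Equal letters of the word mark entries of one row of the tableau, and row standardness says that
$d(\mathfrak s)$ keeps them in order. -/
theorem dWord_tabWord {μ : RComp r n} {s : Tableau μ} (hs : IsRowStandard s) :
    dWord (tabWord s) = dPerm s := by
  symm
  rw [dWord_eq_iff, tabWord, contentOf_comp, contentOf_rowOf]
  refine ⟨rfl, fun p p' hp h => ?_⟩
  obtain ⟨⟨k, i, j⟩, rfl⟩ := s.surjective p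
  obtain ⟨⟨k', i', j'⟩, rfl⟩ := s.surjective p'
  rw [← tabWord, tabWord_apply, tabWord_apply] at h
  have h := toLex.injective h
  simp only [Prod.mk.injEq] at h
  obtain ⟨rfl, rfl⟩ := h
  rw [dPerm_apply, dPerm_apply]
  rw [tInit_row_lt]
  by_contra hc
  rcases lt_or_eq_of_le (not_lt.1 hc) with hc | hc
  · exact absurd hp (not_lt.2 (hs k i hc).le)
  · subst hc
    exact lt_irrefl _ hp

theorem rel_tabWord {μ ν : RComp r n} (s : Tableau μ) :
    Rel (tabCount (typeMap ν s)) (tabWord s) (rowOf ν) := by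
  intro a b
  rw [tabCount]
  symm
  refine Finset.card_bij (fun x _ => s x) ?_ (by simp) fun p hp => ⟨s.symm p, ?_⟩
  · intro x hx
    rw [Finset.mem_filter] at hx ⊢
    rw [tabWord_apply]
    exact ⟨Finset.mem_univ _, hx.2⟩
  · rw [Finset.mem_filter] at hp
    refine ⟨?_, Equiv.apply_symm_apply _ _⟩
    rw [Finset.mem_filter, ← tabWord_apply s, typeMap, Equiv.apply_symm_apply]
    exact ⟨Finset.mem_univ _, hp.2⟩

theorem tabWord_injective {s t : Tableau l.toComp} (hs : IsRowStandard s) (ht : IsRowStandard t)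
    (h : tabWord s = tabWord t) : s = t := by
  have e : dPerm s = dPerm t := by rw [← dWord_tabWord hs, ← dWord_tabWord ht, h]
  refine Equiv.ext fun x => ?_
  rw [dPerm_spec s, dPerm_spec t, e]

/-- The number of `j` with `S(k,i,j) = a`. -/
theorem tabCount_row {μ : RComp r n} (S : Node μ → Letter r n) (a : Letter r n) (k : Fin r)
    (i : Fin n) : tabCount S a (toLex (k, i)) =
      (Finset.univ.filter fun j : Fin (μ.part k i) => S ⟨k, i, j⟩ = a).card := by
  rw [tabCount]
  symm
  refine Finset.card_bij (fun j _ => ⟨k, i, j⟩) ?_ ?_ ?_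
  · intro j hj
    simp only [Finset.mem_filter, Finset.mem_univ, true_and] at hj ⊢
    exact ⟨hj, rfl⟩
  · intro j _ j' _ h
    simpa using h
  · rintro ⟨k', i', j⟩ hx
    have hx := (Finset.mem_filter.1 hx).2
    have h := toLex.injective hx.2
    simp only [Prod.mk.injEq] at h
    obtain ⟨rfl, rfl⟩ := h
    exact ⟨j, by simpa using hx.1, rfl⟩

theorem eq_of_tabCount {μ : RComp r n} {S T : Node μ → Letter r n}
    (hS : ∀ k i, Monotone fun j : Fin (μ.part k i) => S ⟨k, i, j⟩)
    (hT : ∀ k i, Monotone fun j : Fin (μ.part k i) => T ⟨k, i, j⟩)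
    (h : tabCount S = tabCount T) : S = T := by
  funext ⟨k, i, j⟩
  refine congrFun (eq_of_monotone_of_card (hS k i) (hT k i) fun a => ?_) j
  rw [← tabCount_row, ← tabCount_row, h]

/-- The word prescribes which entries lie in which row, and these are arranged increasingly. The
type of the result has weakly increasing rows with the row multiplicities of $S$, hence is $S$. -/
theorem exists_std_of_rel (S : SST l) {u : Word r n} (hu : Rel (tabCount S.tab) u (rowOf S.type)) :
    ∃ s : Std l, typeMap S.type s.1 = S.tab ∧ tabWord s.1 = u := by
  have hc : contentOf u = l.toComp := hu.contentOf_left S.isCount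
  set s : Tableau l.toComp := (tInit l.toComp).trans (dWord u)⁻¹ with hs
  have hd : dPerm s = dWord u := by
    refine Equiv.ext fun p => ?_
    obtain ⟨x, rfl⟩ := s.surjective p
    rw [dPerm_apply]
    exact ((dWord u).apply_symm_apply _).symm
  have hw : tabWord s = u := by rw [tabWord, hd, ← hc, rowOf_comp_dWord]
  have hrow : IsRowStandard s := by
    intro k i j j' hj
    rcases lt_trichotomy (s ⟨k, i, j⟩) (s ⟨k, i, j'⟩) with h | h | h
    · exact h
    · have := s.injective h
      simp only [Sigma.mk.injEq, heq_eq_eq, true_and] at this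
      exact absurd this hj.ne
    · have e : u (s ⟨k, i, j'⟩) = u (s ⟨k, i, j⟩) := by
        rw [← hw, tabWord_apply, tabWord_apply]
        rfl
      have h2 := dWord_lt_of_eq h e
      rw [← hd, dPerm_apply, dPerm_apply] at h2
      exact absurd h2 (not_lt.2 ((tInit_row_lt _ _ _ _ _).2 hj).le)
  have htype : typeMap S.type s = S.tab := by
    refine eq_of_tabCount (fun k i j j' hj => ?_) S.row_mono ?_
    · exact rowOf_monotone _ ((hrow k i).monotone hj)
    · funext a b
      rw [← rel_tabWord s a b, hw, hu a b]
  -- Column standardness is inherited: replacing entries by their rows in $\mathfrak t^\mu$ is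
  -- monotone, and the columns of $S$ increase strictly.
  refine ⟨⟨s, hrow, fun k i i' j h h' hi => ?_⟩, htype, hw⟩
  by_contra hc
  have h1 := rowOf_monotone S.type (not_lt.1 hc)
  have h2 := S.col_lt h h' hi
  rw [← htype] at h2
  exact absurd h2 (not_lt.2 h1)

-- Reading a standard tableau as the word of rows of its entries turns the sums that define $m_{ST}$
-- into sums over words with prescribed joint multiplicities.
open scoped Classical in
theorem sum_std {M : Type*} [AddCommMonoid M] (S : SST l) (f : Equiv.Perm (Fin n) → M) :
    ∑ s ∈ Finset.univ.filter (fun s : Std l => typeMap S.type s.1 = S.tab), f (dPerm s.1) =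
      ∑ u ∈ Finset.univ.filter (fun u => Rel (tabCount S.tab) u (rowOf S.type)), f (dWord u) := by
  refine Finset.sum_bij (fun s _ => tabWord s.1) ?_ ?_ ?_ ?_
  · intro s hs
    rw [Finset.mem_filter] at hs ⊢
    refine ⟨Finset.mem_univ _, ?_⟩
    rw [← hs.2]
    exact rel_tabWord s.1
  · intro s _ t _ h
    exact Subtype.ext (tabWord_injective s.2.1 t.2.1 h)
  · intro u hu
    obtain ⟨s, h1, h2⟩ := exists_std_of_rel S (Finset.mem_filter.1 hu).2
    exact ⟨s, by simp [h1], h2⟩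
  · intro s _
    rw [dWord_tabWord s.2.1]

end SST

end Tableaux

/-! ### The elements of the basis -/

section Phi

variable {R : Type*} [CommRing R] {r n : ℕ} {q : Rˣ} {z : Fin r → R} [Invertible (r : R)]
variable {N : Letter r n → Letter r n → ℕ} {κ ν : RComp r n} {u v : Word r n}

/-- Left multiplication by the Young subgroup permutes places within the rows and so keeps every
strict ascent of $u$ an ascent; lengths add at each step of the construction of $d(u)$. -/
theorem young_mul_dWord {w : Equiv.Perm (Fin n)} (hu : contentOf u = κ)
    (hw : w ∈ youngSubgroup κ) :
    gPerm R r q (w * dWord u) = gPerm R r q w * gPerm R r q (dWord u) ∧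
      len (w * dWord u) = len w + inv u := by
  induction u using word_induction with
  | base u h =>
    rw [dWord_of_monotone h, mul_one, gPerm_one, mul_one, inv_eq_zero h]
    exact ⟨rfl, rfl⟩
  | step u i h ih =>
    rw [contentOf_comp] at hu
    have ih := ih hu
    have h1 : (w * dWord u) (lo i) < (w * dWord u) (hi i) := by
      by_contra hc
      have := rowOf_monotone κ (not_lt.1 hc)
      rw [Equiv.Perm.mul_apply, Equiv.Perm.mul_apply, mem_youngSubgroup.1 hw,
        mem_youngSubgroup.1 hw, ← hu, rowOf_dWord, rowOf_dWord] at this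
      exact absurd h (not_lt.2 this)
    rw [dWord_comp h, ← mul_assoc, gPerm_mul_gY h1, gPerm_mul_gY (dWord_lt_of_lt h), ih.1,
      len_mul_simpleRefl h1, ih.2, inv_comp_simpleRefl h, mul_assoc]
    exact ⟨rfl, by omega⟩

-- The permutations on the right are grouped into cosets of the Young subgroup of $\kappa$, one for
-- each word $u$, and factored uniquely with lengths adding. With $v=v_\nu$ the right side is a full
-- double coset sum, symmetric under inversion.
open scoped Classical in
theorem sum_coset (hN : IsCount N κ ν) (v : Word r n) :
    ∑ u ∈ Finset.univ.filter (fun u => Rel N u v),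
        (q : R) ^ inv u • (xElt q κ * gPerm R r q (dWord u)) =
      ∑ w ∈ Finset.univ.filter (fun w : Equiv.Perm (Fin n) => Rel N (rowOf κ ∘ w) v),
        (q : R) ^ len w • gPerm R r q w := by
  rw [← Finset.sum_fiberwise_of_maps_to (s := Finset.univ.filter
      (fun w : Equiv.Perm (Fin n) => Rel N (rowOf κ ∘ w) v))
      (t := Finset.univ.filter (fun u => Rel N u v)) (g := fun w => rowOf κ ∘ ⇑w)
      (fun w hw => by simpa using hw)]
  refine Finset.sum_congr rfl fun u hu => ?_
  have hu := (Finset.mem_filter.1 hu).2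
  have hc := hu.contentOf_left hN
  have hd : rowOf κ ∘ ⇑(dWord u) = u := by rw [← hc, rowOf_comp_dWord]
  rw [xElt, Finset.sum_mul, Finset.smul_sum]
  refine Finset.sum_bij (fun w _ => w * dWord u) ?_ ?_ ?_ ?_
  · intro w hw
    have e : rowOf κ ∘ ⇑(w * dWord u) = u := by
      conv_rhs => rw [← hd]
      funext p
      exact mem_youngSubgroup.1 hw _
    simp only [Finset.mem_filter, Finset.mem_univ, true_and]
    exact ⟨by rwa [e], e⟩
  · intro w _ w' _ h
    exact mul_right_cancel h
  · intro w hw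
    simp only [Finset.mem_filter, Finset.mem_univ, true_and] at hw
    refine ⟨w * (dWord u)⁻¹, ?_, by simp⟩
    rw [mem_youngSubgroup]
    intro m
    have f1 : dWord u ((dWord u)⁻¹ m) = m := (dWord u).apply_symm_apply m
    calc rowOf κ ((w * (dWord u)⁻¹) m) = (rowOf κ ∘ ⇑w) ((dWord u)⁻¹ m) := rfl
      _ = (rowOf κ ∘ ⇑(dWord u)) ((dWord u)⁻¹ m) := by rw [hw.2, hd]
      _ = rowOf κ m := congrArg (rowOf κ) f1
  · intro w hw
    obtain ⟨e1, e2⟩ := young_mul_dWord (R := R) (r := r) (q := q) hc hw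
    rw [e1, e2, smul_mul_assoc, smul_smul, pow_add, mul_comm]

theorem IsCount.size_eq (hN : IsCount N κ ν) (h : Rel N u v) : κ.size = ν.size := by
  rw [← h.contentOf_left hN, ← h.contentOf_right hN]
  have key : ∀ w : Word r n, (contentOf w).size =
      fun k => (Finset.univ.filter fun p => colour (w p) = k).card := by
    intro w
    funext k
    rw [RComp.size, Finset.card_eq_sum_card_fiberwise (f := fun p => (ofLex (w p)).2)
      (t := Finset.univ) (by simp)]
    refine Finset.sum_congr rfl fun i _ => ?_
    rw [contentOf_part, Finset.filter_filter]
    congr 1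
    ext p
    simp only [Finset.mem_filter, Finset.mem_univ, true_and, letter_eq_iff]
  rw [key, key]
  simp only [h.colour_eq hN]

theorem starY_xElt (κ : RComp r n) : starY (xElt (R := R) q κ) = xElt q κ := by
  rw [xElt, starY_sum]
  refine Finset.sum_bij (fun w _ => w⁻¹) ?_ ?_ ?_ ?_
  · intro w hw
    rw [mem_youngSubgroup] at hw ⊢
    intro m
    rw [← hw (w⁻¹ m)]
    exact congrArg (rowOf κ) (w.apply_symm_apply m)
  · intro w _ w' _ h
    exact inv_injective h
  · intro w hw
    refine ⟨w⁻¹, ?_, inv_inv w⟩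
    rw [mem_youngSubgroup] at hw ⊢
    intro m
    rw [← hw (w⁻¹ m)]
    exact congrArg (rowOf κ) (w.apply_symm_apply m)
  · intro w _
    rw [starY_smul, starY_gPerm, len_inv]

variable [IsDomain R]

theorem starY_mElt (hp : Params q z) (κ : RComp r n) : starY (mElt q z κ) = mElt q z κ := by
  rw [mElt_eq, starY_mul, starY_xElt, starY_eps, xElt, Finset.sum_mul, Finset.mul_sum]
  refine Finset.sum_congr rfl fun w hw => ?_
  rw [smul_mul_assoc, mul_smul_comm, gPerm_mul_eps hp κ]
  exact fun j => congrArg (fun x => (ofLex x).1) (mem_youngSubgroup.1 hw j)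

open scoped Classical in
/-- The anti-automorphism `*` exchanges the two sides of a sum over a double coset. -/
theorem starY_sum_rel (hp : Params q z) (hN : IsCount N κ ν) :
    starY (∑ u ∈ Finset.univ.filter (fun u => Rel N u (rowOf ν)),
        (q : R) ^ inv u • (mElt q z κ * gPerm R r q (dWord u))) =
      ∑ v ∈ Finset.univ.filter (fun v => Rel (Function.swap N) v (rowOf κ)),
        (q : R) ^ inv v • (mElt q z ν * gPerm R r q (dWord v)) := by
  have key : ∀ {N : Letter r n → Letter r n → ℕ} {κ ν : RComp r n}, IsCount N κ ν →
      ∑ u ∈ Finset.univ.filter (fun u => Rel N u (rowOf ν)),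
        (q : R) ^ inv u • (mElt q z κ * gPerm R r q (dWord u)) =
      eps q z κ * ∑ w ∈ Finset.univ.filter
        (fun w : Equiv.Perm (Fin n) => Rel N (rowOf κ ∘ w) (rowOf ν)),
        (q : R) ^ len w • gPerm R r q w := by
    intro N κ ν hN
    rw [← sum_coset hN, Finset.mul_sum]
    refine Finset.sum_congr rfl fun u _ => ?_
    rw [mElt_eq, mul_assoc, mul_smul_comm]
  rw [key hN, key hN.swap, starY_mul, starY_eps, starY_sum, Finset.sum_mul, Finset.mul_sum]
  refine Finset.sum_bij (fun w _ => w⁻¹) ?_ ?_ ?_ ?_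
  · intro w hw
    simp only [Finset.mem_filter, Finset.mem_univ, true_and] at hw ⊢
    rw [rel_swap, ← rel_comp w, Function.comp_assoc, ← Equiv.Perm.coe_mul, inv_mul_cancel,
      Equiv.Perm.coe_one, Function.comp_id]
    exact hw
  · intro w _ w' _ h
    exact inv_injective h
  · intro w hw
    refine ⟨w⁻¹, ?_, inv_inv w⟩
    simp only [Finset.mem_filter, Finset.mem_univ, true_and] at hw ⊢
    rw [← rel_comp w, Function.comp_assoc, ← Equiv.Perm.coe_mul, inv_mul_cancel,
      Equiv.Perm.coe_one, Function.comp_id, ← rel_swap]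
    exact hw
  · intro w hw
    simp only [Finset.mem_filter, Finset.mem_univ, true_and] at hw
    -- The two compositions have the same type, so $u_\kappa E_\kappa=u_\nu E_\nu$, and this element
    -- commutes past $g_{w^{-1}}$ because $w$ preserves colours.
    have hs := hN.size_eq hw
    rw [starY_smul, starY_gPerm, len_inv, smul_mul_assoc, mul_smul_comm, eps_eq_of_size hp hs,
      gPerm_mul_eps hp]
    intro j
    have h1 := hw.colour_eq hN (w⁻¹ j)
    have f1 : w (w⁻¹ j) = j := w.apply_symm_apply j
    rw [Function.comp_apply, f1] at h1
    change compOf κ j = compOf ν (w⁻¹ j) at h1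
    rw [← h1, compOf_eq_of_size hs]

variable {l : RPart r n}

/-- The matrix that takes `v_ν` to a weighted sum of words of content `l`. -/
def etaT (hp : Params q z) (T : SST l) : Matrix (Word r n) (Word r n) R := eta hp T.isCount

/-- The matrix of `φ_{ST}`. -/
def phiMat (hp : Params q z) (S T : SST l) : Matrix (Word r n) (Word r n) R :=
  (etaT hp S)ᵀ * etaT hp T

theorem etaT_mem (hp : Params q z) (T : SST l) : etaT hp T ∈ endAlg n q z := eta_mem hp _

theorem phiMat_mem (hp : Params q z) (S T : SST l) : phiMat hp S T ∈ endAlg n q z :=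
  mul_mem (transpose_mem_endAlg (etaT_mem hp S)) (etaT_mem hp T)

theorem phiMat_transpose (hp : Params q z) (S T : SST l) :
    (phiMat hp S T)ᵀ = phiMat hp T S := by
  rw [phiMat, Matrix.transpose_mul, Matrix.transpose_transpose, phiMat]

theorem phiMat_of_ne (hp : Params q z) (S T : SST l) (hv : contentOf v ≠ T.type) :
    phiMat hp S T u v = 0 := by
  rw [phiMat, Matrix.mul_apply]
  exact Finset.sum_eq_zero fun w _ => by rw [show etaT hp T w v = 0 from eta_of_ne hp _ hv w, mul_zero]

theorem phiMat_of_ne_left (hp : Params q z) (S T : SST l) (hu : contentOf u ≠ S.type) :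
    phiMat hp S T u v = 0 := by
  rw [← phiMat_transpose, Matrix.transpose_apply, phiMat_of_ne hp _ _ hu]

open scoped Classical in
theorem uHom_sum (hp : Params q z) (hN : IsCount N κ ν) {M : Type*} [AddCommGroup M] [Module R M]
    [Module (Y R r n q)ᵐᵒᵖ M] [IsScalarTower R (Y R r n q)ᵐᵒᵖ M]
    (f : WMod hp n →ₗ[(Y R r n q)ᵐᵒᵖ] M) :
    f (toEnd hp ⟨eta hp hN, eta_mem hp hN⟩ (wv hp (rowOf ν))) =
      ∑ u ∈ Finset.univ.filter (fun u => Rel N u (rowOf ν)),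
        (q : R) ^ inv u • (f (wv hp (rowOf κ)) <• gPerm R r q (dWord u)) := by
  rw [WMod.eq_sum hp (toEnd hp _ _), map_sum, Finset.sum_filter]
  refine Finset.sum_congr rfl fun u _ => ?_
  rw [toEnd_wv, ← ract_algebraMap (r := r) (n := n) (q := q), map_smul, ract_algebraMap]
  have e : eta hp hN u (rowOf ν) = etaVec q N ν u := eta_rowOf hp hN u
  change eta hp hN u (rowOf ν) • _ = _
  rw [e, etaVec]
  split_ifs with h
  · rw [← f.map_smul, ← h.contentOf_left hN, wv_rowOf_gPerm]
  · rw [zero_smul]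

/-- The composite $\eta_S^{\mathsf T}\eta_T$ is followed on $v_\nu$: $\eta_T$ gives the sum over
$\mathfrak t$ of the words $v_\lambda g_{d(\mathfrak t)}$, and $\eta_S^{\mathsf T}$ takes
$v_\lambda$ to the sum over $\mathfrak s$ of $g_{d(\mathfrak s)}^*m_\lambda$ when words are read in
$M^\mu$. -/
theorem isPhi_phiMat (hp : Params q z) (S T : SST l) :
    IsPhi S T (ysEquiv hp ⟨phiMat hp S T, phiMat_mem hp S T⟩) := by
  classical
  refine isPhi_of_matrix hp _ (fun κ hκ u => ?_) (fun u hu => ?_) ?_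
  · exact phiMat_of_ne hp S T (by rwa [contentOf_rowOf])
  · by_contra hc
    exact hu (phiMat_of_ne_left hp S T hc)
  set f := uHom hp (isVec_mElt hp S.type) with hf
  have e1 : ∑ u, phiMat hp S T u (rowOf T.type) • (mElt q z S.type * gPerm R r q (dWord u)) =
      f (toEnd hp ⟨phiMat hp S T, phiMat_mem hp S T⟩ (wv hp (rowOf T.type))) := by
    rw [WMod.eq_sum hp (toEnd hp _ _), map_sum]
    refine Finset.sum_congr rfl fun u _ => ?_
    rw [toEnd_wv, ← ract_algebraMap (r := r) (n := n) (q := q) (wv hp u), map_smul, ract_algebraMap]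
    change _ = phiMat hp S T u (rowOf T.type) • _
    by_cases hu : contentOf u = S.type
    · rw [hf, uHom_wv, uFun, if_pos hu]
      rfl
    · rw [phiMat_of_ne_left hp S T hu, zero_smul, zero_smul]
  have e2 : toEnd hp (⟨phiMat hp S T, phiMat_mem hp S T⟩ : endAlg n q z) =
      toEnd hp ⟨eta hp S.isCount.swap, eta_mem hp _⟩ * toEnd hp ⟨eta hp T.isCount, eta_mem hp _⟩ := by
    rw [← map_mul]
    congr 1
    apply Subtype.ext
    change _ = eta hp S.isCount.swap * eta hp T.isCount
    rw [← eta_transpose]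
    rfl
  -- The image is first a sum of terms $m_\mu g_{d(u)}$. The inversion symmetry of the double coset
  -- sum rewrites it as $*$ of a sum of terms $m_\lambda g_{d(\mathfrak s)}$.
  have e3 : f (toEnd hp ⟨eta hp S.isCount.swap, eta_mem hp _⟩ (wv hp (rowOf l.toComp))) =
      ∑ s ∈ Finset.univ.filter (fun s : Std l => typeMap S.type s.1 = S.tab),
        (q : R) ^ len (dPerm s.1) • (starY (gPerm R r q (dPerm s.1)) * mElt q z l.toComp) := by
    rw [uHom_sum, hf, uHom_rowOf]
    refine (starY_sum_rel hp S.isCount).symm.trans ?_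
    rw [starY_sum, sum_std S fun w =>
      (q : R) ^ len w • (starY (gPerm R r q w) * mElt q z l.toComp)]
    refine Finset.sum_congr rfl fun u _ => ?_
    rw [starY_smul, starY_mul, starY_mElt hp, len_dWord]
  have e4 := uHom_sum hp T.isCount (f ∘ₗ toEnd hp ⟨eta hp S.isCount.swap, eta_mem hp _⟩)
  rw [LinearMap.comp_apply, LinearMap.comp_apply, e3] at e4
  change ∑ u, phiMat hp S T u (rowOf T.type) • _ = _
  rw [e1, e2, Module.End.mul_apply, e4, mSST, Finset.sum_comm]
  have e5 := sum_std T fun w => (q : R) ^ len w • ((∑ s ∈ Finset.univ.filter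
      (fun s : Std l => typeMap S.type s.1 = S.tab),
        (q : R) ^ len (dPerm s.1) • (starY (gPerm R r q (dPerm s.1)) * mElt q z l.toComp)) <•
          gPerm R r q w)
  simp only [len_dWord] at e5
  refine e5.symm.trans (Finset.sum_congr rfl fun t _ => ?_)
  rw [Finset.smul_sum, Finset.smul_sum]
  refine Finset.sum_congr rfl fun s _ => ?_
  rw [smul_ract, smul_smul, ← pow_add, add_comm]
  rfl

end Phi

end

end YokonumaSchur

namespace YokonumaSchur

noncomputable section

open scoped RightActions Matrix

/-! ### Cumulative joint multiplicities -/

section Cumulative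

variable {r n : ℕ}

/-- The number of places with letter at most `x` in `u` and at most `y` in `v`. -/
def cum (u v : Word r n) (x y : Letter r n) : ℕ :=
  (Finset.univ.filter fun p => u p ≤ x ∧ v p ≤ y).card

/-- The joint multiplicities of a pair of words. -/
def jointCount (u v : Word r n) (a b : Letter r n) : ℕ :=
  (Finset.univ.filter fun p => v p = a ∧ u p = b).card

theorem rel_jointCount (u v : Word r n) : Rel (jointCount u v) u v := fun _ _ => rfl

theorem rel_iff {N : Letter r n → Letter r n → ℕ} {u v : Word r n} :
    Rel N u v ↔ jointCount u v = N :=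
  ⟨fun h => funext fun a => funext fun b => h a b, fun h a b => congrFun (congrFun h a) b⟩

theorem cum_comm (u v : Word r n) (x y : Letter r n) : cum u v x y = cum v u y x := by
  simp only [cum, and_comm]

theorem cum_comp (u v : Word r n) (w : Equiv.Perm (Fin n)) : cum (u ∘ w) (v ∘ w) = cum u v := by
  funext x y
  exact Finset.card_bij (fun p _ => w p) (by simp) (by simp)
    (fun p hp => ⟨w⁻¹ p, by simpa using hp⟩)

theorem cum_eq_sum (u v : Word r n) (x y : Letter r n) :
    cum u v x y = ∑ a ∈ Finset.univ.filter (· ≤ y), ∑ b ∈ Finset.univ.filter (· ≤ x),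
      jointCount u v a b := by
  rw [cum, Finset.card_eq_sum_card_fiberwise (f := v) (t := Finset.univ.filter (· ≤ y))
    (fun p hp => by simp at hp ⊢; exact hp.2)]
  refine Finset.sum_congr rfl fun a ha => ?_
  rw [Finset.card_eq_sum_card_fiberwise (f := u) (t := Finset.univ.filter (· ≤ x))
    (fun p hp => by simp at hp ⊢; exact hp.1.1)]
  refine Finset.sum_congr rfl fun b hb => ?_
  rw [Finset.mem_filter] at ha hb
  rw [Finset.filter_filter, Finset.filter_filter, jointCount]
  congr 1
  ext p
  simp only [Finset.mem_filter, Finset.mem_univ, true_and]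
  constructor
  · rintro ⟨_, h1, h2⟩
    exact ⟨h1, h2⟩
  · rintro ⟨rfl, rfl⟩
    exact ⟨⟨hb.2, ha.2⟩, rfl, rfl⟩

theorem eq_of_sum_le_eq {α : Type*} [LinearOrder α] [Fintype α] {f g : α → ℕ}
    (h : ∀ y, ∑ a ∈ Finset.univ.filter (· ≤ y), f a = ∑ a ∈ Finset.univ.filter (· ≤ y), g a) :
    f = g := by
  funext y
  induction y using WellFoundedLT.induction with
  | _ y ih =>
    have e : (Finset.univ.filter (· ≤ y)) = insert y (Finset.univ.filter (· < y)) := by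
      ext a
      simp [le_iff_eq_or_lt]
    have h1 := h y
    rw [e, Finset.sum_insert (by simp), Finset.sum_insert (by simp),
      Finset.sum_congr rfl fun a ha => ih a (Finset.mem_filter.1 ha).2] at h1
    exact Nat.add_right_cancel h1

/-- Cumulative sums determine the summands, first in one variable and then in the other. Hence the
pointwise order on `cum` is antisymmetric on tableaux. -/
theorem jointCount_eq_of_cum {u v u' v' : Word r n} (h : cum u v = cum u' v') :
    jointCount u v = jointCount u' v' := by
  have h1 : ∀ x, (fun a => ∑ b ∈ Finset.univ.filter (· ≤ x), jointCount u v a b) =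
      fun a => ∑ b ∈ Finset.univ.filter (· ≤ x), jointCount u' v' a b := by
    intro x
    refine eq_of_sum_le_eq fun y => ?_
    rw [← cum_eq_sum, ← cum_eq_sum, h]
  funext a
  exact eq_of_sum_le_eq fun x => congrFun (h1 x) a

theorem cum_eq_of_rel {N : Letter r n → Letter r n → ℕ} {u v u' v' : Word r n} (h : Rel N u v)
    (h' : Rel N u' v') : cum u v = cum u' v' := by
  funext x y
  rw [cum_eq_sum, cum_eq_sum, rel_iff.1 h, rel_iff.1 h']

theorem cum_simpleRefl (u v : Word r n) (i : Fin (n - 1)) :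
    cum u (v ∘ simpleRefl i) = cum (u ∘ simpleRefl i) v := by
  rw [← cum_comp u (v ∘ simpleRefl i) (simpleRefl i), comp_simpleRefl_comp]

/-- Sorting a discordant pair of neighbours raises the cumulative multiplicities. -/
theorem cum_step {u v : Word r n} {i : Fin (n - 1)} (hu : u (hi i) < u (lo i))
    (hv : v (lo i) < v (hi i)) :
    cum u v ≤ cum u (v ∘ simpleRefl i) ∧ cum u v ≠ cum u (v ∘ simpleRefl i) := by
  have split : ∀ (v : Word r n) x y, cum u v x y =
      (Finset.univ.filter fun p => (p ≠ lo i ∧ p ≠ hi i) ∧ u p ≤ x ∧ v p ≤ y).card +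
      ((if u (lo i) ≤ x ∧ v (lo i) ≤ y then 1 else 0) +
        if u (hi i) ≤ x ∧ v (hi i) ≤ y then 1 else 0) := by
    intro v x y
    have e : ∀ P : Fin n → Prop, ∀ [DecidablePred P], (Finset.univ.filter P).card =
        ∑ p, if P p then 1 else 0 := fun P _ => by rw [Finset.card_filter]
    rw [cum, e, e, ← Finset.sum_erase_add _ _ (Finset.mem_univ (lo i)),
      ← Finset.sum_erase_add (Finset.univ.erase (lo i)) _
        (Finset.mem_erase.2 ⟨(lo_ne_hi i).symm, Finset.mem_univ (hi i)⟩),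
      ← Finset.sum_erase_add Finset.univ (fun p => if (p ≠ lo i ∧ p ≠ hi i) ∧ u p ≤ x ∧ v p ≤ y
        then 1 else 0) (Finset.mem_univ (lo i)),
      ← Finset.sum_erase_add (Finset.univ.erase (lo i)) (fun p =>
        if (p ≠ lo i ∧ p ≠ hi i) ∧ u p ≤ x ∧ v p ≤ y then 1 else 0)
        (Finset.mem_erase.2 ⟨(lo_ne_hi i).symm, Finset.mem_univ (hi i)⟩)]
    have e2 : ∑ p ∈ (Finset.univ.erase (lo i)).erase (hi i), (if u p ≤ x ∧ v p ≤ y then 1 else 0) =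
        ∑ p ∈ (Finset.univ.erase (lo i)).erase (hi i),
          if (p ≠ lo i ∧ p ≠ hi i) ∧ u p ≤ x ∧ v p ≤ y then 1 else 0 := by
      refine Finset.sum_congr rfl fun p hp => ?_
      simp only [Finset.mem_erase, Finset.mem_univ, and_true] at hp
      simp [hp.1, hp.2]
    rw [e2]
    simp
    omega
  have common : ∀ x y, (Finset.univ.filter fun p => (p ≠ lo i ∧ p ≠ hi i) ∧ u p ≤ x ∧
      (v ∘ simpleRefl i) p ≤ y) =
      Finset.univ.filter fun p => (p ≠ lo i ∧ p ≠ hi i) ∧ u p ≤ x ∧ v p ≤ y := by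
    intro x y
    refine Finset.filter_congr fun p _ => and_congr_right fun hp => ?_
    rw [Function.comp_apply, simpleRefl_of_ne hp.1 hp.2]
  constructor
  · intro x y
    rw [split, split, common]
    simp only [Function.comp_apply, simpleRefl_lo, simpleRefl_hi]
    apply Nat.add_le_add_left
    by_cases h1 : u (lo i) ≤ x
    · have h2 : u (hi i) ≤ x := hu.le.trans h1
      simp [h1, h2, add_comm]
    · by_cases h2 : v (hi i) ≤ y
      · have h3 : v (lo i) ≤ y := hv.le.trans h2
        simp [h1, h2, h3]
      · simp [h1, h2]
  · intro h
    -- At this pair of bounds the two exchanged places count $0$ before and $1$ after.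
    have := congrFun (congrFun h (u (hi i))) (v (lo i))
    rw [split, split, common] at this
    simp [not_le.2 hu, not_le.2 hv] at this

end Cumulative

/-! ### Block-strict words -/

section Blocks

variable {r n : ℕ} {B : RComp r n}

/-- Words that increase strictly along the blocks of consecutive places given by `B`. -/
def BlockStrict (B : RComp r n) (u : Word r n) : Prop :=
  ∀ p p', p < p' → rowOf B p = rowOf B p' → u p < u p'

theorem BlockStrict.le_iff {u : Word r n} (hu : BlockStrict B u) {p p' : Fin n}
    (h : rowOf B p = rowOf B p') : u p ≤ u p' ↔ p ≤ p' := by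
  constructor
  · intro h1
    by_contra hc
    exact absurd h1 (not_le.2 (hu _ _ (not_le.1 hc) h.symm))
  · intro h1
    rcases h1.eq_or_lt with rfl | h1
    · exact le_rfl
    · exact (hu _ _ h1 h).le

/-- The part of `cum` that comes from one block. -/
def blockCum (B : RComp r n) (c : Letter r n) (u v : Word r n) (x y : Letter r n) : ℕ :=
  (Finset.univ.filter fun p => rowOf B p = c ∧ u p ≤ x ∧ v p ≤ y).card

theorem cum_eq_sum_block (u v : Word r n) (x y : Letter r n) :
    cum u v x y = ∑ c, blockCum B c u v x y := by
  rw [cum, Finset.card_eq_sum_card_fiberwise (f := rowOf B) (t := Finset.univ) (by simp)]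
  refine Finset.sum_congr rfl fun c _ => ?_
  rw [Finset.filter_filter, blockCum]
  congr 1
  ext p
  simp only [Finset.mem_filter]
  tauto

variable {u u' v : Word r n}

theorem block_card_eq (h : jointCount u' (rowOf B) = jointCount u (rowOf B)) (c x : Letter r n) :
    (Finset.univ.filter fun p => rowOf B p = c ∧ u' p ≤ x).card =
      (Finset.univ.filter fun p => rowOf B p = c ∧ u p ≤ x).card := by
  have key : ∀ u : Word r n, (Finset.univ.filter fun p => rowOf B p = c ∧ u p ≤ x).card =
      ∑ b ∈ Finset.univ.filter (· ≤ x), jointCount u (rowOf B) c b := by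
    intro u
    rw [Finset.card_eq_sum_card_fiberwise (f := u) (t := Finset.univ.filter (· ≤ x))
      (fun p hp => by simp at hp ⊢; exact hp.2)]
    refine Finset.sum_congr rfl fun b hb => ?_
    rw [Finset.filter_filter, jointCount]
    congr 1
    ext p
    simp only [Finset.mem_filter, Finset.mem_univ, true_and] at hb ⊢
    constructor
    · rintro ⟨⟨h1, _⟩, h2⟩
      exact ⟨h1, h2⟩
    · rintro ⟨h1, rfl⟩
      exact ⟨⟨h1, hb⟩, rfl⟩
  rw [key, key, h]

/-- Within a block $\{u\le x\}$ and $\{v\le y\}$ are initial segments, hence nested, so their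
intersection is as large as the sizes permit. The size of $\{u\le x\}$ is unchanged when $u$ is
rearranged within blocks. -/
theorem blockCum_le (hu : BlockStrict B u) (hv : BlockStrict B v)
    (h : jointCount u' (rowOf B) = jointCount u (rowOf B)) (c x y : Letter r n) :
    blockCum B c u' v x y ≤ blockCum B c u v x y := by
  by_cases hc : ∀ p, rowOf B p = c → u p ≤ x → v p ≤ y
  · have e : blockCum B c u v x y = (Finset.univ.filter fun p => rowOf B p = c ∧ u p ≤ x).card := by
      rw [blockCum]
      congr 1
      ext p
      simp only [Finset.mem_filter, Finset.mem_univ, true_and]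
      exact ⟨fun h => ⟨h.1, h.2.1⟩, fun h => ⟨h.1, h.2, hc p h.1 h.2⟩⟩
    rw [e, ← block_card_eq h]
    refine Finset.card_le_card fun p hp => ?_
    simp only [Finset.mem_filter, Finset.mem_univ, true_and] at hp ⊢
    exact ⟨hp.1, hp.2.1⟩
  · push Not at hc
    obtain ⟨p₀, h1, h2, h3⟩ := hc
    refine Finset.card_le_card fun p hp => ?_
    simp only [Finset.mem_filter, Finset.mem_univ, true_and] at hp ⊢
    refine ⟨hp.1, ?_, hp.2.2⟩
    have h4 : v p ≤ v p₀ := hp.2.2.trans h3.le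
    rw [hv.le_iff (hp.1.trans h1.symm)] at h4
    exact ((hu.le_iff (hp.1.trans h1.symm)).2 h4).trans h2

theorem cum_block_le (hu : BlockStrict B u) (hv : BlockStrict B v)
    (h : jointCount u' (rowOf B) = jointCount u (rowOf B)) : cum u' v ≤ cum u v := by
  intro x y
  rw [cum_eq_sum_block (B := B), cum_eq_sum_block (B := B)]
  exact Finset.sum_le_sum fun c _ => blockCum_le hu hv h c x y

/-- Equality of the sums over blocks forces equality in each block, and the letters of $u'$ are then
recovered one place after another. -/
theorem eq_of_cum_block_eq (hu : BlockStrict B u) (hv : BlockStrict B v)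
    (h : jointCount u' (rowOf B) = jointCount u (rowOf B)) (he : cum u' v = cum u v) : u' = u := by
  have key : ∀ c x y, blockCum B c u' v x y = blockCum B c u v x y := by
    intro c x y
    have := congrFun (congrFun he x) y
    rw [cum_eq_sum_block (B := B), cum_eq_sum_block (B := B)] at this
    exact (Finset.sum_eq_sum_iff_of_le fun c _ => blockCum_le hu hv h c x y).1 this c
      (Finset.mem_univ c)
  funext p
  induction p using WellFoundedLT.induction with
  | _ p ih =>
    apply eq_of_forall_ge_iff
    intro x
    -- With $y=v(p)$ the places of the block that count are those up to $p$; earlier ones are known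
    -- by induction, which isolates the condition at $p$.
    have e : ∀ w : Word r n, blockCum B (rowOf B p) w v x (v p) =
        (Finset.univ.filter fun p' => p' < p ∧ rowOf B p' = rowOf B p ∧ w p' ≤ x).card +
          if w p ≤ x then 1 else 0 := by
      intro w
      have e1 : (Finset.univ.filter fun p' => rowOf B p' = rowOf B p ∧ w p' ≤ x ∧ v p' ≤ v p) =
          (Finset.univ.filter fun p' => p' < p ∧ rowOf B p' = rowOf B p ∧ w p' ≤ x) ∪
            if w p ≤ x then {p} else ∅ := by
        ext p'
        rw [Finset.mem_union, Finset.mem_filter, Finset.mem_filter]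
        constructor
        · rintro ⟨-, h1, h2, h3⟩
          rw [hv.le_iff h1] at h3
          rcases h3.eq_or_lt with rfl | h3
          · exact Or.inr (by simp [h2])
          · exact Or.inl ⟨Finset.mem_univ _, h3, h1, h2⟩
        · rintro (⟨-, h1, h2, h3⟩ | h1)
          · exact ⟨Finset.mem_univ _, h2, h3, (hv.le_iff h2).2 h1.le⟩
          · split_ifs at h1 with h2
            · rw [Finset.mem_singleton.1 h1]
              exact ⟨Finset.mem_univ _, rfl, h2, le_rfl⟩
            · simp at h1
      rw [blockCum, e1, Finset.card_union_of_disjoint]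
      · split_ifs <;> simp
      · rw [Finset.disjoint_left]
        intro p' h1 h2
        split_ifs at h2
        · rw [Finset.mem_singleton.1 h2] at h1
          simp at h1
        · simp at h2
    have e2 : (Finset.univ.filter fun p' => p' < p ∧ rowOf B p' = rowOf B p ∧ u' p' ≤ x) =
        Finset.univ.filter fun p' => p' < p ∧ rowOf B p' = rowOf B p ∧ u p' ≤ x :=
      Finset.filter_congr fun p' _ => and_congr_right fun hp => by rw [ih p' hp]
    have := key (rowOf B p) x (v p)
    rw [e, e, e2] at this
    have := Nat.add_left_cancel this
    by_cases h1 : u' p ≤ x <;> by_cases h2 : u p ≤ x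
    · exact ⟨fun _ => h2, fun _ => h1⟩
    · rw [if_pos h1, if_neg h2] at this
      exact absurd this one_ne_zero
    · rw [if_neg h1, if_pos h2] at this
      exact absurd this.symm one_ne_zero
    · exact ⟨fun h => absurd h h1, fun h => absurd h h2⟩

end Blocks

/-! ### Column reading -/

section Columns

variable {r n : ℕ}

theorem lt_card_iff_of_antitone {m : ℕ} {f : Fin m → ℕ} (hf : Antitone f) (j : ℕ) (i : Fin m) :
    (i : ℕ) < (Finset.univ.filter fun i => j < f i).card ↔ j < f i :=
  Tuple.lt_card_le_iff_apply_le_of_monotone (α := ℕᵒᵈ) (f := fun i => OrderDual.toDual (f i))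
    (a := OrderDual.toDual (j + 1)) (j := i) hf

theorem sum_card_lt {m : ℕ} {f : Fin m → ℕ} (hf : ∀ i, f i ≤ m) :
    ∑ j : Fin m, (Finset.univ.filter fun i => (j : ℕ) < f i).card = ∑ i, f i := by
  simp only [Finset.card_filter]
  rw [Finset.sum_comm]
  refine Finset.sum_congr rfl fun i _ => ?_
  rw [← Finset.card_filter]
  rw [Fin.card_filter_val_lt, min_eq_right (hf i)]

/-- The conjugate of an `r`-partition. -/
def conj (l : RPart r n) : RComp r n :=
  ⟨fun k j => (Finset.univ.filter fun i => (j : ℕ) < l.toComp.part k i).card, by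
    have : ∀ k, ∑ j : Fin n, (Finset.univ.filter fun i => (j : ℕ) < l.toComp.part k i).card =
        l.toComp.size k := fun k => sum_card_lt fun i => l.toComp.part_le k i
    simp only [this]
    exact l.toComp.sum_size⟩

theorem lt_conj_iff (l : RPart r n) (k : Fin r) (i j : Fin n) :
    (i : ℕ) < (conj l).part k j ↔ (j : ℕ) < l.toComp.part k i :=
  lt_card_iff_of_antitone (l.2 k) j i

theorem conj_part_le (l : RPart r n) (k : Fin r) (j : Fin n) : (conj l).part k j ≤ n :=
  (conj l).part_le k j

/-- Reflection of the diagram. -/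
def conjNode (l : RPart r n) : Node (conj l) ≃ Node l.toComp where
  toFun x := ⟨x.1, ⟨x.2.2, x.2.2.2.trans_le (conj_part_le l _ _)⟩, ⟨x.2.1, (lt_conj_iff l x.1
    ⟨x.2.2, x.2.2.2.trans_le (conj_part_le l _ _)⟩ x.2.1).1 x.2.2.2⟩⟩
  invFun x := ⟨x.1, ⟨x.2.2, x.2.2.2.trans_le (l.toComp.part_le _ _)⟩, ⟨x.2.1, (lt_conj_iff l x.1
    x.2.1 ⟨x.2.2, x.2.2.2.trans_le (l.toComp.part_le _ _)⟩).2 x.2.2.2⟩⟩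
  left_inv _ := rfl
  right_inv _ := rfl

/-- The node of `l` at a place of the column reading. -/
def colNode (l : RPart r n) : Fin n ≃ Node l.toComp := (tInit (conj l)).symm.trans (conjNode l)

/-- The column reading of a tableau. -/
def colWord {l : RPart r n} (S : Node l.toComp → Letter r n) : Word r n := S ∘ colNode l

theorem rowOf_conj_colour (l : RPart r n) (p : Fin n) :
    colour (rowOf (conj l) p) = (colNode l p).1 := rfl

theorem exists_node_of_lt {l : RPart r n} {p p' : Fin n} (h : p < p')
    (hr : rowOf (conj l) p = rowOf (conj l) p') :
    ∃ (k : Fin r) (i i' : Fin n) (j : ℕ) (hj : j < l.toComp.part k i)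
      (hj' : j < l.toComp.part k i'), i < i' ∧ colNode l p = ⟨k, i, ⟨j, hj⟩⟩ ∧
      colNode l p' = ⟨k, i', ⟨j, hj'⟩⟩ := by
  obtain ⟨⟨k, j, i⟩, rfl⟩ := (tInit (conj l)).surjective p
  obtain ⟨⟨k', j', i'⟩, rfl⟩ := (tInit (conj l)).surjective p'
  rw [rowOf_tInit, rowOf_tInit] at hr
  have hr := toLex.injective hr
  simp only [Prod.mk.injEq] at hr
  obtain ⟨rfl, rfl⟩ := hr
  rw [tInit_row_lt] at h
  simp only [colNode, Equiv.trans_apply, Equiv.symm_apply_apply]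
  exact ⟨k, _, _, j, (conjNode l ⟨k, j, i⟩).2.2.2, (conjNode l ⟨k, j, i'⟩).2.2.2,
    Fin.lt_def.2 (Fin.lt_def.1 h), rfl, rfl⟩

theorem SST.blockStrict {l : RPart r n} (S : SST l) : BlockStrict (conj l) (colWord S.tab) := by
  intro p p' h hr
  obtain ⟨k, i, i', j, hj, hj', hi, e1, e2⟩ := exists_node_of_lt h hr
  rw [colWord, Function.comp_apply, Function.comp_apply, e1, e2]
  exact S.col_lt hj hj' hi

theorem nodeRow_blockStrict (l : RPart r n) :
    BlockStrict (conj l) (colWord (l := l) nodeRow) := by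
  intro p p' h hr
  obtain ⟨k, i, i', j, hj, hj', hi, e1, e2⟩ := exists_node_of_lt h hr
  rw [colWord, Function.comp_apply, Function.comp_apply, e1, e2]
  exact Prod.Lex.toLex_lt_toLex.2 (Or.inr ⟨rfl, hi⟩)

theorem SST.rel_colWord {l : RPart r n} (S : SST l) :
    Rel (tabCount S.tab) (colWord (l := l) nodeRow) (colWord S.tab) := by
  intro a b
  rw [tabCount]
  refine Finset.card_bij (fun p _ => colNode l p) ?_ (by simp) fun x hx => ⟨(colNode l).symm x, ?_⟩
  · intro p hp
    rw [Finset.mem_filter] at hp ⊢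
    exact ⟨Finset.mem_univ _, hp.2⟩
  · refine ⟨?_, Equiv.apply_symm_apply _ _⟩
    rw [Finset.mem_filter] at hx ⊢
    rw [colWord, colWord, Function.comp_apply, Function.comp_apply, Equiv.apply_symm_apply]
    exact ⟨Finset.mem_univ _, hx.2⟩

theorem contentOf_colWord_nodeRow (l : RPart r n) :
    contentOf (colWord (l := l) nodeRow) = l.toComp := by
  apply Subtype.ext
  funext k i
  change (contentOf (colWord (l := l) nodeRow)).part k i = l.toComp.part k i
  rw [contentOf_part, ← card_nodeRow]
  refine Finset.card_bij (fun p _ => colNode l p) ?_ (by simp) fun x hx => ⟨(colNode l).symm x, ?_⟩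
  · intro p hp
    rw [Finset.mem_filter] at hp ⊢
    exact ⟨Finset.mem_univ _, hp.2⟩
  · refine ⟨?_, Equiv.apply_symm_apply _ _⟩
    rw [Finset.mem_filter] at hx ⊢
    rw [colWord, Function.comp_apply, Equiv.apply_symm_apply]
    exact ⟨Finset.mem_univ _, hx.2⟩

/-- A block-strict word with the right colours is at least the row word. -/
theorem nodeRow_le {l : RPart r n} {u : Word r n} (hu : BlockStrict (conj l) u)
    (hc : ∀ p, colour (u p) = colour (rowOf (conj l) p)) (p : Fin n) :
    colWord (l := l) nodeRow p ≤ u p := by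
  obtain ⟨⟨k, j, ⟨i, hi⟩⟩, rfl⟩ := (tInit (conj l)).surjective p
  induction i with
  | zero =>
    have h1 := hc (tInit (conj l) ⟨k, j, ⟨0, hi⟩⟩)
    rw [rowOf_conj_colour] at h1
    refine Prod.Lex.le_iff.2 (Or.inr ⟨h1.symm, ?_⟩)
    rw [colWord, Function.comp_apply, colNode, Equiv.trans_apply, Equiv.symm_apply_apply]
    exact Nat.zero_le _
  | succ i ih =>
    have h1 := hc (tInit (conj l) ⟨k, j, ⟨i + 1, hi⟩⟩)
    have h2 := ih (Nat.lt_of_succ_lt hi)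
    have h3 := hu (tInit (conj l) ⟨k, j, ⟨i, Nat.lt_of_succ_lt hi⟩⟩)
      (tInit (conj l) ⟨k, j, ⟨i + 1, hi⟩⟩) ((tInit_row_lt _ _ _ _ _).2 (by simp [Fin.lt_def]))
      (by rw [rowOf_tInit, rowOf_tInit])
    have h4 := lt_of_le_of_lt h2 h3
    rw [rowOf_conj_colour] at h1
    refine Prod.Lex.le_iff.2 (Or.inr ⟨h1.symm, ?_⟩)
    rcases Prod.Lex.lt_iff.1 h4 with h5 | h5
    · have h6 : colour (u (tInit (conj l) ⟨k, j, ⟨i + 1, hi⟩⟩)) = k := by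
        rw [h1, colNode, Equiv.trans_apply, Equiv.symm_apply_apply]
        rfl
      rw [colWord, Function.comp_apply, colNode, Equiv.trans_apply, Equiv.symm_apply_apply] at h5
      exact absurd h6.symm h5.ne
    · have h6 := h5.2
      rw [colWord, Function.comp_apply, colNode, Equiv.trans_apply, Equiv.symm_apply_apply] at h6 ⊢
      rw [Fin.le_def]
      exact Nat.succ_le_of_lt (Fin.lt_def.1 h6)

theorem partialSum_contentOf (u : Word r n) (k : Fin r) (j : ℕ) :
    (contentOf u).partialSum k j = (Finset.univ.filter fun p =>
      colour (u p) < k ∨ (colour (u p) = k ∧ ((ofLex (u p)).2 : ℕ) < j)).card := by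
  rw [Finset.filter_or, Finset.card_union_of_disjoint, RComp.partialSum]
  · congr 1
    · rw [Finset.card_eq_sum_card_fiberwise (f := fun p => colour (u p))
        (t := Finset.univ.filter (· < k)) (fun p hp => by simpa using hp)]
      refine Finset.sum_congr rfl fun c hc => ?_
      rw [RComp.size, Finset.card_eq_sum_card_fiberwise (f := fun p => (ofLex (u p)).2)
        (t := Finset.univ) (by simp)]
      refine Finset.sum_congr rfl fun i _ => ?_
      rw [contentOf_part, Finset.filter_filter, Finset.filter_filter]
      congr 1
      ext p
      simp only [Finset.mem_filter, Finset.mem_univ, true_and, letter_eq_iff] at hc ⊢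
      constructor
      · rintro ⟨h1, h2⟩
        exact ⟨h1 ▸ hc, h1, h2⟩
      · exact fun h => h.2
    · rw [Finset.card_eq_sum_card_fiberwise (f := fun p => (ofLex (u p)).2)
        (t := Finset.univ.filter fun i : Fin n => (i : ℕ) < j) (fun p hp => by
          simp only [Finset.coe_filter, Finset.mem_univ, true_and, Set.mem_ofPred_eq] at hp ⊢
          exact hp.2)]
      refine Finset.sum_congr rfl fun i hi => ?_
      rw [contentOf_part, Finset.filter_filter]
      congr 1
      ext p
      simp only [Finset.mem_filter, Finset.mem_univ, true_and, letter_eq_iff] at hi ⊢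
      constructor
      · rintro ⟨rfl, rfl⟩
        exact ⟨⟨rfl, hi⟩, rfl⟩
      · rintro ⟨⟨h1, _⟩, h2⟩
        exact ⟨h1, h2⟩
  · rw [Finset.disjoint_left]
    intro p h1 h2
    simp only [Finset.mem_filter, Finset.mem_univ, true_and] at h1 h2
    exact h1.ne h2.1

/-- Smaller words have more dominant contents. -/
theorem contentOf_anti {u v : Word r n} (h : ∀ p, u p ≤ v p) : contentOf v ≤ contentOf u := by
  intro k j
  change (contentOf v).partialSum k j ≤ (contentOf u).partialSum k j
  rw [partialSum_contentOf, partialSum_contentOf]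
  refine Finset.card_le_card fun p hp => ?_
  simp only [Finset.mem_filter, Finset.mem_univ, true_and] at hp ⊢
  have h1 := h p
  rcases Prod.Lex.le_iff.1 h1 with h2 | ⟨h2, h3⟩
  · rcases hp with hp | hp
    · exact Or.inl (lt_trans h2 hp)
    · exact Or.inl (lt_of_lt_of_eq h2 hp.1)
  · rcases hp with hp | hp
    · exact Or.inl (lt_of_eq_of_lt h2 hp)
    · exact Or.inr ⟨h2.trans hp.1, lt_of_le_of_lt (Fin.le_def.1 h3) hp.2⟩

/-- Comparable words of equal content agree. -/
theorem eq_of_le_of_contentOf {u v : Word r n} (h : ∀ p, u p ≤ v p)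
    (hc : contentOf u = contentOf v) : u = v := by
  -- Equal contents give equal sums of ranks over all places, so the termwise inequalities are
  -- equalities.
  let rank : Letter r n → ℕ := fun x => (Finset.univ.filter (· < x)).card
  have mono : StrictMono rank := by
    intro x y hxy
    refine Finset.card_lt_card ⟨fun a ha => ?_, fun hs => ?_⟩
    · rw [Finset.mem_filter] at ha ⊢
      exact ⟨ha.1, ha.2.trans hxy⟩
    · have := hs (Finset.mem_filter.2 ⟨Finset.mem_univ x, hxy⟩)
      simp at this
  have e : ∀ u : Word r n, ∑ p, rank (u p) =
      ∑ a, (contentOf u).part (ofLex a).1 (ofLex a).2 * rank a := by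
    intro u
    rw [← Finset.sum_fiberwise_of_maps_to (s := Finset.univ) (t := Finset.univ) (g := u) (by simp)]
    refine Finset.sum_congr rfl fun a _ => ?_
    rw [Finset.sum_eq_card_nsmul (b := rank a) fun p hp => by rw [(Finset.mem_filter.1 hp).2]]
    rfl
  have h1 : ∑ p, rank (u p) = ∑ p, rank (v p) := by rw [e, e, hc]
  funext p
  exact mono.injective ((Finset.sum_eq_sum_iff_of_le fun p _ => mono.monotone (h p)).1 h1 p
    (Finset.mem_univ p))

end Columns

end

end YokonumaSchur

namespace YokonumaSchur

noncomputable section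

open scoped RightActions Matrix

/-- The column reading of the tableau whose entries are the rows. -/
abbrev rowWord {r n : ℕ} (l : RPart r n) : Word r n := colWord (l := l) nodeRow

section Anti

variable {R : Type*} [CommRing R] {r n : ℕ} {q : Rˣ} {z : Fin r → R} [Invertible (r : R)]
variable {B : RComp r n} {u v w : Word r n}

/-! ### Vectors that are antisymmetric along blocks -/

/-- Vectors that are antisymmetric along the blocks of `B`. -/
structure IsAnti (z : Fin r → R) (B : RComp r n) {N : Type*} [AddCommGroup N] [Module R N]
    [Module (Y R r n q)ᵐᵒᵖ N] (x : N) : Prop where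
  tY_act : ∀ j, x <• tY R r q j = z (compOf B j) • x
  gY_act : ∀ i, rowOf B (lo i) = rowOf B (hi i) → x <• gY R r q i = ((-q⁻¹ : Rˣ) : R) • x

theorem IsAnti.map {N N' : Type*} [AddCommGroup N] [Module R N]
    [Module (Y R r n q)ᵐᵒᵖ N] [IsScalarTower R (Y R r n q)ᵐᵒᵖ N] [AddCommGroup N'] [Module R N']
    [Module (Y R r n q)ᵐᵒᵖ N'] [IsScalarTower R (Y R r n q)ᵐᵒᵖ N'] {x : N}
    (hx : IsAnti (q := q) z B x) (f : N →ₗ[(Y R r n q)ᵐᵒᵖ] N') : IsAnti (q := q) z B (f x) where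
  tY_act j := by
    rw [← map_smul, hx.tY_act, ← ract_algebraMap (r := r) (n := n) (q := q) x, map_smul,
      ract_algebraMap]
  gY_act i h := by
    rw [← map_smul, hx.gY_act i h, ← ract_algebraMap (r := r) (n := n) (q := q) x, map_smul,
      ract_algebraMap]

variable [IsDomain R]

theorem IsAnti.colour_eq {hp : Params q z} {x : WMod hp n} (hx : IsAnti (q := q) z B x)
    (hu : x u ≠ 0) (p : Fin n) : colour (u p) = colour (rowOf B p) := by
  have h := congrFun (hx.tY_act p) u
  rw [ract_tY_apply] at h
  exact hp.inj (mul_right_cancel₀ hu h)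

theorem IsAnti.step {hp : Params q z} {x : WMod hp n} (hx : IsAnti (q := q) z B x)
    (u : Word r n) (i : Fin (n - 1)) (hi' : rowOf B (lo i) = rowOf B (hi i))
    (h : u (lo i) < u (hi i)) : x (u ∘ simpleRefl i) = ((-q⁻¹ : Rˣ) : R) * x u := by
  have := congrFun (hx.gY_act i hi') u
  rw [ract_gY_apply, bCoef_lt h, zero_mul, add_zero] at this
  exact this

/-- On a word with equal letters in places $i,i+1$ the generator acts by $q$, while antisymmetry
asks for $-q^{-1}$; the difference $q+q^{-1}$ is not zero. -/
theorem IsAnti.eq_zero {hp : Params q z} {x : WMod hp n} (hx : IsAnti (q := q) z B x)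
    {i : Fin (n - 1)} (hi' : rowOf B (lo i) = rowOf B (hi i)) (h : u (lo i) = u (hi i)) :
    x u = 0 := by
  have := congrFun (hx.gY_act i hi') u
  rw [ract_gY_apply, comp_simpleRefl_of_eq h, h, bCoef_self] at this
  change _ = ((-q⁻¹ : Rˣ) : R) * x u at this
  rw [Units.val_neg] at this
  have h2 : ((q : R) + ((q⁻¹ : Rˣ) : R)) * x u = 0 := by linear_combination this
  exact (mul_eq_zero.1 h2).resolve_left hp.q_add

/-- Antisymmetric vectors are determined by their values at block-strict words. -/
theorem IsAnti.ext {hp : Params q z} {x y : WMod hp n} (hx : IsAnti (q := q) z B x)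
    (hy : IsAnti (q := q) z B y) (h : ∀ u, BlockStrict B u → x u = y u) : x = y := by
  refine eq_of_row_sorted (q := -q⁻¹) (κ := B) hx.step hy.step fun u hu => ?_
  by_cases hs : BlockStrict B u
  · exact h u hs
  · unfold BlockStrict at hs
    push Not at hs
    obtain ⟨p, p', h1, h2, h3⟩ := hs
    -- A word that is weakly but not strictly increasing along a block repeats a letter, hence
    -- repeats it in two neighbouring places of the block, where both vectors vanish.
    have h4 := le_antisymm (hu p p' h1 h2) h3
    have hlt : (p : ℕ) + 1 < n := lt_of_le_of_lt (Fin.lt_def.1 h1) p'.2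
    obtain ⟨i, rfl⟩ : ∃ i : Fin (n - 1), lo i = p := ⟨⟨p, by omega⟩, rfl⟩
    have h5 : hi i ≤ p' := Fin.lt_def.1 h1
    have h6 : rowOf B (lo i) = rowOf B (hi i) :=
      le_antisymm (rowOf_monotone B (lo_lt_hi i).le) (h2 ▸ rowOf_monotone B h5)
    have h7 : u (lo i) = u (hi i) := by
      apply le_antisymm (hu _ _ (lo_lt_hi i) h6)
      rw [h4]
      rcases h5.eq_or_lt with h5 | h5
      · rw [h5]
      · exact hu _ _ h5 (h6.symm.trans h2)
    rw [hx.eq_zero h6 h7, hy.eq_zero h6 h7]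

theorem isAnti_of_step (hp : Params q z) {x : WMod hp n}
    (hcol : ∀ u, x u ≠ 0 → ∀ p, colour (u p) = colour (rowOf B p))
    (hstep : ∀ u i, rowOf B (lo i) = rowOf B (hi i) → u (lo i) < u (hi i) →
      x (u ∘ simpleRefl i) = ((-q⁻¹ : Rˣ) : R) * x u)
    (hzero : ∀ u i, rowOf B (lo i) = rowOf B (hi i) → u (lo i) = u (hi i) → x u = 0) :
    IsAnti (q := q) z B x := by
  constructor
  · intro j
    funext u
    rw [ract_tY_apply]
    change _ = z (compOf B j) * x u
    by_cases h : x u = 0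
    · rw [h, mul_zero, mul_zero]
    · rw [hcol u h j]
      rfl
  · intro i hi'
    funext u
    rw [ract_gY_apply]
    change _ = ((-q⁻¹ : Rˣ) : R) * x u
    rcases lt_trichotomy (u (lo i)) (u (hi i)) with h | h | h
    · rw [hstep u i hi' h, bCoef_lt h, zero_mul, add_zero]
    · rw [comp_simpleRefl_of_eq h, hzero u i hi' h]
      ring
    · have e := hstep (u ∘ simpleRefl i) i hi' (by simpa using h)
      rw [comp_simpleRefl_comp] at e
      by_cases h0 : x u = 0
      · rw [h0, mul_zero, mul_zero, add_zero]
        rw [h0] at e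
        exact (mul_eq_zero.1 e.symm).resolve_left (-q⁻¹ : Rˣ).ne_zero
      · rw [bCoef_gt h, e, Units.val_neg]
        · linear_combination (-x (u ∘ simpleRefl i)) * q.mul_inv
        · rw [hcol u h0, hcol u h0, hi']

open scoped Classical in
/-- The antisymmetric vector attached to a word. -/
def antiVec (q : Rˣ) (B : RComp r n) (w u : Word r n) : R :=
  if jointCount u (rowOf B) = jointCount w (rowOf B) then ((-q⁻¹ : Rˣ) : R) ^ inv u else 0

theorem antiVec_ne_zero (h : antiVec q B w u ≠ (0 : R)) :
    jointCount u (rowOf B) = jointCount w (rowOf B) := by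
  unfold antiVec at h
  exact by_contra fun hc => h (if_neg hc)

theorem antiVec_self (w : Word r n) : IsUnit (antiVec q B w w : R) := by
  rw [antiVec, if_pos rfl]
  exact ((-q⁻¹ : Rˣ).isUnit).pow _

theorem jointCount_comp (u v : Word r n) (s : Equiv.Perm (Fin n)) :
    jointCount (u ∘ s) (v ∘ s) = jointCount u v :=
  rel_iff.1 ((rel_comp s).2 (rel_jointCount u v))

theorem contentOf_eq_of_jointCount (h : jointCount u v = jointCount w v) :
    contentOf u = contentOf w := by
  have key : ∀ u : Word r n, ∀ k i, (contentOf u).part k i = ∑ a, jointCount u v a (toLex (k, i)) := by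
    intro u k i
    rw [contentOf_part, Finset.card_eq_sum_card_fiberwise (f := v) (t := Finset.univ) (by simp)]
    refine Finset.sum_congr rfl fun a _ => ?_
    rw [Finset.filter_filter, jointCount]
    simp only [and_comm]
  apply Subtype.ext
  funext k i
  exact (key u k i).trans ((by rw [h] : _ = _).trans (key w k i).symm)

theorem isAnti_antiVec (hp : Params q z) (hw : BlockStrict B w)
    (hc : ∀ p, colour (w p) = colour (rowOf B p)) :
    IsAnti (q := q) z B (N := WMod hp n) (antiVec q B w) := by
  have hcol : ∀ u, antiVec q B w u ≠ (0 : R) → ∀ p, colour (u p) = colour (rowOf B p) := by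
    intro u hu p
    have h1 := congrFun (congrFun (antiVec_ne_zero hu) (rowOf B p)) (u p)
    have h2 : jointCount u (rowOf B) (rowOf B p) (u p) ≠ 0 := by
      rw [jointCount, Finset.card_ne_zero]
      exact ⟨p, by simp⟩
    rw [h1, jointCount, Finset.card_ne_zero] at h2
    obtain ⟨p', hp'⟩ := h2
    have hp' := (Finset.mem_filter.1 hp').2
    rw [← hp'.2, hc, hp'.1]
  have hstep : ∀ u i, rowOf B (lo i) = rowOf B (hi i) → u (lo i) < u (hi i) →
      (antiVec q B w (u ∘ simpleRefl i) : R) = ((-q⁻¹ : Rˣ) : R) * antiVec q B w u := by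
    intro u i hi' h
    have e : jointCount (u ∘ simpleRefl i) (rowOf B) = jointCount u (rowOf B) := by
      conv_lhs => rw [← comp_simpleRefl_of_eq hi']
      exact jointCount_comp _ _ _
    rw [antiVec, antiVec, e, inv_comp_simpleRefl h]
    split_ifs
    · rw [pow_succ']
    · rw [mul_zero]
  have hzero : ∀ u i, rowOf B (lo i) = rowOf B (hi i) → u (lo i) = u (hi i) →
      antiVec q B w u = (0 : R) := by
    intro u i hi' h
    by_contra hne
    have h1 := congrFun (congrFun (antiVec_ne_zero hne) (rowOf B (lo i))) (u (lo i))
    have h2 : 1 < jointCount u (rowOf B) (rowOf B (lo i)) (u (lo i)) := by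
      rw [jointCount, Finset.one_lt_card]
      exact ⟨lo i, by simp, hi i, by simp [hi', h], lo_ne_hi i⟩
    rw [h1, jointCount, Finset.one_lt_card] at h2
    obtain ⟨a, ha, b, hb, hab⟩ := h2
    have ha := (Finset.mem_filter.1 ha).2
    have hb := (Finset.mem_filter.1 hb).2
    rcases lt_or_gt_of_ne hab with hab | hab
    · exact (hw a b hab (ha.1.trans hb.1.symm)).ne (ha.2.trans hb.2.symm)
    · exact (hw b a hab (hb.1.trans ha.1.symm)).ne (hb.2.trans ha.2.symm)
  exact isAnti_of_step hp hcol hstep hzero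

theorem IsAnti.mulVec {hp : Params q z} {x : WMod hp n} (hx : IsAnti (q := q) z B x)
    {F : Matrix (Word r n) (Word r n) R} (hF : F ∈ endAlg n q z) :
    IsAnti (q := q) z B (N := WMod hp n) (F *ᵥ (x : Word r n → R)) :=
  hx.map (toEnd hp ⟨F, hF⟩)

/-! ### Triangularity -/

variable {l : RPart r n}

/-- The recursion in $v$ expresses a new entry through old entries at $u\circ s_i$ and $u$. The
first has the same cumulative multiplicities as the new pair. The second either comes with no new
pair to compare, or, at a descent of $u$, has strictly smaller ones, so it cannot contribute where
minimality is attained. There the entry is a power of $q$ carried along. -/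
theorem xi_entry (hp : Params q z) (U : SST l) (u v : Word r n) :
    ((etaT hp U)ᵀ u v ≠ 0 → cum (colWord U.tab) (rowWord l) ≤ cum u v) ∧
      (cum u v = cum (colWord U.tab) (rowWord l) → IsUnit ((etaT hp U)ᵀ u v)) := by
  have hE := transpose_mem_endAlg (etaT_mem hp U)
  set c := cum (colWord U.tab) (rowWord l) with hcdef
  have hrel : Rel (Function.swap (tabCount U.tab)) (colWord U.tab) (rowWord l) :=
    rel_swap.2 U.rel_colWord
  induction v using word_induction generalizing u with
  | base v hv =>
    have hv' := eq_rowOf_of_monotone hv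
    have e : ∀ v, (etaT hp U)ᵀ u v = eta hp U.isCount.swap u v := by
      intro v
      rw [etaT, eta_transpose]
    by_cases hc : contentOf v = l.toComp
    · rw [hc] at hv'
      rw [e, hv', eta_rowOf, etaVec]
      constructor
      · intro h
        have hR : Rel (Function.swap (tabCount U.tab)) u (rowOf l.toComp) :=
          by_contra fun hc => h (if_neg hc)
        rw [hcdef, cum_eq_of_rel hrel hR]
      · intro h
        rw [if_pos]
        · exact q.isUnit.pow _
        · rw [rel_iff, jointCount_eq_of_cum h, rel_iff.1 hrel]
    · have h0 : (etaT hp U)ᵀ u v = 0 := by rw [e, eta_of_ne hp _ hc]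
      constructor
      · intro h
        exact absurd h0 h
      · intro h
        have : Rel (Function.swap (tabCount U.tab)) u v := by
          rw [rel_iff, jointCount_eq_of_cum h, rel_iff.1 hrel]
        exact absurd (this.contentOf_right U.isCount.swap) hc
  | step v i hv ih =>
    have key := entry_rel hE i u v
    rw [bCoef_lt hv, zero_mul, add_zero] at key
    rw [← key, cum_simpleRefl]
    rcases lt_trichotomy (u (lo i)) (u (hi i)) with h | h | h
    -- At an ascent of $u$ only the exchanged word contributes.
    · rw [bCoef_lt h, zero_mul, add_zero]
      exact ih _
    · rw [comp_simpleRefl_of_eq h, h, bCoef_self]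
      have e : (etaT hp U)ᵀ u v + ((q : R) - 1) * (etaT hp U)ᵀ u v = (q : R) * (etaT hp U)ᵀ u v := by
        ring
      rw [e]
      exact ⟨fun hne => (ih u).1 (right_ne_zero_of_mul hne), fun he => q.isUnit.mul ((ih u).2 he)⟩
    · obtain ⟨s1, s2⟩ := cum_step h hv
      rw [cum_simpleRefl] at s1 s2
      constructor
      · intro hne
        by_cases h1 : (etaT hp U)ᵀ (u ∘ simpleRefl i) v = 0
        · rw [h1, zero_add] at hne
          exact ((ih u).1 (right_ne_zero_of_mul hne)).trans s1
        · exact (ih _).1 h1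
      · intro he
        have h1 : (etaT hp U)ᵀ u v = 0 := by
          by_contra hne
          have := (ih u).1 hne
          rw [← he] at this
          exact s2 (le_antisymm s1 this)
        rw [h1, mul_zero, add_zero]
        exact (ih _).2 he

theorem colWord_colour (U : SST l) (p : Fin n) :
    colour (colWord U.tab p) = colour (rowOf (conj l) p) := by
  rw [rowOf_conj_colour, colWord, Function.comp_apply, U.colour_tab]

theorem nodeRow_colour (p : Fin n) :
    colour (rowWord l p) = colour (rowOf (conj l) p) := rfl

/-- `D[V, T] = (η_V a_T)(r_l)`. -/
theorem eta_anti_entry (hp : Params q z) (V T : SST l) :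
    ((etaT hp V *ᵥ antiVec q (conj l) (colWord T.tab)) (rowWord l) ≠ 0 →
      cum (colWord V.tab) (rowWord l) ≤
        cum (colWord T.tab) (rowWord l)) ∧
    (V = T → IsUnit ((etaT hp V *ᵥ antiVec q (conj l) (colWord T.tab)) (rowWord l))) := by
  have hsum : (etaT hp V *ᵥ antiVec q (conj l) (colWord T.tab)) (rowWord l) =
      ∑ u, (etaT hp V)ᵀ u (rowWord l) * antiVec q (conj l) (colWord T.tab) u := rfl
  constructor
  · intro h
    rw [hsum] at h
    obtain ⟨u, -, hu⟩ := Finset.exists_ne_zero_of_sum_ne_zero h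
    exact ((xi_entry hp V _ _).1 (left_ne_zero_of_mul hu)).trans
      (cum_block_le T.blockStrict (nodeRow_blockStrict l)
        (antiVec_ne_zero (right_ne_zero_of_mul hu)))
  · rintro rfl
    -- A contributing word has `cum` at least that of the column reading by triangularity and at
    -- most that by maximality of block-strict words; equality singles out the column reading
    -- itself.
    rw [hsum, Finset.sum_eq_single (colWord V.tab)]
    · exact ((xi_entry hp V _ _).2 rfl).mul (antiVec_self _)
    · intro u _ hu
      by_contra hne
      have h1 := antiVec_ne_zero (right_ne_zero_of_mul hne)
      exact hu (eq_of_cum_block_eq V.blockStrict (nodeRow_blockStrict l) h1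
        (le_antisymm (cum_block_le V.blockStrict (nodeRow_blockStrict l) h1)
          ((xi_entry hp V _ _).1 (left_ne_zero_of_mul hne))))
    · simp

/-- `D'[U, S] = (ξ_U a_{r_l})(S)`. -/
theorem xi_anti_entry (hp : Params q z) (U S : SST l) :
    (((etaT hp U)ᵀ *ᵥ antiVec q (conj l) (rowWord l)) (colWord S.tab) ≠ 0 →
      cum (colWord U.tab) (rowWord l) ≤
        cum (colWord S.tab) (rowWord l)) ∧
    (U = S → IsUnit (((etaT hp U)ᵀ *ᵥ antiVec q (conj l) (rowWord l)) (colWord S.tab))) := by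
  have hsum : ((etaT hp U)ᵀ *ᵥ antiVec q (conj l) (rowWord l)) (colWord S.tab) =
      ∑ v, (etaT hp U)ᵀ (colWord S.tab) v * antiVec q (conj l) (rowWord l) v := rfl
  have hle : ∀ v, jointCount v (rowOf (conj l)) =
      jointCount (rowWord l) (rowOf (conj l)) →
      cum (colWord S.tab) v ≤ cum (colWord S.tab) (rowWord l) := by
    intro v hv x y
    rw [cum_comm, cum_comm (colWord S.tab)]
    exact cum_block_le (nodeRow_blockStrict l) S.blockStrict hv y x
  constructor
  · intro h
    rw [hsum] at h
    obtain ⟨v, -, hv⟩ := Finset.exists_ne_zero_of_sum_ne_zero h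
    exact ((xi_entry hp U _ _).1 (left_ne_zero_of_mul hv)).trans
      (hle v (antiVec_ne_zero (right_ne_zero_of_mul hv)))
  · rintro rfl
    rw [hsum, Finset.sum_eq_single (rowWord l)]
    · exact ((xi_entry hp U _ _).2 rfl).mul (antiVec_self _)
    · intro v _ hv
      by_contra hne
      have h1 := antiVec_ne_zero (right_ne_zero_of_mul hne)
      have h2 := le_antisymm (hle v h1) ((xi_entry hp U _ _).1 (left_ne_zero_of_mul hne))
      refine hv (eq_of_cum_block_eq (nodeRow_blockStrict l) U.blockStrict h1 ?_)
      funext x y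
      rw [cum_comm, cum_comm _ (colWord U.tab), h2]
    · simp

/-- Block-strict words of the right colours in the support of `η_V x` have dominated content. -/
theorem le_of_anti_ne_zero (hp : Params q z) {κ : RPart r n} (V : SST κ) {x : Word r n → R}
    (hx : IsAnti (q := q) z (conj l) (N := WMod hp n) x) (h : etaT hp V *ᵥ x ≠ 0) : κ ≤ l := by
  by_contra hc
  apply h
  have h1 := hx.mulVec (etaT_mem hp V)
  have h0 : IsAnti (q := q) z (conj l) (0 : WMod hp n) :=
    ⟨fun j => by rw [smul_zero, smul_zero], fun i _ => by rw [smul_zero, smul_zero]⟩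
  refine h1.ext h0 fun u hu => ?_
  by_contra hne
  have h2 : (etaT hp V *ᵥ x) u ≠ 0 := hne
  have h3 : contentOf u = κ.toComp := by
    by_contra hcu
    apply h2
    exact Finset.sum_eq_zero fun v _ =>
      mul_eq_zero_of_left (eta_of_ne_left hp V.isCount hcu v) _
  apply hc
  change κ.toComp ≤ l.toComp
  rw [← h3, ← contentOf_colWord_nodeRow]
  exact contentOf_anti (nodeRow_le hu (h1.colour_eq h2))

/-- An antisymmetric vector is determined at block-strict words. These dominate the row word letter
by letter, and among them only the row word itself has content $\lambda$, so one coefficient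
remains. -/
theorem IsAnti.eq_smul (hp : Params q z) {x : Word r n → R}
    (hx : IsAnti (q := q) z (conj l) (N := WMod hp n) x)
    (h : ∀ u, x u ≠ 0 → contentOf u = l.toComp) {c : R}
    (hc : c * antiVec q (conj l) (rowWord l) (rowWord l) = 1) :
    x = (x (rowWord l) * c) • antiVec q (conj l) (rowWord l) := by
  have h1 := isAnti_antiVec hp (nodeRow_blockStrict l) (fun p => nodeRow_colour (l := l) p)
  have h2 : IsAnti (q := q) z (conj l) (N := WMod hp n)
      ((x (rowWord l) * c) • antiVec q (conj l) (rowWord l)) := by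
    have := h1.mulVec (F := (x (rowWord l) * c) • 1)
      (Subalgebra.smul_mem _ (one_mem (endAlg n q z)) _)
    rwa [Matrix.smul_mulVec, Matrix.one_mulVec] at this
  have key : ∀ (y : Word r n → R), IsAnti (q := q) z (conj l) (N := WMod hp n) y → ∀ u,
      BlockStrict (conj l) u → y u ≠ 0 → contentOf u = l.toComp → u = rowWord l := by
    intro y hy u hu hyu hcu
    exact (eq_of_le_of_contentOf (nodeRow_le hu (hy.colour_eq hyu))
      ((contentOf_colWord_nodeRow l).trans hcu.symm)).symm
  refine hx.ext h2 fun u hu => ?_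
  by_cases hur : u = rowWord l
  · rw [hur, Pi.smul_apply, smul_eq_mul, mul_assoc, hc, mul_one]
  · have e1 : x u = 0 := by
      by_contra hne
      exact hur (key x hx u hu hne (h u hne))
    have e2 : antiVec q (conj l) (rowWord l) u = (0 : R) := by
      by_contra hne
      exact hur (key _ h1 u hu hne ((contentOf_eq_of_jointCount (antiVec_ne_zero hne)).trans
        (contentOf_colWord_nodeRow l)))
    rw [Pi.smul_apply, e1, e2, smul_zero]

/-- The linear form that detects the coefficient of `φ_{ST}`. -/
def pairing (q : Rˣ) (S T : SST l) : Matrix (Word r n) (Word r n) R →ₗ[R] R where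
  toFun F := (F *ᵥ antiVec q (conj l) (colWord T.tab)) (colWord S.tab)
  map_add' F G := by rw [Matrix.add_mulVec, Pi.add_apply]
  map_smul' c F := by rw [Matrix.smul_mulVec, Pi.smul_apply, RingHom.id_apply]

theorem pairing_phiMat (hp : Params q z) {κ : RPart r n} (S T : SST l) (U V : SST κ) :
    pairing q S T (phiMat hp U V) =
      ((etaT hp U)ᵀ *ᵥ (etaT hp V *ᵥ antiVec q (conj l) (colWord T.tab))) (colWord S.tab) := by
  change (phiMat hp U V *ᵥ _) _ = _
  rw [phiMat, Matrix.mulVec_mulVec]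

theorem isAnti_colWord (hp : Params q z) (T : SST l) :
    IsAnti (q := q) z (conj l) (N := WMod hp n) (antiVec q (conj l) (colWord T.tab)) :=
  isAnti_antiVec hp T.blockStrict (colWord_colour T)

theorem le_of_pairing_ne_zero (hp : Params q z) {κ : RPart r n} {S T : SST l} {U V : SST κ}
    (h : pairing q S T (phiMat hp U V) ≠ 0) : κ ≤ l := by
  rw [pairing_phiMat] at h
  refine le_of_anti_ne_zero hp V (isAnti_colWord hp T) fun h0 => h ?_
  rw [h0, Matrix.mulVec_zero, Pi.zero_apply]

/-- For a fixed shape $\eta_V$ takes the antisymmetric vector of $T$ to a multiple of the one vector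
attached to the row word, so the form factors into a contribution of $(V,T)$ and one of $(U,S)$.
Triangularity can then be proved for each factor alone. -/
theorem exists_pairing_eq (hp : Params q z) (S T U V : SST l) : ∃ c : Rˣ,
    pairing q S T (phiMat hp U V) = c *
      ((etaT hp V *ᵥ antiVec q (conj l) (colWord T.tab)) (rowWord l) *
      ((etaT hp U)ᵀ *ᵥ antiVec q (conj l) (rowWord l)) (colWord S.tab)) := by
  obtain ⟨c, hc⟩ := (antiVec_self (R := R) (q := q) (B := conj l) (rowWord l))
  refine ⟨c⁻¹, ?_⟩
  have := ((isAnti_colWord hp T).mulVec (etaT_mem hp V)).eq_smul hp (fun u hu => ?_)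
    (c := ((c⁻¹ : Rˣ) : R)) (by rw [← hc, Units.inv_mul])
  · rw [pairing_phiMat]
    conv_lhs => rw [this, Matrix.mulVec_smul, Pi.smul_apply, smul_eq_mul]
    ring
  · by_contra hcu
    apply hu
    exact Finset.sum_eq_zero fun v _ =>
      mul_eq_zero_of_left (eta_of_ne_left hp V.isCount hcu v) _

theorem pairing_self (hp : Params q z) (S T : SST l) :
    IsUnit (pairing q S T (phiMat hp S T)) := by
  obtain ⟨c, hc⟩ := exists_pairing_eq hp S T S T
  rw [hc]
  exact c.isUnit.mul (((eta_anti_entry hp T T).2 rfl).mul ((xi_anti_entry hp S S).2 rfl))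

theorem cum_le_of_pairing_ne_zero (hp : Params q z) {S T U V : SST l}
    (h : pairing q S T (phiMat hp U V) ≠ 0) :
    cum (colWord U.tab) (rowWord l) ≤ cum (colWord S.tab) (rowWord l) ∧
    cum (colWord V.tab) (rowWord l) ≤ cum (colWord T.tab) (rowWord l) := by
  obtain ⟨c, hc⟩ := exists_pairing_eq hp S T U V
  rw [hc] at h
  have h1 := right_ne_zero_of_mul h
  exact ⟨(xi_anti_entry hp U S).1 (right_ne_zero_of_mul h1),
    (eta_anti_entry hp V T).1 (left_ne_zero_of_mul h1)⟩

theorem SST.ext_tab {S T : SST l} (h : S.tab = T.tab) : S = T := by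
  have h1 : S.type = T.type := by
    apply Subtype.ext
    funext k i
    change S.type.part k i = T.type.part k i
    rw [← S.card_type, ← T.card_type, h]
  obtain ⟨μ, S, hS⟩ := S
  obtain ⟨ν, T, hT⟩ := T
  change μ = ν at h1
  change S = T at h
  subst h1 h
  rfl

/-- The cumulative multiplicities recover the numbers of entries of each kind in each row, and
weakly increasing rows are determined by these. -/
theorem SST.eq_of_cum {S T : SST l}
    (h : cum (colWord S.tab) (rowWord l) = cum (colWord T.tab) (rowWord l)) :
    S = T := by
  apply SST.ext_tab
  refine eq_of_tabCount S.row_mono T.row_mono ?_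
  have h1 := rel_iff.1 (rel_swap.2 S.rel_colWord)
  have h2 := rel_iff.1 (rel_swap.2 T.rel_colWord)
  have h3 := jointCount_eq_of_cum h
  rw [h1, h2] at h3
  funext a b
  exact congrFun (congrFun h3 b) a

end Anti

/-! ### The Gram matrix -/

section Gram

variable {R : Type*} [CommRing R] {r n : ℕ} {q : Rˣ} {z : Fin r → R} [Invertible (r : R)]
  [IsDomain R]

instance : Finite (RPart r n) := inferInstanceAs (Finite (Subtype _))

instance : Fintype (RPart r n) := Fintype.ofFinite _

/-- The index set of the basis. -/
abbrev PairIdx (r n : ℕ) : Type := Σ l : RPart r n, SST l × SST l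

/-- The values of the linear forms on the `φ_{UV}`. -/
def gram (hp : Params q z) : Matrix (PairIdx r n) (PairIdx r n) R :=
  fun i j => pairing q j.2.1 j.2.2 (phiMat hp i.2.1 i.2.2)

open scoped Classical in
/-- The position of a shape in the dominance order. -/
def domRank (l : RPart r n) : ℕ := (Finset.univ.filter (· < l)).card

theorem domRank_lt {κ l : RPart r n} (h : κ < l) : domRank κ < domRank l := by
  classical
  refine Finset.card_lt_card ⟨fun a ha => ?_, fun hs => ?_⟩
  · rw [Finset.mem_filter] at ha ⊢
    exact ⟨Finset.mem_univ _, ha.2.trans h⟩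
  · have := hs (Finset.mem_filter.2 ⟨Finset.mem_univ κ, h⟩)
    simp at this

/-- The total cumulative multiplicity of a semistandard tableau. -/
def cumRank {l : RPart r n} (S : SST l) : ℕ :=
  ∑ x, ∑ y, cum (colWord S.tab) (rowWord l) x y

theorem cumRank_le {l : RPart r n} {S T : SST l}
    (h : cum (colWord S.tab) (rowWord l) ≤ cum (colWord T.tab) (rowWord l)) :
    cumRank S ≤ cumRank T :=
  Finset.sum_le_sum fun x _ => Finset.sum_le_sum fun y _ => h x y

theorem eq_of_cumRank {l : RPart r n} {S T : SST l}
    (h : cum (colWord S.tab) (rowWord l) ≤ cum (colWord T.tab) (rowWord l))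
    (he : cumRank S = cumRank T) : S = T := by
  apply SST.eq_of_cum
  funext x y
  have h1 := (Finset.sum_eq_sum_iff_of_le fun x _ =>
    Finset.sum_le_sum fun y _ => h x y).1 he x (Finset.mem_univ x)
  exact (Finset.sum_eq_sum_iff_of_le fun y _ => h x y).1 h1 y (Finset.mem_univ y)

/-- The rank for which the Gram matrix is triangular. -/
def pairRank (i : PairIdx r n) : ℕ ×ₗ ℕ :=
  toLex (domRank i.1, cumRank i.2.1 + cumRank i.2.2)

/-- A nonzero value forces the shapes to be comparable in dominance and, for equal shapes, both
tableaux to be comparable in `cum`; counting turns these partial orders into one numerical rank. -/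
theorem pairRank_of_gram (hp : Params q z) {i j : PairIdx r n} (h : gram hp i j ≠ 0) :
    i = j ∨ pairRank i < pairRank j := by
  obtain ⟨κ, U, V⟩ := i
  obtain ⟨l, S, T⟩ := j
  rcases (le_of_pairing_ne_zero hp h).eq_or_lt with hl | hl
  · change κ = l at hl
    subst hl
    obtain ⟨h1, h2⟩ := cum_le_of_pairing_ne_zero hp h
    have c1 : cumRank U ≤ cumRank S := cumRank_le h1
    have c2 : cumRank V ≤ cumRank T := cumRank_le h2
    rcases (Nat.add_le_add c1 c2).eq_or_lt with he | he
    · left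
      have e1 : U = S := eq_of_cumRank h1 (by omega)
      have e2 : V = T := eq_of_cumRank h2 (by omega)
      rw [e1, e2]
    · exact Or.inr (Prod.Lex.toLex_lt_toLex.2 (Or.inr ⟨rfl, he⟩))
  · exact Or.inr (Prod.Lex.toLex_lt_toLex.2 (Or.inl (domRank_lt hl)))

-- The blocks for the rank are diagonal, since two different indices of equal rank pair to zero, and
-- their diagonal entries are units.
open scoped Classical in
theorem isUnit_gram (hp : Params q z) : IsUnit (gram (n := n) hp) := by
  rw [Matrix.isUnit_iff_isUnit_det]
  have ht : (gram (n := n) hp).BlockTriangular pairRank := by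
    intro i j hij
    by_contra h
    rcases pairRank_of_gram hp h with rfl | h'
    · exact lt_irrefl _ hij
    · exact lt_asymm hij h'
  rw [ht.det]
  refine IsUnit.prod_iff.2 fun a _ => ?_
  have e : (gram (n := n) hp).toSquareBlock pairRank a =
      Matrix.diagonal fun i => gram hp i.1 i.1 := by
    ext i j
    rw [Matrix.toSquareBlock_def, Matrix.of_apply, Matrix.diagonal_apply]
    split_ifs with hij
    · rw [hij]
    · by_contra h
      rcases pairRank_of_gram hp h with h' | h'
      · exact hij (Subtype.ext h')
      · rw [i.2, j.2] at h'
        exact lt_irrefl _ h'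
  rw [e, Matrix.det_diagonal]
  exact IsUnit.prod_iff.2 fun i _ => pairing_self hp i.1.2.1 i.1.2.2

end Gram

end

end YokonumaSchur

namespace YokonumaSchur

noncomputable section

open scoped RightActions Matrix

/-! ### The Robinson–Schensted–Knuth correspondence by growth diagrams -/

section Growth

/-- The local rule: the partition at the upper right corner of a cell. -/
def growRule (m : ℕ) (ρ κ μ : ℕ → ℕ) : ℕ → ℕ
  | 0 => m + max (κ 0) (μ 0)
  | i + 1 => max (κ (i + 1)) (μ (i + 1)) + (min (κ i) (μ i) - ρ i)

/-- The growth diagram of a matrix. -/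
def growth (M : ℕ → ℕ → ℕ) : ℕ → ℕ → ℕ → ℕ
  | 0, _ => 0
  | _ + 1, 0 => 0
  | x + 1, y + 1 => growRule (M x y) (growth M x y) (growth M (x + 1) y) (growth M x (y + 1))

variable (M : ℕ → ℕ → ℕ)

theorem growth_zero_left (y : ℕ) : growth M 0 y = 0 := by rw [growth]

theorem growth_zero_right (x : ℕ) : growth M x 0 = 0 := by cases x <;> rw [growth]

theorem growth_succ (x y : ℕ) : growth M (x + 1) (y + 1) =
    growRule (M x y) (growth M x y) (growth M (x + 1) y) (growth M x (y + 1)) := by rw [growth]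

/-- The skew shape is a horizontal strip. -/
def HStrip (ρ κ : ℕ → ℕ) : Prop := ∀ i, ρ i ≤ κ i ∧ κ (i + 1) ≤ ρ i

theorem HStrip.refl_zero : HStrip 0 0 := fun _ => ⟨le_rfl, le_rfl⟩

theorem HStrip.growRule_left {m : ℕ} {ρ κ μ : ℕ → ℕ} (h1 : HStrip ρ κ) (h2 : HStrip ρ μ) :
    HStrip κ (growRule m ρ κ μ) := by
  intro i
  have a := h1 i
  have b := h2 i
  refine ⟨?_, ?_⟩
  · cases i with
    | zero => simp only [growRule]; omega
    | succ i => simp only [growRule]; omega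
  · simp only [growRule]
    omega

theorem HStrip.growRule_right {m : ℕ} {ρ κ μ : ℕ → ℕ} (h1 : HStrip ρ κ) (h2 : HStrip ρ μ) :
    HStrip μ (growRule m ρ κ μ) := by
  intro i
  have a := h1 i
  have b := h2 i
  refine ⟨?_, ?_⟩
  · cases i with
    | zero => simp only [growRule]; omega
    | succ i => simp only [growRule]; omega
  · simp only [growRule]
    omega

/-- Horizontal strips along the two lower edges of a cell give horizontal strips along its two upper
edges, so the property spreads from the zero boundary over the whole diagram. -/
theorem growth_hStrip (x y : ℕ) : HStrip (growth M x y) (growth M (x + 1) y) ∧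
    HStrip (growth M x y) (growth M x (y + 1)) := by
  induction x generalizing y with
  | zero =>
    rw [growth_zero_left, growth_zero_left]
    refine ⟨?_, HStrip.refl_zero⟩
    induction y with
    | zero => rw [growth_zero_right]; exact HStrip.refl_zero
    | succ y ih =>
      rw [growth_succ, growth_zero_left, growth_zero_left]
      exact HStrip.growRule_right ih HStrip.refl_zero
  | succ x ihx =>
    induction y with
    | zero =>
      rw [growth_zero_right, growth_zero_right]
      refine ⟨HStrip.refl_zero, ?_⟩
      rw [growth_succ, growth_zero_right, growth_zero_right]
      have := (ihx 0).2
      rw [growth_zero_right] at this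
      exact HStrip.growRule_left HStrip.refl_zero this
    | succ y ihy =>
      have h1 : HStrip (growth M (x + 1) (y + 1)) (growth M (x + 1 + 1) (y + 1)) := by
        rw [growth_succ M (x + 1) y]
        exact HStrip.growRule_right ihy.1 ihy.2
      have h2 : HStrip (growth M (x + 1) (y + 1)) (growth M (x + 1) (y + 1 + 1)) := by
        rw [growth_succ M x (y + 1)]
        exact HStrip.growRule_left (ihx (y + 1)).1 (ihx (y + 1)).2
      exact ⟨h1, h2⟩

theorem growth_eq_zero {x i : ℕ} (y : ℕ) (h : x ≤ i) : growth M x y i = 0 := by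
  induction x generalizing i with
  | zero => rw [growth_zero_left]; rfl
  | succ x ih =>
    obtain ⟨i, rfl⟩ : ∃ j, i = j + 1 := ⟨i - 1, by omega⟩
    have := ((growth_hStrip M x y).1 i).2
    rw [ih (by omega)] at this
    exact Nat.le_zero.1 this

theorem growth_antitone (x y : ℕ) : Antitone (growth M x y) :=
  antitone_nat_of_succ_le fun i =>
    (((growth_hStrip M x y).2 (i + 1)).1).trans ((growth_hStrip M x y).2 i).2

/-- Part $i+1$ of the new partition and part $i$ of $\rho$ together give
$\max(\kappa_{i+1},\mu_{i+1})+\min(\kappa_i,\mu_i)$; regrouping by index pairs each maximum with its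
minimum, and the last minimum is left over. -/
theorem growRule_sum {m : ℕ} {ρ κ μ : ℕ → ℕ} (h1 : HStrip ρ κ) (h2 : HStrip ρ μ) (d : ℕ) :
    ∑ i ∈ Finset.range (d + 1), growRule m ρ κ μ i + ∑ i ∈ Finset.range d, ρ i +
      min (κ d) (μ d) = m + ∑ i ∈ Finset.range (d + 1), (κ i + μ i) := by
  induction d with
  | zero => simp [growRule]; omega
  | succ d ih =>
    have a := h1 d
    have b := h2 d
    have e1 : growRule m ρ κ μ (d + 1) =
      max (κ (d + 1)) (μ (d + 1)) + (min (κ d) (μ d) - ρ d) := rfl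
    have e2 := Finset.sum_range_succ (growRule m ρ κ μ) (d + 1)
    have e3 := Finset.sum_range_succ ρ d
    have e4 := Finset.sum_range_succ (fun i => κ i + μ i) (d + 1)
    omega

theorem growth_sum {d x y : ℕ} (hx : x ≤ d) (hy : y ≤ d) :
    ∑ i ∈ Finset.range d, growth M x y i =
      ∑ a ∈ Finset.range x, ∑ b ∈ Finset.range y, M a b := by
  induction x generalizing y with
  | zero => simp [growth_zero_left]
  | succ x ihx =>
    induction y with
    | zero => simp [growth_zero_right]
    | succ y ihy =>
      obtain ⟨e, rfl⟩ : ∃ e, d = e + 1 := ⟨d - 1, by omega⟩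
      -- The sum is cut off after the last row that can be nonzero, so the leftover minimum and the
      -- last terms vanish.
      have h := growRule_sum (m := M x y) (growth_hStrip M x y).1 (growth_hStrip M x y).2 (e + 1)
      rw [← growth_succ, Finset.sum_range_succ _ (e + 1), Finset.sum_range_succ _ (e + 1),
        growth_eq_zero M _ hx, growth_eq_zero M _ hx,
        growth_eq_zero M _ (show x ≤ e + 1 by omega), Finset.sum_add_distrib,
        ihx (by omega) (by omega), ihx (by omega) (by omega), ihy (by omega)] at h
      rw [Finset.sum_range_succ, Finset.sum_range_succ] at h ⊢
      rw [Finset.sum_range_succ _ y]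
      have e1 : ∑ a ∈ Finset.range x, ∑ b ∈ Finset.range (y + 1), M a b =
        ∑ a ∈ Finset.range x, ∑ b ∈ Finset.range y, M a b + ∑ a ∈ Finset.range x, M a y := by
        rw [← Finset.sum_add_distrib]
        exact Finset.sum_congr rfl fun a _ => Finset.sum_range_succ _ _
      rw [e1] at h ⊢
      simp only [min_self] at h
      omega

/-- The local rule can be reversed. -/
theorem growRule_injective {m m' : ℕ} {ρ ρ' κ μ : ℕ → ℕ} (h1 : HStrip ρ κ) (h2 : HStrip ρ μ)
    (h1' : HStrip ρ' κ) (h2' : HStrip ρ' μ) (h : growRule m ρ κ μ = growRule m' ρ' κ μ) :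
    m = m' ∧ ρ = ρ' := by
  constructor
  · have := congrFun h 0
    simp only [growRule] at this
    omega
  · funext i
    -- The truncated subtraction in the rule is a true one because $\rho$ lies below both $\kappa$
    -- and $\mu$, so $\rho_i$ can be solved for.
    have := congrFun h (i + 1)
    simp only [growRule] at this
    have a := h1 i
    have b := h2 i
    have c := h1' i
    have d := h2' i
    omega

/-- The local rule is inverted cell by cell from the upper right corner, starting with the two outer
edges; each inversion returns the matrix entry of its cell. -/
theorem growth_injective {M M' : ℕ → ℕ → ℕ} {d : ℕ}
    (h1 : ∀ x ≤ d, growth M x d = growth M' x d) (h2 : ∀ y ≤ d, growth M d y = growth M' d y) :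
    ∀ x < d, ∀ y < d, M x y = M' x y := by
  have key : ∀ x ≤ d, ∀ y ≤ d, growth M x y = growth M' x y := by
    intro x hx
    induction hx using Nat.decreasingInduction with
    | self => exact h2
    | of_succ x hx ihx =>
      intro y hy
      induction hy using Nat.decreasingInduction with
      | self => exact h1 x (by omega)
      | of_succ y hy ihy =>
        have h := ihx (y + 1) hy
        rw [growth_succ, growth_succ] at h
        have e1 := ihx y (by omega)
        have a := growth_hStrip M x y
        have b := growth_hStrip M' x y
        rw [e1, ihy] at h a
        exact (growRule_injective a.1 a.2 b.1 b.2 h).2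
  intro x hx y hy
  have h := key (x + 1) hx (y + 1) hy
  rw [growth_succ, growth_succ] at h
  have a := growth_hStrip M x y
  have b := growth_hStrip M' x y
  rw [key (x + 1) hx y hy.le, key x hx.le (y + 1) hy] at h a
  exact (growRule_injective a.1 a.2 b.1 b.2 h).1

end Growth

/-! ### Semistandard tableaux from chains of partitions -/

section Chains

variable {r n : ℕ}

/-- A chain of multipartitions from `0` to `l` whose steps are horizontal strips. -/
structure IsChain (l : RPart r n) (γ : Fin r → ℕ → ℕ → ℕ) : Prop where
  zero : ∀ k i, γ k 0 i = 0
  strip : ∀ k c, HStrip (γ k c) (γ k (c + 1))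
  top : ∀ k (i : Fin n), γ k n i = l.toComp.part k i

variable {l : RPart r n} {γ : Fin r → ℕ → ℕ → ℕ}

theorem IsChain.mono (h : IsChain l γ) (k : Fin r) (i : ℕ) : Monotone fun c => γ k c i :=
  monotone_nat_of_le_succ fun c => (h.strip k c i).1

theorem IsChain.anti (h : IsChain l γ) (k : Fin r) (c : ℕ) : Antitone (γ k c) :=
  antitone_nat_of_succ_le fun i => ((h.strip k c (i + 1)).1).trans (h.strip k c i).2

theorem IsChain.exists_lt (h : IsChain l γ) (x : Node l.toComp) :
    ∃ c : Fin n, (x.2.2 : ℕ) < γ x.1 (c + 1) x.2.1 := by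
  have hn : 0 < n := x.2.1.pos
  refine ⟨⟨n - 1, by omega⟩, ?_⟩
  have e : n - 1 + 1 = n := by omega
  rw [Fin.val_mk, e, h.top]
  exact x.2.2.2

/-- The step at which a node is added. -/
def IsChain.entry (h : IsChain l γ) (x : Node l.toComp) : Fin n := Fin.find _ (h.exists_lt x)

theorem IsChain.entry_lt_iff (h : IsChain l γ) (x : Node l.toComp) (c : ℕ) :
    (h.entry x : ℕ) < c ↔ (x.2.2 : ℕ) < γ x.1 c x.2.1 := by
  constructor
  · intro hc
    exact lt_of_lt_of_le (Fin.find_spec (h.exists_lt x)) (h.mono x.1 x.2.1 hc)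
  · intro hc
    cases c with
    | zero =>
      rw [h.zero] at hc
      exact absurd hc (Nat.not_lt_zero _)
    | succ c =>
      by_cases hcn : c < n
      · exact Nat.lt_succ_of_le (Fin.le_def.1 (Fin.find_le_of_pos (h.exists_lt x)
          (j := ⟨c, hcn⟩) hc))
      · have := (h.entry x).2
        omega

/-- The tableau attached to a chain. -/
def IsChain.tab (h : IsChain l γ) (x : Node l.toComp) : Letter r n := toLex (x.1, h.entry x)

open scoped Classical in
/-- The type of a tableau. -/
def tabType (S : Node l.toComp → Letter r n) : RComp r n :=
  ⟨fun k i => (Finset.univ.filter fun x => S x = toLex (k, i)).card, by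
    have h := Finset.card_eq_sum_card_fiberwise (s := (Finset.univ : Finset (Node l.toComp)))
      (t := (Finset.univ : Finset (Fin r × Fin n))) (f := fun p => ofLex (S p)) (by simp)
    rw [Finset.card_univ, Fintype.card_congr (tInit l.toComp), Fintype.card_fin,
      ← Finset.univ_product_univ, Finset.sum_product] at h
    exact h.symm⟩

theorem hasType_tabType (S : Node l.toComp → Letter r n) : HasType S (tabType S) := by
  intro k i
  rw [Nat.card_eq_fintype_card, Fintype.card_subtype]
  rfl

theorem IsChain.mem_T0plus (h : IsChain l γ) : h.tab ∈ T0plus l (tabType h.tab) := by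
  refine ⟨⟨hasType_tabType _, fun k i j j' hj => ?_, fun k i i' j hj hj' hi => ?_,
    fun x => le_rfl⟩, ?_⟩
  · refine Prod.Lex.toLex_le_toLex.2 (Or.inr ⟨rfl, ?_⟩)
    by_contra hc
    have hc := Fin.lt_def.1 (not_le.1 hc)
    rw [h.entry_lt_iff] at hc
    exact absurd ((h.entry_lt_iff ⟨k, i, j⟩ (h.entry ⟨k, i, j⟩)).2
      (lt_of_le_of_lt (Fin.le_def.1 hj) hc)) (lt_irrefl _)
  · refine Prod.Lex.toLex_lt_toLex.2 (Or.inr ⟨rfl, ?_⟩)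
    rw [Fin.lt_def, h.entry_lt_iff]
    have h1 := (h.entry_lt_iff ⟨k, i', ⟨j, hj'⟩⟩ (h.entry ⟨k, i', ⟨j, hj'⟩⟩ + 1)).1
      (Nat.lt_succ_self _)
    -- When the node in row $i'$ is added, the strip condition says that row $i'-1$ already reached
    -- its column one step earlier; row $i\le i'-1$ is at least as long.
    have h2 := (h.strip k (h.entry ⟨k, i', ⟨j, hj'⟩⟩) (i' - 1)).2
    have e : (i' : ℕ) - 1 + 1 = i' := by
      have := Fin.lt_def.1 hi
      omega
    rw [e] at h2
    have h3 := h.anti k (h.entry ⟨k, i', ⟨j, hj'⟩⟩)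
      (show (i : ℕ) ≤ i' - 1 by have := Fin.lt_def.1 hi; omega)
    exact (h1.trans_le h2).trans_le h3
  · funext k
    rw [← card_comp, RComp.size]
    rw [Finset.card_eq_sum_card_fiberwise (f := fun x => h.entry x) (t := Finset.univ) (by simp)]
    refine Finset.sum_congr rfl fun i _ => ?_
    rw [Finset.filter_filter]
    change _ = (Finset.univ.filter fun x => h.tab x = toLex (k, i)).card
    congr 1
    ext x
    simp only [Finset.mem_filter, Finset.mem_univ, true_and, letter_eq_iff]
    exact Iff.rfl

/-- The semistandard tableau attached to a chain. -/
def IsChain.toSST (h : IsChain l γ) : SST l := ⟨tabType h.tab, h.tab, h.mem_T0plus⟩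

/-- The chain attached to a semistandard tableau. -/
def sstChain (S : SST l) (k : Fin r) (c : ℕ) (i : Fin n) : ℕ :=
  (Finset.univ.filter fun j : Fin (l.toComp.part k i) =>
    ((ofLex (S.tab ⟨k, i, j⟩)).2 : ℕ) < c).card

theorem IsChain.sstChain_toSST (h : IsChain l γ) (k : Fin r) {c : ℕ} (hc : c ≤ n) (i : Fin n) :
    sstChain h.toSST k c i = γ k c i := by
  have e : (Finset.univ.filter fun j : Fin (l.toComp.part k i) =>
      ((ofLex (h.toSST.tab ⟨k, i, j⟩)).2 : ℕ) < c) =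
      Finset.univ.filter fun j : Fin (l.toComp.part k i) => (j : ℕ) < γ k c i :=
    Finset.filter_congr fun j _ => h.entry_lt_iff ⟨k, i, j⟩ c
  rw [sstChain, e, Fin.card_filter_val_lt, min_eq_right]
  rw [← h.top]
  exact h.mono k i hc

end Chains

/-! ### Counting -/

section Count

variable {r n : ℕ}

/-- Words that increase weakly along the rows of `ν` and have the colours of `ν`. -/
def SortedPair (r n : ℕ) : Type := {x : RComp r n × Word r n //
  (∀ p p', p < p' → rowOf x.1 p = rowOf x.1 p' → x.2 p ≤ x.2 p') ∧
    ∀ p, colour (x.2 p) = colour (rowOf x.1 p)}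

instance : Finite (SortedPair r n) := inferInstanceAs (Finite (Subtype _))

instance : Fintype (SortedPair r n) := Fintype.ofFinite _

/-- The matrix of multiplicities in one colour. -/
def colourMat (x : SortedPair r n) (k : Fin r) (a b : ℕ) : ℕ :=
  if h : a < n ∧ b < n then
    jointCount x.1.2 (rowOf x.1.1) (toLex (k, ⟨a, h.1⟩)) (toLex (k, ⟨b, h.2⟩)) else 0

theorem colourMat_apply (x : SortedPair r n) (k : Fin r) (a b : Fin n) :
    colourMat x k a b = jointCount x.1.2 (rowOf x.1.1) (toLex (k, a)) (toLex (k, b)) := by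
  rw [colourMat, dif_pos ⟨a.2, b.2⟩]

theorem jointCount_of_colour_ne (x : SortedPair r n) {a b : Letter r n}
    (h : colour a ≠ colour b) : jointCount x.1.2 (rowOf x.1.1) a b = 0 := by
  rw [jointCount, Finset.card_eq_zero, Finset.filter_eq_empty_iff]
  rintro p - ⟨rfl, rfl⟩
  exact h (x.2.2 p).symm

/-- Joint multiplicities between different colours vanish, so the matrices give all of them. Row
sums recover $\nu$, and the sequence of pairs (row of $\nu$, letter of $u$) is monotone, hence
determined by its multiplicities. -/
theorem SortedPair.ext_colourMat {x y : SortedPair r n}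
    (h : ∀ k, ∀ a < n, ∀ b < n, colourMat x k a b = colourMat y k a b) : x = y := by
  have hJ : jointCount x.1.2 (rowOf x.1.1) = jointCount y.1.2 (rowOf y.1.1) := by
    funext a b
    by_cases hc : colour a = colour b
    · have := h (colour a) (ofLex a).2 (Fin.is_lt _) (ofLex b).2 (Fin.is_lt _)
      rw [colourMat_apply, colourMat_apply] at this
      have ea : toLex (colour a, (ofLex a).2) = a := rfl
      have eb : toLex (colour a, (ofLex b).2) = b := by rw [hc]; rfl
      rwa [ea, eb] at this
    · rw [jointCount_of_colour_ne x hc, jointCount_of_colour_ne y hc]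
  obtain ⟨⟨ν, u⟩, hs, hc⟩ := x
  obtain ⟨⟨ν', u'⟩, hs', hc'⟩ := y
  simp only at hs hs' hJ
  have hν : ν = ν' := by
    rw [← contentOf_rowOf ν, ← contentOf_rowOf ν']
    apply Subtype.ext
    funext k i
    have key : ∀ (ν : RComp r n) (u : Word r n), (contentOf (rowOf ν)).part k i =
        ∑ b, jointCount u (rowOf ν) (toLex (k, i)) b := by
      intro ν u
      rw [contentOf_part, Finset.card_eq_sum_card_fiberwise (f := u) (t := Finset.univ) (by simp)]
      refine Finset.sum_congr rfl fun b _ => ?_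
      rw [Finset.filter_filter, jointCount]
    exact (key ν u).trans ((by rw [hJ] : _ = _).trans (key ν' u').symm)
  subst hν
  have hu : u = u' := by
    have hmono : ∀ u : Word r n, (∀ p p', p < p' → rowOf ν p = rowOf ν p' → u p ≤ u p') →
        Monotone fun p => (toLex (rowOf ν p, u p) : Letter r n ×ₗ Letter r n) := by
      intro u hu p p' hp
      rcases hp.eq_or_lt with rfl | hp
      · exact le_rfl
      · rcases (rowOf_monotone ν hp.le).eq_or_lt with h | h
        · exact Prod.Lex.toLex_le_toLex.2 (Or.inr ⟨h, hu p p' hp h⟩)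
        · exact Prod.Lex.toLex_le_toLex.2 (Or.inl h)
    have e := eq_of_monotone_of_card (hmono u hs) (hmono u' hs') fun a => by
      have key : ∀ u : Word r n, (Finset.univ.filter fun p =>
          (toLex (rowOf ν p, u p) : Letter r n ×ₗ Letter r n) = a).card =
          jointCount u (rowOf ν) (ofLex a).1 (ofLex a).2 := by
        intro u
        rw [jointCount]
        congr 1
        ext p
        simp only [Finset.mem_filter, Finset.mem_univ, true_and]
        constructor
        · rintro rfl
          exact ⟨rfl, rfl⟩
        · rintro ⟨h1, h2⟩
          exact ofLex.injective (Prod.ext h1 h2)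
      rw [key, key, hJ]
    funext p
    exact congrArg (fun x => (ofLex x).2) (congrFun e p)
  subst hu
  rfl

theorem sum_range_colourMat (x : SortedPair r n) (k : Fin r) :
    ∑ a ∈ Finset.range n, ∑ b ∈ Finset.range n, colourMat x k a b =
      (Finset.univ.filter fun p => colour (rowOf x.1.1 p) = k).card := by
  rw [Finset.sum_range]
  simp only [Finset.sum_range, colourMat_apply]
  rw [Finset.card_eq_sum_card_fiberwise (f := fun p => (ofLex (rowOf x.1.1 p)).2)
    (t := Finset.univ) (by simp)]
  refine Finset.sum_congr rfl fun a _ => ?_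
  rw [Finset.card_eq_sum_card_fiberwise (f := fun p => (ofLex (x.1.2 p)).2)
    (t := Finset.univ) (by simp)]
  refine Finset.sum_congr rfl fun b _ => ?_
  rw [Finset.filter_filter, Finset.filter_filter, jointCount]
  congr 1
  ext p
  simp only [Finset.mem_filter, Finset.mem_univ, true_and, letter_eq_iff, x.2.2 p]
  tauto

/-- The shape of a sorted pair. -/
def rskShape (x : SortedPair r n) : RPart r n :=
  ⟨⟨fun k i => growth (colourMat x k) n n i, by
    have e : ∀ k, ∑ i : Fin n, growth (colourMat x k) n n i =
        (Finset.univ.filter fun p => colour (rowOf x.1.1 p) = k).card := by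
      intro k
      rw [← sum_range_colourMat, ← growth_sum (colourMat x k) le_rfl le_rfl, Finset.sum_range]
    simp only [e]
    rw [← Finset.card_eq_sum_card_fiberwise (by simp), Finset.card_univ, Fintype.card_fin]⟩,
    fun k i j hij => growth_antitone (colourMat x k) n n (Fin.le_def.1 hij)⟩

theorem rsk_isChain_left (x : SortedPair r n) :
    IsChain (rskShape x) fun k c => growth (colourMat x k) c n where
  zero k i := by rw [growth_zero_left]; rfl
  strip k c := (growth_hStrip (colourMat x k) c n).1
  top _ _ := rfl

theorem rsk_isChain_right (x : SortedPair r n) :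
    IsChain (rskShape x) fun k c => growth (colourMat x k) n c where
  zero k i := by rw [growth_zero_right]; rfl
  strip k c := (growth_hStrip (colourMat x k) n c).2
  top _ _ := rfl

/-- The Robinson–Schensted–Knuth correspondence. -/
def rsk (x : SortedPair r n) : PairIdx r n :=
  ⟨rskShape x, (rsk_isChain_left x).toSST, (rsk_isChain_right x).toSST⟩

/-- The two tableaux encode the chains of shapes along the two outer edges of the growth diagram in
each colour, and these edges determine the matrices. Only injectivity is needed, since it bounds the
rank from the required side. -/
theorem rsk_injective : Function.Injective (rsk (r := r) (n := n)) := by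
  intro x y h
  have h1 : ∀ k c i, sstChain (rsk x).2.1 k c i = sstChain (rsk y).2.1 k c i := by rw [h]; simp
  have h2 : ∀ k c i, sstChain (rsk x).2.2 k c i = sstChain (rsk y).2.2 k c i := by rw [h]; simp
  refine SortedPair.ext_colourMat fun k => growth_injective (fun c hc => ?_) fun c hc => ?_
  · funext i
    by_cases hi : i < n
    · have e1 := (rsk_isChain_left x).sstChain_toSST k hc ⟨i, hi⟩
      have e2 := (rsk_isChain_left y).sstChain_toSST k hc ⟨i, hi⟩
      exact e1.symm.trans ((h1 k c ⟨i, hi⟩).trans e2)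
    · rw [growth_eq_zero _ _ (by omega), growth_eq_zero _ _ (by omega)]
  · funext i
    by_cases hi : i < n
    · have e1 := (rsk_isChain_right x).sstChain_toSST k hc ⟨i, hi⟩
      have e2 := (rsk_isChain_right y).sstChain_toSST k hc ⟨i, hi⟩
      exact e1.symm.trans ((h2 k c ⟨i, hi⟩).trans e2)
    · rw [growth_eq_zero _ _ (by omega), growth_eq_zero _ _ (by omega)]

end Count

end

end YokonumaSchur

namespace YokonumaSchur

noncomputable section

open scoped RightActions Matrix

section BasisThm

variable {R : Type*} [CommRing R] {r n : ℕ} {q : Rˣ} {z : Fin r → R} [Invertible (r : R)]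
  [IsDomain R]

/-! ### The basis -/

/-- The entries that determine an element of `endAlg`. -/
def sortedEntries (n : ℕ) (q : Rˣ) (z : Fin r → R) : endAlg n q z →ₗ[R] SortedPair r n → R where
  toFun F x := F.1 x.1.2 (rowOf x.1.1)
  map_add' _ _ := rfl
  map_smul' _ _ := rfl

/-- A commuting matrix is determined by its columns at the generators $v_\nu$; such a column is
determined by words sorted along the rows of $\nu$ and vanishes unless the colours match. -/
theorem sortedEntries_injective (hp : Params q z) :
    Function.Injective (sortedEntries n q z) := by
  intro F G h
  refine Subtype.ext (endAlg_ext hp F.2 G.2 fun ν u => ?_)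
  refine congrFun (eq_of_row_sorted (q := q) (κ := ν)
    (x := fun u => F.1 u (rowOf ν)) (y := fun u => G.1 u (rowOf ν))
    (row_step_of_isVec hp (isVec_col hp F.2 ν)) (row_step_of_isVec hp (isVec_col hp G.2 ν))
    fun u hu => ?_) u
  by_cases hc : ∀ p, colour (u p) = colour (rowOf ν p)
  · exact congrFun h ⟨(ν, u), hu, hc⟩
  · have h0 : ∀ H : endAlg n q z, H.1 u (rowOf ν) = 0 := fun H => by
      by_contra hne
      exact hc (entry_colour hp H.2 hne)
    exact (h0 F).trans (h0 G).symm

/-- `φ_{ST}` as an element of `endAlg`. -/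
def phiEnd (hp : Params q z) (i : PairIdx r n) : endAlg n q z :=
  ⟨phiMat hp i.2.1 i.2.2, phiMat_mem hp i.2.1 i.2.2⟩

/-- The linear forms `pairing` together. -/
def pairings (n : ℕ) (q : Rˣ) (z : Fin r → R) : endAlg n q z →ₗ[R] PairIdx r n → R :=
  LinearMap.pi fun j => pairing q j.2.1 j.2.2 ∘ₗ (endAlg n q z).val.toLinearMap

open scoped Classical in
theorem pairings_sum (hp : Params q z) (g : PairIdx r n → R) :
    pairings n q z (∑ i, g i • phiEnd hp i) = g ᵥ* gram hp := by
  rw [map_sum]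
  funext j
  rw [Finset.sum_apply]
  refine Finset.sum_congr rfl fun i _ => ?_
  rw [map_smul]
  rfl

open scoped Classical in
theorem eq_zero_of_pairings (hp : Params q z) {g : PairIdx r n → R}
    (h : pairings n q z (∑ i, g i • phiEnd hp i) = 0) : g = 0 := by
  rw [pairings_sum] at h
  exact Matrix.vecMul_injective_of_isUnit (isUnit_gram hp) (h.trans (Matrix.zero_vecMul _).symm)

theorem linearIndependent_phiEnd (hp : Params q z) :
    LinearIndependent R (phiEnd (n := n) hp) := by
  classical
  rw [Fintype.linearIndependent_iff]
  intro g hg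
  exact congrFun (eq_zero_of_pairings hp (by rw [hg, map_zero]))

/-- A nonzero element in the kernel of the forms could be added to the $\varphi_{ST}$ without losing
independence, since the forms separate the $\varphi_{ST}$ and the algebra is torsion free. Its
embedding into functions on sorted pairs would then have too large a rank. -/
theorem eq_zero_of_pairings_eq_zero (hp : Params q z) {y : endAlg n q z}
    (hy : pairings n q z y = 0) : y = 0 := by
  classical
  by_contra hne
  have hli : LinearIndependent R (fun o : Option (PairIdx r n) => o.elim y (phiEnd hp)) := by
    rw [Fintype.linearIndependent_iff]
    intro g hg
    rw [Fintype.sum_option] at hg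
    simp only [Option.elim] at hg
    have h1 := congrArg (pairings n q z) hg
    rw [map_add, map_smul, hy, smul_zero, zero_add, map_zero] at h1
    have h2 := eq_zero_of_pairings hp (g := fun i => g (some i)) h1
    have h3 : ∀ i, g (some i) = 0 := congrFun h2
    intro o
    cases o with
    | some i => exact h3 i
    | none =>
      simp only [h3, zero_smul, Finset.sum_const_zero, add_zero] at hg
      by_contra hg0
      apply hne
      apply Subtype.ext
      ext u v
      have := congrFun (congrFun (congrArg Subtype.val hg) u) v
      exact (mul_eq_zero.1 this).resolve_left hg0
  have h2 := (hli.map' _ (LinearMap.ker_eq_bot.2 (sortedEntries_injective hp))).fintype_card_le_finrank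
  rw [Fintype.card_option, Module.finrank_fintype_fun_eq_card] at h2
  have h3 := Fintype.card_le_of_injective _ (rsk_injective (r := r) (n := n))
  omega

/-- The inverse Gram matrix, with entries in the ground ring, gives a combination of the
$\varphi_{ST}$ with the same values of all the forms; the difference vanishes. No denominators
arise. -/
theorem span_phiEnd (hp : Params q z) : ⊤ ≤ Submodule.span R (Set.range (phiEnd (n := n) hp)) := by
  classical
  rintro x -
  set c := pairings n q z x ᵥ* (gram hp)⁻¹ with hc
  have h : x - ∑ i, c i • phiEnd hp i = 0 := by
    apply eq_zero_of_pairings_eq_zero hp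
    rw [map_sub, pairings_sum, hc, Matrix.vecMul_vecMul,
      Matrix.nonsing_inv_mul _ ((Matrix.isUnit_iff_isUnit_det _).1 (isUnit_gram hp)),
      Matrix.vecMul_one, sub_self]
  rw [sub_eq_zero.1 h]
  exact Submodule.sum_mem _ fun i _ =>
    Submodule.smul_mem _ _ (Submodule.subset_span ⟨i, rfl⟩)

/-- The basis of `endAlg` formed by the `φ_{ST}`. -/
def phiBasis (n : ℕ) (hp : Params q z) : Module.Basis (PairIdx r n) R (endAlg n q z) :=
  Module.Basis.mk (linearIndependent_phiEnd hp) (span_phiEnd hp)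

@[simp] theorem phiBasis_apply (hp : Params q z) (i : PairIdx r n) :
    phiBasis n hp i = phiEnd hp i := Module.Basis.mk_apply _ _ _

/-! ### The multiplication rule -/

theorem SST.contentOf_colWord {l : RPart r n} (V : SST l) : contentOf (colWord V.tab) = V.type :=
  V.rel_colWord.contentOf_right V.isCount

theorem SST.type_le {l : RPart r n} (V : SST l) : V.type ≤ l.toComp := by
  rw [← V.contentOf_colWord, ← contentOf_colWord_nodeRow]
  exact contentOf_anti (nodeRow_le V.blockStrict (colWord_colour V))

theorem SST.colWord_of_type {l : RPart r n} {V : SST l} (h : V.type = l.toComp) :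
    colWord (l := l) nodeRow = colWord V.tab :=
  eq_of_le_of_contentOf (nodeRow_le V.blockStrict (colWord_colour V))
    ((contentOf_colWord_nodeRow l).trans (h.symm.trans V.contentOf_colWord.symm))

/-- The column reading of $V$ dominates the row word letter by letter and has the same content, so
they agree and each entry of $V$ is its own row. The joint multiplicities are then diagonal, which
leaves only the word $v_\lambda$. -/
theorem SST.rel_of_type {l : RPart r n} {V : SST l} (h : V.type = l.toComp) (u : Word r n) :
    Rel (tabCount V.tab) u (rowOf l.toComp) ↔ u = rowOf l.toComp := by
  have h0 : Rel (tabCount V.tab) (rowOf l.toComp) (rowOf l.toComp) := by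
    have h1 := V.rel_colWord
    rw [V.colWord_of_type h] at h1
    have e : rowOf l.toComp ∘ dWord (colWord V.tab) = colWord V.tab := by
      rw [← h, ← V.contentOf_colWord, rowOf_comp_dWord]
    rwa [← rel_comp (dWord (colWord V.tab)), e]
  refine ⟨fun hu => ?_, fun hu => hu ▸ h0⟩
  funext p
  by_contra hne
  have h2 := (hu (rowOf l.toComp p) (u p)).trans (h0 (rowOf l.toComp p) (u p)).symm
  have h3 : (Finset.univ.filter fun p' => rowOf l.toComp p' = rowOf l.toComp p ∧
      rowOf l.toComp p' = u p) = ∅ :=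
    Finset.filter_eq_empty_iff.2 fun p' _ hh => hne (hh.2.symm.trans hh.1)
  rw [h3, Finset.card_empty, Finset.card_eq_zero] at h2
  have : p ∈ Finset.univ.filter fun p' => rowOf l.toComp p' = rowOf l.toComp p ∧ u p' = u p := by
    simp
  rw [h2] at this
  exact absurd this (Finset.notMem_empty _)

/-- The defining sum of $\eta_V$ has the single term $v_\lambda\mapsto v_\lambda$ with weight $1$.
The projections to contents thus belong to the family of the $\eta$'s, which is the source of the
multiplication rule. -/
theorem etaT_of_type (hp : Params q z) {l : RPart r n} {V : SST l} (h : V.type = l.toComp) :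
    etaT hp V = contProj R l.toComp := by
  refine endAlg_ext hp (etaT_mem hp V) (contProj_mem _) fun ν u => ?_
  by_cases hν : ν = l.toComp
  · subst hν
    have e : ∀ ν, V.type = ν →
        (etaT hp V : Matrix (Word r n) (Word r n) R) u (rowOf ν) =
          etaVec q (tabCount V.tab) ν u := by
      rintro _ rfl
      exact eta_rowOf hp V.isCount u
    rw [e _ h, etaVec, contProj, Matrix.diagonal_apply]
    simp only [V.rel_of_type h]
    split_ifs with h1 h2
    · rw [h1, inv_eq_zero (rowOf_monotone _), pow_zero]
    · exact absurd ((congrArg contentOf h1).trans (contentOf_rowOf _)) h2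
    · rfl
  · have hc : contentOf (rowOf ν) ≠ l.toComp := by rwa [contentOf_rowOf]
    rw [etaT, eta_of_ne hp V.isCount (by rwa [h]), contProj, Matrix.diagonal_apply]
    split_ifs with h1 h2
    · exact absurd (h1 ▸ h2) hc
    · rfl
    · rfl

variable {l : RPart r n}

theorem contProj_mul_etaT (hp : Params q z) (V : SST l) :
    contProj R l.toComp * etaT hp V = etaT hp V := contProj_mul_eta hp V.isCount

theorem etaT_transpose_mul_contProj (hp : Params q z) (V : SST l) :
    (etaT hp V)ᵀ * contProj R l.toComp = (etaT hp V)ᵀ := by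
  have := congrArg Matrix.transpose (contProj_mul_etaT hp V)
  rwa [Matrix.transpose_mul, contProj_transpose] at this

theorem phiMat_mul_contProj (hp : Params q z) (U V : SST l) (ν : RComp r n) :
    phiMat hp U V * contProj R ν = if V.type = ν then phiMat hp U V else 0 := by
  ext u v
  rw [mul_contProj_apply]
  split_ifs with h1 h2 h2
  · rfl
  · exact phiMat_of_ne hp U V fun h => h2 (h.symm.trans h1)
  · exact (phiMat_of_ne hp U V fun h => h1 (h.trans h2)).symm
  · rfl

/-- The span of the `φ_{UV}` of the shapes in `P`. -/
def shapeSpan (hp : Params q z) (P : RPart r n → Prop) :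
    Submodule R (Matrix (Word r n) (Word r n) R) :=
  Submodule.span R {a | ∃ (m : RPart r n) (U V : SST m), P m ∧ a = phiMat hp U V}

theorem shapeSpan_mono (hp : Params q z) {P Q : RPart r n → Prop} (h : ∀ m, P m → Q m) :
    shapeSpan hp P ≤ shapeSpan hp Q :=
  Submodule.span_mono fun _ ⟨m, U, V, hm, e⟩ => ⟨m, U, V, h m hm, e⟩

/-- Elements of `endAlg` supported on the columns of content `l`. -/
theorem mem_sup_of_mul_contProj (hp : Params q z) {F : Matrix (Word r n) (Word r n) R}
    (hF : F ∈ endAlg n q z) (h : F * contProj R l.toComp = F) :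
    F ∈ Submodule.span R (Set.range fun U : SST l => (etaT hp U)ᵀ) ⊔ shapeSpan hp (l < ·) := by
  have h1 : (⟨F, hF⟩ : endAlg n q z) ∈ Submodule.span R (Set.range (phiEnd (n := n) hp)) :=
    span_phiEnd hp trivial
  have h2 := Submodule.mem_map_of_mem (f := LinearMap.mulRight R (contProj R l.toComp) ∘ₗ
    (endAlg n q z).val.toLinearMap) h1
  have e : (LinearMap.mulRight R (contProj R l.toComp) ∘ₗ (endAlg n q z).val.toLinearMap)
    ⟨F, hF⟩ = F := h
  rw [e, Submodule.map_span] at h2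
  refine Submodule.span_le.2 ?_ h2
  rintro _ ⟨_, ⟨⟨m, U, V⟩, rfl⟩, rfl⟩
  change phiMat hp U V * contProj R l.toComp ∈ _
  rw [phiMat_mul_contProj]
  split_ifs with hV
  -- Only basis elements whose second tableau has type $\lambda$ survive on the right of the
  -- projection, and a type is dominated by its shape.
  · have hle : l ≤ m := by
      change l.toComp ≤ m.toComp
      rw [← hV]
      exact V.type_le
    rcases hle.eq_or_lt with hlm | hlm
    · subst hlm
      refine Submodule.mem_sup_left (Submodule.subset_span ⟨U, ?_⟩)
      change (etaT hp U)ᵀ = phiMat hp U V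
      rw [phiMat, etaT_of_type hp hV, etaT_transpose_mul_contProj]
    · exact Submodule.mem_sup_right (Submodule.subset_span ⟨m, U, V, hlm, rfl⟩)
  · exact Submodule.zero_mem _

theorem mul_contProj_mul_mem (hp : Params q z) (l : RPart r n)
    {F G : Matrix (Word r n) (Word r n) R} (hF : F ∈ endAlg n q z) (hG : G ∈ endAlg n q z) :
    F * contProj R l.toComp * G ∈ shapeSpan hp (l ≤ ·) := by
  induction l using WellFoundedGT.induction generalizing F G with
  | ind l ih =>
    have hcp : contProj R l.toComp ∈ endAlg n q z := contProj_mem _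
    have key : ∀ (m : RPart r n) (U V : SST m) (A B : Matrix (Word r n) (Word r n) R),
        A ∈ endAlg n q z → B ∈ endAlg n q z → l < m →
          A * phiMat hp U V * B ∈ shapeSpan hp (l ≤ ·) := by
      intro m U V A B hA hB hm
      -- Every $\varphi_{UV}$ of shape $m$ factors through the projection to content $m$, so the
      -- induction hypothesis for the larger shape applies to it with arbitrary factors on both
      -- sides.
      have e : A * phiMat hp U V * B =
          A * (etaT hp U)ᵀ * contProj R m.toComp * (etaT hp V * B) := by
        rw [phiMat, mul_assoc (A * _), ← mul_assoc (contProj R _), contProj_mul_etaT]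
        simp only [mul_assoc]
      rw [e]
      exact shapeSpan_mono hp (fun _ h => hm.le.trans h) (ih m hm
        (mul_mem hA (transpose_mem_endAlg (etaT_mem hp U))) (mul_mem (etaT_mem hp V) hB))
    have h1 : F * contProj R l.toComp ∈ _ := mem_sup_of_mul_contProj hp (l := l)
      (mul_mem hF hcp) (by rw [mul_assoc, contProj_mul_self])
    have h2 : (contProj R l.toComp * G)ᵀ ∈ _ := mem_sup_of_mul_contProj hp (l := l)
      (transpose_mem_endAlg (mul_mem hcp hG))
      (by rw [Matrix.transpose_mul, contProj_transpose, mul_assoc, contProj_mul_self])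
    have e : F * contProj R l.toComp * G =
        F * contProj R l.toComp * (contProj R l.toComp * G) := by
      rw [← mul_assoc, mul_assoc F (contProj R _) (contProj R _), contProj_mul_self]
    have hPG : contProj R l.toComp * G ∈ endAlg n q z := mul_mem hcp hG
    rw [e]
    generalize F * contProj R l.toComp = A at h1
    generalize contProj R l.toComp * G = B at h2 hPG
    rw [shapeSpan, ← Submodule.span_union] at h1
    rw [shapeSpan, ← Submodule.span_union] at h2
    -- The left factor is a combination of $\eta_U^{\mathsf T}$ and larger terms, and the transpose
    -- of the right factor likewise. The products of the leading terms are the $\varphi_{UV}$ of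
    -- shape $\lambda$.
    induction h1 using Submodule.span_induction with
    | mem x hx =>
      rcases hx with ⟨U, rfl⟩ | ⟨m, U, V, hm, rfl⟩
      · obtain ⟨C, rfl⟩ : ∃ C, B = Cᵀ := ⟨Bᵀ, rfl⟩
        rw [Matrix.transpose_transpose] at h2
        clear hPG
        induction h2 using Submodule.span_induction with
        | mem x hx =>
          rcases hx with ⟨V, rfl⟩ | ⟨m, U', V', hm, rfl⟩
          · exact Submodule.subset_span ⟨l, U, V, le_rfl, by rw [Matrix.transpose_transpose]; rfl⟩
          · have := key m V' U' (etaT hp U)ᵀ 1 (transpose_mem_endAlg (etaT_mem hp U))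
              (one_mem _) hm
            rwa [mul_one, ← phiMat_transpose] at this
        | zero => rw [Matrix.transpose_zero, mul_zero]; exact Submodule.zero_mem _
        | add x y _ _ hx hy =>
          rw [Matrix.transpose_add, mul_add]; exact Submodule.add_mem _ hx hy
        | smul c x _ hx =>
          rw [Matrix.transpose_smul, mul_smul_comm]; exact Submodule.smul_mem _ c hx
      · have := key m U V 1 B (one_mem _) hPG hm
        rwa [one_mul] at this
    | zero => rw [zero_mul]; exact Submodule.zero_mem _
    | add x y _ _ hx hy => rw [add_mul]; exact Submodule.add_mem _ hx hy
    | smul c x _ hx => rw [smul_mul_assoc]; exact Submodule.smul_mem _ c hx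

/-- A generator $\varphi_{UV}=\eta_U^{\mathsf T}P_m\eta_V$ of shape $m$ absorbs a factor on the
right into $\eta_V$, and a product through $P_m$ only involves shapes $\unrhd m$. -/
theorem mul_mem_shapeSpan (hp : Params q z) {F G : Matrix (Word r n) (Word r n) R}
    (hF : F ∈ shapeSpan hp (l < ·)) (hG : G ∈ endAlg n q z) :
    F * G ∈ shapeSpan hp (l < ·) := by
  induction hF using Submodule.span_induction with
  | mem x hx =>
    obtain ⟨m, U, V, hm, rfl⟩ := hx
    have h := mul_contProj_mul_mem hp m (transpose_mem_endAlg (etaT_mem hp U))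
      (mul_mem (etaT_mem hp V) hG)
    rw [etaT_transpose_mul_contProj, ← mul_assoc] at h
    exact shapeSpan_mono hp (fun _ h => hm.trans_le h) h
  | zero => rw [zero_mul]; exact Submodule.zero_mem _
  | add x y _ _ hx hy => rw [add_mul]; exact Submodule.add_mem _ hx hy
  | smul c x _ hx => rw [smul_mul_assoc]; exact Submodule.smul_mem _ c hx

/-- The coefficients come from expanding $F\eta_S^{\mathsf T}$ before $T$ enters; multiplying by
$\eta_T$ afterwards shows that they serve all $T$ at once. -/
theorem exists_mul_phiMat (hp : Params q z) (l : RPart r n) {F : Matrix (Word r n) (Word r n) R}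
    (hF : F ∈ endAlg n q z) (S : SST l) : ∃ c : SST l → R, ∀ T : SST l,
      F * phiMat hp S T - ∑ U, c U • phiMat hp U T ∈ shapeSpan hp (l < ·) := by
  have h := mem_sup_of_mul_contProj hp (l := l)
    (mul_mem hF (transpose_mem_endAlg (etaT_mem hp S)))
    (by rw [mul_assoc, etaT_transpose_mul_contProj])
  obtain ⟨y, hy, w, hw, e⟩ := Submodule.mem_sup.1 h
  obtain ⟨c, rfl⟩ := (Submodule.mem_span_range_iff_exists_fun R).1 hy
  refine ⟨c, fun T => ?_⟩
  have h2 := mul_mem_shapeSpan hp hw (etaT_mem hp T)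
  rw [← eq_sub_iff_add_eq'] at e
  rw [e, sub_mul, Finset.sum_mul, mul_assoc] at h2
  simpa only [smul_mul_assoc, phiMat] using h2

end BasisThm

end

end YokonumaSchur

namespace YokonumaSchur

noncomputable section

open scoped RightActions Matrix

/-! ### The parameters of the ground ring -/

section GroundParams

open Polynomial

variable (r : ℕ)

instance : IsDomain (Ground r) := inferInstanceAs (IsDomain (LaurentPolynomial (Coeff r)))

/-- The specialization `q = 1`. -/
def evalOne : Ground r →+* ℂ :=
  LaurentPolynomial.eval₂ (Algebra.adjoin ℤ ({(r : ℂ)⁻¹, zetaC r} : Set ℂ)).val.toRingHom 1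

theorem evalOne_q : evalOne r (qGround r) = 1 :=
  (LaurentPolynomial.eval₂_T _ _ 1).trans (by simp)

theorem evalOne_q_inv : evalOne r ((qGround r)⁻¹ : (Ground r)ˣ) = 1 :=
  (LaurentPolynomial.eval₂_T _ _ (-1)).trans (by simp)

theorem constGround_injective : Function.Injective (constGround r) := by
  intro a b h
  apply Polynomial.C_injective
  apply Polynomial.toLaurent_injective
  rw [Polynomial.toLaurent_C, Polynomial.toLaurent_C]
  exact h

theorem isPrimitiveRoot_zetaGround [NeZero r] : IsPrimitiveRoot (zetaGround r) r := by
  refine IsPrimitiveRoot.map_of_injective (f := constGround r) ?_ (constGround_injective r)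
  refine IsPrimitiveRoot.of_map_of_injective
    (f := (Algebra.adjoin ℤ ({(r : ℂ)⁻¹, zetaC r} : Set ℂ)).val) ?_ Subtype.val_injective
  exact Complex.isPrimitiveRoot_exp r (NeZero.ne r)

variable {r} [NeZero r] (σ : Equiv.Perm (Fin r))

theorem roots_injective : Function.Injective (roots σ) := by
  intro a b h
  exact σ.injective (Fin.ext ((isPrimitiveRoot_zetaGround r).pow_inj (σ a).2 (σ b).2 h))

theorem prod_X_sub_roots : ∏ l, (X - C (roots σ l)) = X ^ r - 1 := by
  classical
  rw [X_pow_sub_one_eq_prod (NeZero.pos r) (isPrimitiveRoot_zetaGround r)]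
  have e : nthRootsFinset r (1 : Ground r) = Finset.univ.image (roots σ) := by
    symm
    refine Finset.eq_of_subset_of_card_le ?_ ?_
    · intro x hx
      obtain ⟨l, -, rfl⟩ := Finset.mem_image.1 hx
      rw [mem_nthRootsFinset (NeZero.pos r), roots, ← pow_mul, mul_comm, pow_mul,
        (isPrimitiveRoot_zetaGround r).pow_eq_one, one_pow]
    · rw [(isPrimitiveRoot_zetaGround r).card_nthRootsFinset,
        Finset.card_image_of_injective _ (roots_injective σ), Finset.card_univ, Fintype.card_fin]
  rw [e, Finset.prod_image fun a _ b _ h => roots_injective σ h]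

/-- Both nonvanishing conditions are seen after the specialisation $q=1$, where $q+q^{-1}$ becomes
$2$ and the weighted sum becomes the number of its terms. -/
theorem params_ground : Params (qGround r) (roots σ) where
  prod_eq := prod_X_sub_roots σ
  inj := roots_injective σ
  q_add h := by
    have := congrArg (evalOne r) h
    rw [map_add, evalOne_q, evalOne_q_inv, map_zero] at this
    norm_num at this
  poincare n s hs h := by
    have := congrArg (evalOne r) h
    simp only [map_sum, map_pow, evalOne_q, one_pow, Finset.sum_const, nsmul_eq_mul, mul_one,
      map_zero, Nat.cast_eq_zero, Finset.card_eq_zero] at this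
    exact hs.ne_empty this

end GroundParams

/-! ### The cellular basis of the Yokonuma–Schur algebra -/

section Cellularity

variable {R : Type*} [CommRing R] {r n : ℕ} {q : Rˣ} {z : Fin r → R} [Invertible (r : R)]
  [IsDomain R]

/-- Transposition on `endAlg`. -/
def transposeEnd (n : ℕ) (q : Rˣ) (z : Fin r → R) : endAlg n q z ≃ₗ[R] endAlg n q z where
  toFun F := ⟨F.1ᵀ, transpose_mem_endAlg F.2⟩
  invFun F := ⟨F.1ᵀ, transpose_mem_endAlg F.2⟩
  map_add' _ _ := rfl
  map_smul' _ _ := rfl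
  left_inv _ := rfl
  right_inv _ := rfl

/-- The anti-automorphism `*` of the Yokonuma–Schur algebra. -/
def ysStar (n : ℕ) (hp : Params q z) : YS n q z ≃ₗ[R] YS n q z :=
  (ysEquiv hp).symm.toLinearEquiv ≪≫ₗ transposeEnd n q z ≪≫ₗ (ysEquiv hp).toLinearEquiv

theorem ysStar_apply (hp : Params q z) (a : YS n q z) :
    ysStar n hp a = ysEquiv hp (transposeEnd n q z ((ysEquiv hp).symm a)) := rfl

theorem ysStar_ysStar (hp : Params q z) (a : YS n q z) : ysStar n hp (ysStar n hp a) = a := by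
  rw [ysStar_apply, ysStar_apply, AlgEquiv.symm_apply_apply]
  exact (ysEquiv hp).apply_symm_apply a

theorem ysStar_mul (hp : Params q z) (a b : YS n q z) :
    ysStar n hp (a * b) = ysStar n hp b * ysStar n hp a := by
  rw [ysStar_apply, ysStar_apply, ysStar_apply, ← map_mul, map_mul (ysEquiv hp).symm]
  congr 1
  exact Subtype.ext (Matrix.transpose_mul _ _)

/-- The basis of the Yokonuma–Schur algebra formed by the `φ_{ST}`. -/
def ysBasis (n : ℕ) (hp : Params q z) : Module.Basis (Σ l : RPart r n, SST l × SST l) R (YS n q z) :=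
  (phiBasis n hp).map (ysEquiv hp).toLinearEquiv

theorem ysBasis_apply (hp : Params q z) (i : PairIdx r n) :
    ysBasis n hp i = ysEquiv hp (phiEnd hp i) := by
  rw [ysBasis, Module.Basis.map_apply, phiBasis_apply]
  rfl

theorem isPhi_ysBasis (hp : Params q z) (l : RPart r n) (S T : SST l) :
    IsPhi S T (ysBasis n hp ⟨l, S, T⟩) := by
  rw [ysBasis_apply]
  exact isPhi_phiMat hp S T

theorem ysStar_ysBasis (hp : Params q z) (l : RPart r n) (S T : SST l) :
    ysStar n hp (ysBasis n hp ⟨l, S, T⟩) = ysBasis n hp ⟨l, T, S⟩ := by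
  rw [ysBasis_apply, ysBasis_apply, ysStar_apply, AlgEquiv.symm_apply_apply]
  congr 1
  exact Subtype.ext (phiMat_transpose hp S T)

/-- The ideals of larger shapes on the matrix side and in YS are spanned by corresponding basis
elements, so the rule proved for matrices can be transported. -/
theorem ysEquiv_mem_cellAbove (hp : Params q z) {l : RPart r n} {F : endAlg n q z}
    (h : F.1 ∈ shapeSpan hp (l < ·)) : ysEquiv hp F ∈ cellAbove (ysBasis n hp) l := by
  have key : shapeSpan hp (l < ·) ≤ ((cellAbove (ysBasis n hp) l).comap
      (ysEquiv hp).toLinearMap).map (endAlg n q z).val.toLinearMap := by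
    refine Submodule.span_le.2 ?_
    rintro _ ⟨m, U, V, hm, rfl⟩
    refine ⟨phiEnd hp ⟨m, U, V⟩, ?_, rfl⟩
    exact Submodule.subset_span ⟨m, U, V, hm, (ysBasis_apply hp ⟨m, U, V⟩).symm⟩
  obtain ⟨G, hG, e⟩ := key h
  have : G = F := Subtype.ext e
  rw [← this]
  exact hG

theorem exists_mul_ysBasis (hp : Params q z) (l : RPart r n) (a : YS n q z) (U : SST l) :
    ∃ c : SST l → R, ∀ V : SST l,
      a * ysBasis n hp ⟨l, U, V⟩ - ∑ W, c W • ysBasis n hp ⟨l, W, V⟩ ∈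
        cellAbove (ysBasis n hp) l := by
  obtain ⟨c, hc⟩ := exists_mul_phiMat hp l ((ysEquiv hp).symm a).2 U
  refine ⟨c, fun V => ?_⟩
  have := ysEquiv_mem_cellAbove hp (l := l) (F := (ysEquiv hp).symm a * phiEnd hp ⟨l, U, V⟩ -
    ∑ W, c W • phiEnd hp ⟨l, W, V⟩) (by
      have h := hc V
      convert h using 1
      rw [AddSubgroupClass.coe_sub, AddSubmonoidClass.coe_finsetSum]
      rfl)
  rw [map_sub, map_mul, map_sum, AlgEquiv.apply_symm_apply] at this
  simpa only [map_smul, ysBasis_apply] using this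

theorem ysStar_mem_cellAbove (hp : Params q z) {l : RPart r n} {a : YS n q z}
    (h : a ∈ cellAbove (ysBasis n hp) l) : ysStar n hp a ∈ cellAbove (ysBasis n hp) l := by
  have key : cellAbove (ysBasis n hp) l ≤
      (cellAbove (ysBasis n hp) l).comap (ysStar n hp).toLinearMap := by
    refine Submodule.span_le.2 ?_
    rintro _ ⟨m, U, V, hm, rfl⟩
    exact Submodule.subset_span ⟨m, V, U, hm, ysStar_ysBasis hp m U V⟩
  exact key h

/-- The right-hand rule is the image under $*$ of the left-hand rule for $f^*$; the ideal of larger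
shapes is stable under $*$. -/
theorem exists_ysBasis_mul (hp : Params q z) (l : RPart r n) (T : SST l) (f : YS n q z) :
    ∃ c : SST l → R, ∀ S : SST l,
      ysBasis n hp ⟨l, S, T⟩ * f - ∑ V, c V • ysBasis n hp ⟨l, S, V⟩ ∈
        cellAbove (ysBasis n hp) l := by
  obtain ⟨c, hc⟩ := exists_mul_ysBasis hp l (ysStar n hp f) T
  refine ⟨c, fun S => ?_⟩
  have := ysStar_mem_cellAbove hp (hc S)
  rw [map_sub, ysStar_mul, ysStar_ysStar, map_sum, ysStar_ysBasis] at this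
  simpa only [map_smul, ysStar_ysBasis] using this

theorem isCellularBasis_ysBasis (hp : Params q z) :
    IsCellularBasis (R := R) (A := YS n q z) (ysBasis n hp) where
  exists_involution := ⟨(ysStar n hp).toLinearMap, ysStar_ysStar hp, ysStar_mul hp,
    ysStar_ysBasis hp⟩
  mul_rule l a := by
    choose c hc using exists_mul_ysBasis hp l a
    exact ⟨fun W U => c U W, fun U V => hc U V⟩

end Cellularity

end

end YokonumaSchur


theorem theorem3p9 (r n : ℕ) [NeZero r] (σ : Equiv.Perm (Fin r)) :
    ∃ φ : Module.Basis (Σ l : RPart r n, SST l × SST l) (Ground r)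
        (YS n (qGround r) (roots σ)),
      -- the basis elements are the maps `φ_{ST}`
      (∀ (l : RPart r n) (S T : SST l), IsPhi S T (φ ⟨l, S, T⟩)) ∧
      -- (i) `φ_{ST} ↦ φ_{TS}` is an anti-automorphism
      (∃ star : YS n (qGround r) (roots σ) ≃ₗ[Ground r] YS n (qGround r) (roots σ),
        (∀ (l : RPart r n) (S T : SST l), star (φ ⟨l, S, T⟩) = φ ⟨l, T, S⟩) ∧
        ∀ a b, star (a * b) = star b * star a) ∧
      -- (ii) the multiplication rule modulo the span of the `φ_{UV}` of shape `▷ l`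
      (∀ (l : RPart r n) (T : SST l) (f : YS n (qGround r) (roots σ)),
        ∃ c : SST l → Ground r, ∀ S : SST l,
          φ ⟨l, S, T⟩ * f - ∑ V, c V • φ ⟨l, S, V⟩ ∈ cellAbove φ l) ∧
      -- the basis is cellular
      IsCellularBasis (R := Ground r) (A := YS n (qGround r) (roots σ)) φ :=
  have hp := params_ground σ
  ⟨ysBasis n hp, isPhi_ysBasis hp, ⟨ysStar n hp, ysStar_ysBasis hp, ysStar_mul hp⟩,
    exists_ysBasis_mul hp, isCellularBasis_ysBasis hp⟩
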